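/- Let $N\ge 1$, let $\lambda$ be a partition of $N$, let $\mathbb K\supseteq\mathbb Q$ be a field and let $q,s\in\mathbb K$ be algebraically independent over $\mathbb Q$. Operators act on the right (a product $AB$ means first $A$, then $B$). *Tableaux.* A reverse standard tableau (RST) of shape $\lambda$ is a filling of $\lambda$ (French notation: rows numbered from the bottom, the bottom row being the longest) by $1,\dots,N$, strictly decreasing along rows (left to right) and columns (bottom to top). ${\rm ROW}_{\mathbb T}[i]$, ${\rm COL}_{\mathbb T}[i]$ are the row and column of the entry $i$, and ${\rm CT}_{\mathbb T}[i]={\rm COL}_{\mathbb T}[i]-{\rm ROW}_{\mathbb T}[i]$; $\mathbb T^{(i,j)}$ is $\mathbb T$ with the entries $i,j$ exchanged. Let $V_\lambda$ be the $\mathbb K$-space with basis the RST of shape $\lambda$. With $m={\rm CT}_{\mathbb T}[i+1]-{\rm CT}_{\mathbb T}[i]$, the Hecke generator $T_i$ ($1\le i<N$) acts by: $\mathbb TT_i=s\mathbb T$ if $i,i+1$ are in the same row; $\mathbb TT_i=-\mathbb T$ if they are in the same column; $\mathbb TT_i=-\frac{1-s}{1-s^m}\mathbb T+\mathbb T^{(i,i+1)}$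 if ${\rm ROW}_{\mathbb T}[i]<{\rm ROW}_{\mathbb T}[i+1]$ and they are not in the same column; $\mathbb TT_i=-\frac{1-s}{1-s^m}\mathbb T+\frac{s(1-s^{m+1})(1-s^{m-1})}{(1-s^m)^2}\mathbb T^{(i,i+1)}$ if ${\rm ROW}_{\mathbb T}[i]>{\rm ROW}_{\mathbb T}[i+1]$ and they are not in the same column. *Operators.* Let $\mathcal M_\lambda=\mathbb K[x_1,\dots,x_N]\otimes V_\lambda$. Let $s_i^x$ exchange $x_i$ and $x_{i+1}$, let $p\,\partial_i^x=\frac{p-ps_i^x}{x_i-x_{i+1}}$, and let $\tau_1^x$ replace $x_1$ by $qx_1$. Put ${\bf T}_i=(1-s)\partial_i^xx_{i+1}+s_i^xT_i$, ${\bf T}_i^{-1}=\frac1s({\bf T}_i+1-s)$, ${\bf w}=\tau_1^xs_1^x\cdots s_{N-1}^xT_1\cdots T_{N-1}$, $\boldsymbol\xi_N={\bf T}_{N-1}^{-1}\cdots{\bf T}_1^{-1}{\bf w}$, ${\bf D}_N=(1-\boldsymbol\xi_N)x_N^{-1}$, ${\bf D}_i=\frac1s{\bf T}_i{\bf D}_{i+1}{\bf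 T}_i$ for $i<N$, and $\boldsymbol\Phi={\bf T}_1^{-1}\cdots{\bf T}_{N-1}^{-1}x_N$. *Macdonald polynomials.* For $v\in\mathbb N^N$ let $r_v[i]=\#\{j\le i: v[j]\ge v[i]\}+\#\{j>i: v[j]>v[i]\}$, and for an RST $\mathbb T$ let $\zeta=\zeta_{v,\mathbb T}$ be the spectral vector $\zeta[i]=q^{v[i]}s^{{\rm CT}_{\mathbb T}[r_v[i]]}$. Consider the directed graph on the pairs $(\mathbb T,v)$ whose root is $(\mathbb T_\lambda,0^N)$, where $\mathbb T_\lambda$ is filled column by column from left to right, each column from bottom to top, with $N,N-1,\dots,1$, and whose arrows carry polynomials as follows: the root carries $\mathbb T_\lambda$, and from $(\mathbb T,v)$ carrying $P$, with $\zeta=\zeta_{v,\mathbb T}$, there are - if $v[i]<v[i+1]$, an arrow to $(\mathbb T,vs_i)$ giving $P\Big({\bf T}_i+\frac{1-s}{1-\zeta[i+1]/\zeta[i]}\Big)$, where $vs_i$ is $v$ with entries $i,i+1$ exchanged; - if $v[i]=v[i+1]$ and, with $k=r_v[i]$ (so $r_v[i+1]=k+1$), ${\rm CT}_{\mathbb T}[k]\ge{\rm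 CT}_{\mathbb T}[k+1]+2$, an arrow to $(\mathbb T^{(k,k+1)},v)$ giving the same expression; - an arrow to $(\mathbb T,[v[2],\dots,v[N],v[1]+1])$ giving $P\boldsymbol\Phi$. *Bilinear form.* Let $\nu(\mathbb T)=\prod_{i<j,\ {\rm CT}_{\mathbb T}[i]-{\rm CT}_{\mathbb T}[j]\le-2}\frac{(1-s^{d-1})(1-s^{d+1})}{(1-s^{d})^2}$ with $d={\rm CT}_{\mathbb T}[j]-{\rm CT}_{\mathbb T}[i]$, and let $\langle\,,\rangle$ be the $\mathbb K$-bilinear form on $\mathcal M_\lambda\times\mathcal M_\lambda$ for which $\langle x^v\mathbb T,Q\rangle$ is $\nu(\mathbb T)$ times the coefficient of $x^0\,\mathbb T$ in $Q{\bf D}_1^{v[1]}\cdots{\bf D}_N^{v[N]}$. **Theorem.** The form $\langle\,,\rangle$ satisfies $\langle\mathbb T_1,\mathbb T_2\rangle=\delta_{\mathbb T_1,\mathbb T_2}\nu(\mathbb T_1)$, $\langle\mathbb T_1,x^v\mathbb T_2\rangle=0$ for $v\ne0$, and $\langle Px_i,Q\rangle=\langle P,Q{\bf D}_i\rangle$ for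 all $i,P,Q$. Let $v\in\mathbb N^N$, let $\mathbb T$ be an RST of shape $\lambda$, and $\zeta=\zeta_{v,\mathbb T}$. Then $(\mathbb T,v)$ is reached by a path from the root, and the resulting polynomial $P_\zeta$ does not depend on the path; the same holds with $(q,s)$ replaced by $(q^{-1},s^{-1})$ in the whole construction of the polynomials, which gives a polynomial $P_\zeta^*$. Moreover $$\langle P_\zeta^*,P_\zeta\rangle=\Box(\zeta)\,\triangle(\zeta).$$ Here $\Box(\zeta)=\prod_{i=1}^N\Box(\zeta[i])$ with $\Box(q^as^m)=(qs^m;q)_a=\prod_{k=1}^a(1-q^ks^m)$, and $$\triangle(\zeta)=\prod_{\substack{1\le i,j\le N,\ k\ge\chi(i,j)\\ \zeta[i]\succ\zeta[j]q^k}}\rho(\zeta[j]q^k,\zeta[i]),\qquad \rho(a,b)=\frac{(a-s^{-1}b)(a-sb)}{(a-b)^2},$$ where $\chi(i,j)=1$ if $j<i$ and $\chi(i,j)=0$ if $j\ge i$, and $q^{a_1}s^{m_1}\succ q^{a_2}s^{m_2}$ means $a_1>a_2$, or $a_1=a_2$ and $m_1\le m_2-2$. -/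

import Mathlib

/-! Vector valued nonsymmetric Macdonald polynomials. Throughout, `N = n + 1`, so that entries of
tableaux and indices of variables are elements of `Fin (n + 1)`, and the index `i : Fin n` of a
generator stands for the adjacent pair `(i.castSucc, i.succ)`. All operators act on the right in the
mathematical text: a product `A B` means "first `A`, then `B`", which is rendered by `opSeq`. -/

namespace VVMac

/-- Reverse standard tableaux of shape `μ` with entries `0, …, n`: fillings that are strictly
decreasing along rows (increasing column index) and along columns (increasing row index). Row `0` is
the longest row. -/
structure RST (n : ℕ) (μ : YoungDiagram) where
  cell : Fin (n + 1) ≃ μ.cells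
  row_decr : ∀ i j, (cell i : ℕ × ℕ).1 = (cell j : ℕ × ℕ).1 →
    (cell i : ℕ × ℕ).2 < (cell j : ℕ × ℕ).2 → j < i
  col_decr : ∀ i j, (cell i : ℕ × ℕ).2 = (cell j : ℕ × ℕ).2 →
    (cell i : ℕ × ℕ).1 < (cell j : ℕ × ℕ).1 → j < i

namespace RST

variable {n : ℕ} {μ : YoungDiagram}

theorem cell_injective : Function.Injective (RST.cell : RST n μ → (Fin (n + 1) ≃ μ.cells)) := by
  intro A B h
  cases A
  cases B
  cases h
  rfl

noncomputable instance : Fintype (RST n μ) :=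
  @Fintype.ofFinite _ (Finite.of_injective _ cell_injective)

noncomputable instance : DecidableEq (RST n μ) := Classical.decEq _

/-- The row of the entry `i`. -/
def row (T : RST n μ) (i : Fin (n + 1)) : ℕ := (T.cell i : ℕ × ℕ).1

/-- The column of the entry `i`. -/
def col (T : RST n μ) (i : Fin (n + 1)) : ℕ := (T.cell i : ℕ × ℕ).2

/-- The content of the entry `i`. -/
def ct (T : RST n μ) (i : Fin (n + 1)) : ℤ := (T.col i : ℤ) - (T.row i : ℤ)

/-- `T'` is obtained from `T` by exchanging the entries `i` and `j`. -/
def IsSwap (T T' : RST n μ) (i j : Fin (n + 1)) : Prop :=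
  T'.cell = (Equiv.swap i j).trans T.cell

/-- The tableau obtained by filling the columns from left to right, each one from its longest-row end
upwards, with `n, n - 1, …, 0`: the greater of two entries has the lexicographically smaller
`(column, row)`. -/
def IsRoot (T : RST n μ) : Prop :=
  ∀ i j, j < i ↔ T.col i < T.col j ∨ (T.col i = T.col j ∧ T.row i < T.row j)

end RST

open RST MvPolynomial

variable {K : Type*} [Field K] {n : ℕ} {μ : YoungDiagram}

/-- Vector valued polynomials `K[x_0, …, x_n] ⊗ V_μ`, where `V_μ` has the basis `RST n μ`: the family
`(p_A)` stands for `∑ A, p_A ⊗ A`. -/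
abbrev VPoly (K : Type*) [Field K] (n : ℕ) (μ : YoungDiagram) : Type _ :=
  RST n μ → MvPolynomial (Fin (n + 1)) K

/-- The pure tensor `p ⊗ A`. -/
noncomputable def tens (p : MvPolynomial (Fin (n + 1)) K) (A : RST n μ) : VPoly K n μ :=
  Pi.single A p

/-- The right-acting product of a list of operators: the head of the list is applied first. -/
def opSeq {M : Type*} [AddCommGroup M] [Module K M] (l : List (Module.End K M)) : Module.End K M :=
  l.foldl (fun acc f => f ∘ₗ acc) LinearMap.id

/-! ### Operators on the tableaux -/

open Classical in
/-- The coefficient of the tableau `B` in `A T_i`, the action of the Hecke algebra with parameter `s`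
on `V_μ`. -/
noncomputable def tabCoeff (s : K) (i : Fin n) (A B : RST n μ) : K :=
  let m : ℤ := A.ct i.succ - A.ct i.castSucc
  if A.row i.castSucc = A.row i.succ then (if B = A then s else 0)
  else if A.col i.castSucc = A.col i.succ then (if B = A then -1 else 0)
  else if B = A then -((1 - s) / (1 - s ^ m))
  else if IsSwap A B i.castSucc i.succ then
    (if A.row i.castSucc < A.row i.succ then 1
      else s * (1 - s ^ (m + 1)) * (1 - s ^ (m - 1)) / (1 - s ^ m) ^ 2)
  else 0

/-- `T_i` acting on the tableaux only: `p ⊗ A ↦ p ⊗ A T_i`. -/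
noncomputable def tabT (s : K) (i : Fin n) : Module.End K (VPoly K n μ) :=
  ∑ A : RST n μ, ∑ B : RST n μ, tabCoeff s i A B •
    (LinearMap.single K (fun _ : RST n μ => MvPolynomial (Fin (n + 1)) K) B ∘ₗ LinearMap.proj A)

/-! ### Operators on the polynomials -/

/-- `s_i` on polynomials: exchange of `x_i` and `x_{i+1}`. -/
noncomputable def swapX (i : Fin n) : Module.End K (MvPolynomial (Fin (n + 1)) K) :=
  (rename (Equiv.swap i.castSucc i.succ)).toLinearMap

theorem exists_divDiff (i : Fin n) (p : MvPolynomial (Fin (n + 1)) K) :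
    ∃ g : MvPolynomial (Fin (n + 1)) K, (X i.castSucc - X i.succ) * g = p - swapX i p := by
  suffices h : (X i.castSucc - X i.succ : MvPolynomial (Fin (n + 1)) K) ∣ p - swapX i p by
    obtain ⟨g, hg⟩ := h
    exact ⟨g, hg.symm⟩
  induction p using MvPolynomial.induction_on with
  | C a => simp [swapX]
  | add p r hp hr =>
    have : p + r - swapX i (p + r) = (p - swapX i p) + (r - swapX i r) := by
      rw [map_add]; ring
    rw [this]
    exact dvd_add hp hr
  | mul_X p j hp =>
    have h1 : p * X j - swapX i (p * X j)
        = (p - swapX i p) * X j + swapX i p * (X j - X (Equiv.swap i.castSucc i.succ j)) := by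
      simp only [swapX, AlgHom.toLinearMap_apply, map_mul, rename_X]
      ring
    rw [h1]
    refine dvd_add (Dvd.dvd.mul_right hp _) (Dvd.dvd.mul_left ?_ _)
    by_cases ha : j = i.castSucc
    · subst ha
      simp
    · by_cases hb : j = i.succ
      · subst hb
        rw [Equiv.swap_apply_right]
        exact ⟨-1, by ring⟩
      · rw [Equiv.swap_apply_of_ne_of_ne ha hb]
        simp

theorem X_sub_X_ne_zero (i : Fin n) :
    (X i.castSucc - X i.succ : MvPolynomial (Fin (n + 1)) K) ≠ 0 := by
  intro h
  have h2 := X_injective (R := K) (sub_eq_zero.mp h)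
  exact absurd h2 (Fin.castSucc_lt_succ (i := i)).ne

/-- The divided difference `p ∂_i = (p - p s_i) / (x_i - x_{i+1})`. -/
noncomputable def divDiff (i : Fin n) : Module.End K (MvPolynomial (Fin (n + 1)) K) where
  toFun p := (exists_divDiff i p).choose
  map_add' p r := by
    apply mul_left_cancel₀ (X_sub_X_ne_zero i)
    rw [mul_add, (exists_divDiff i p).choose_spec, (exists_divDiff i r).choose_spec,
      (exists_divDiff i (p + r)).choose_spec, map_add]
    ring
  map_smul' c p := by
    apply mul_left_cancel₀ (X_sub_X_ne_zero i)
    rw [RingHom.id_apply, mul_smul_comm, (exists_divDiff i p).choose_spec,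
      (exists_divDiff i (c • p)).choose_spec, map_smul, smul_sub]

theorem divDiff_spec (i : Fin n) (p : MvPolynomial (Fin (n + 1)) K) :
    (X i.castSucc - X i.succ) * divDiff i p = p - swapX i p :=
  (exists_divDiff i p).choose_spec

/-- `δ_i = (1 - s) ∂_i x_{i+1}` (first `∂_i`, then multiplication by `x_{i+1}`). -/
noncomputable def deltaX (s : K) (i : Fin n) : Module.End K (MvPolynomial (Fin (n + 1)) K) :=
  (1 - s) • (LinearMap.mulLeft K (X i.succ) ∘ₗ divDiff i)

/-- `τ_1`: the first variable is multiplied by `q`. -/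
noncomputable def tauX (q : K) : Module.End K (MvPolynomial (Fin (n + 1)) K) :=
  (aeval (fun j : Fin (n + 1) => if j = 0 then C q * X j else X j)).toLinearMap

/-- Exact division by the last variable (on polynomials that are multiples of it). -/
noncomputable def divLastX : Module.End K (MvPolynomial (Fin (n + 1)) K) where
  toFun p := p.divMonomial (Finsupp.single (Fin.last n) 1)
  map_add' p r := add_divMonomial p r _
  map_smul' c p := by
    ext m
    simp [coeff_divMonomial, coeff_smul]

/-! ### Operators on vector valued polynomials -/

/-- An operator on polynomials, applied to all components. -/
noncomputable def onX (f : Module.End K (MvPolynomial (Fin (n + 1)) K)) :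
    Module.End K (VPoly K n μ) :=
  f.compLeft (RST n μ)

/-- Multiplication by the variable `x_i`. -/
noncomputable def mulX (i : Fin (n + 1)) : Module.End K (VPoly K n μ) :=
  onX (LinearMap.mulLeft K (X i))

/-- `𝐓_i = δ_i^x + s_i^x T_i`. -/
noncomputable def boldT (s : K) (i : Fin n) : Module.End K (VPoly K n μ) :=
  onX (deltaX s i) + tabT s i ∘ₗ onX (swapX i)

/-- `𝐓_i⁻¹ = (1/s) (𝐓_i + 1 - s)`. -/
noncomputable def boldTinv (s : K) (i : Fin n) : Module.End K (VPoly K n μ) :=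
  s⁻¹ • (boldT s i + (1 - s) • LinearMap.id)

/-- `𝐰 = τ_1^x s_1^x ⋯ s_{N-1}^x T_1 ⋯ T_{N-1}`. -/
noncomputable def boldW (q s : K) : Module.End K (VPoly K n μ) :=
  opSeq ([onX (tauX q)] ++ (List.finRange n).map (fun i => onX (swapX i))
    ++ (List.finRange n).map (fun i => tabT s i))

/-- The last Cherednik operator `𝛏_N = 𝐓_{N-1}⁻¹ ⋯ 𝐓_1⁻¹ 𝐰`. -/
noncomputable def cherednikLast (q s : K) : Module.End K (VPoly K n μ) :=
  opSeq ((List.finRange n).reverse.map (fun i => boldTinv s i) ++ [boldW q s])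

/-- The Dunkl operators: `𝐃_N = (1 - 𝛏_N) x_N⁻¹` and `𝐃_i = (1/s) 𝐓_i 𝐃_{i+1} 𝐓_i`. -/
noncomputable def dunkl (q s : K) (i : Fin (n + 1)) : Module.End K (VPoly K n μ) :=
  Fin.reverseInduction (motive := fun _ => Module.End K (VPoly K n μ))
    (onX divLastX ∘ₗ (LinearMap.id - cherednikLast q s))
    (fun i D => s⁻¹ • opSeq [boldT s i, D, boldT s i]) i

/-- The raising operator `𝚽 = 𝐓_1⁻¹ ⋯ 𝐓_{N-1}⁻¹ x_N`. -/
noncomputable def raising (s : K) : Module.End K (VPoly K n μ) :=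
  opSeq ((List.finRange n).map (fun i => boldTinv s i) ++ [mulX (Fin.last n)])

/-! ### Spectral vectors and Macdonald polynomials -/

/-- The rank function (with values counted from `0`): the position of `v i` in the stable decreasing
rearrangement of `v`. -/
def rank (v : Fin (n + 1) → ℕ) (i : Fin (n + 1)) : Fin (n + 1) :=
  ⟨(Finset.univ.filter fun j => (j < i ∧ v i ≤ v j) ∨ (i < j ∧ v i < v j)).card, by
    have h : (Finset.univ.filter fun j => (j < i ∧ v i ≤ v j) ∨ (i < j ∧ v i < v j)).card
        < (Finset.univ : Finset (Fin (n + 1))).card := by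
      apply Finset.card_lt_card
      refine ⟨Finset.filter_subset _ _, fun hsub => ?_⟩
      have := hsub (Finset.mem_univ i)
      simp at this
    simpa using h⟩

/-- The exponent of `s` in the spectral vector: `CT_T[r_v[i]]`. -/
def sExp (v : Fin (n + 1) → ℕ) (T : RST n μ) (i : Fin (n + 1)) : ℤ := T.ct (rank v i)

/-- The spectral vector `ζ_{v,T}[i] = q^{v[i]} s^{CT_T[r_v[i]]}`. -/
noncomputable def zeta (q s : K) (v : Fin (n + 1) → ℕ) (T : RST n μ) (i : Fin (n + 1)) : K :=
  q ^ v i * s ^ sExp v T i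

/-- The affine action `[v_1, …, v_N] ↦ [v_2, …, v_N, v_1 + 1]`. -/
def affineV (v : Fin (n + 1) → ℕ) : Fin (n + 1) → ℕ :=
  Fin.snoc (fun i : Fin n => v i.succ) (v 0 + 1)

/-- The polynomial attached to an arrow labelled `s_i` out of the vertex `(T, v)`:
`P (𝐓_i + (1 - s) / (1 - ζ[i+1]/ζ[i]))`. -/
noncomputable def stepPoly (q s : K) (v : Fin (n + 1) → ℕ) (T : RST n μ) (i : Fin n)
    (P : VPoly K n μ) : VPoly K n μ :=
  boldT s i P + ((1 - s) / (1 - zeta q s v T i.succ / zeta q s v T i.castSucc)) • P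

/-- `IsMacdonald q s T v P`: the polynomial `P` is computed along some path without fall from the root
of the Yang-Baxter graph to the vertex `(T, v)`. -/
inductive IsMacdonald (q s : K) : RST n μ → (Fin (n + 1) → ℕ) → VPoly K n μ → Prop
  | root (T : RST n μ) (hT : T.IsRoot) : IsMacdonald q s T 0 (tens 1 T)
  | step (T : RST n μ) (v : Fin (n + 1) → ℕ) (P : VPoly K n μ) (i : Fin n)
      (hP : IsMacdonald q s T v P) (hv : v i.castSucc < v i.succ) :
      IsMacdonald q s T (v ∘ Equiv.swap i.castSucc i.succ) (stepPoly q s v T i P)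
  | jump (T T' : RST n μ) (v : Fin (n + 1) → ℕ) (P : VPoly K n μ) (i : Fin n)
      (hP : IsMacdonald q s T v P) (hv : v i.castSucc = v i.succ)
      (hT' : IsSwap T T' (rank v i.castSucc) (rank v i.succ))
      (hct : T.ct (rank v i.succ) + 2 ≤ T.ct (rank v i.castSucc)) :
      IsMacdonald q s T' v (stepPoly q s v T i P)
  | affine (T : RST n μ) (v : Fin (n + 1) → ℕ) (P : VPoly K n μ) (hP : IsMacdonald q s T v P) :
      IsMacdonald q s T (affineV v) (raising s P)

/-! ### The bilinear form -/

/-- `ν(T)`. -/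
noncomputable def nu (s : K) (T : RST n μ) : K :=
  ∏ p ∈ (Finset.univ : Finset (Fin (n + 1) × Fin (n + 1))).filter
      (fun p => p.1 < p.2 ∧ T.ct p.1 - T.ct p.2 ≤ -2),
    (1 - s ^ (T.ct p.2 - T.ct p.1 - 1)) * (1 - s ^ (T.ct p.2 - T.ct p.1 + 1))
      / (1 - s ^ (T.ct p.2 - T.ct p.1)) ^ 2

/-- `𝐃^v = 𝐃_1^{v[1]} ⋯ 𝐃_N^{v[N]}`. -/
noncomputable def dunklPow (q s : K) (v : Fin (n + 1) →₀ ℕ) : Module.End K (VPoly K n μ) :=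
  opSeq ((List.finRange (n + 1)).map (fun i => dunkl q s i ^ v i))

/-- The bilinear form: `⟨x^v ⊗ A, Q⟩` is `ν(A)` times the constant term of the `A`-component of
`Q 𝐃^v`. The left argument lives in the space of the reciprocal parameters, which has the same
underlying vector space. -/
noncomputable def pairing (q s : K) : VPoly K n μ →ₗ[K] VPoly K n μ →ₗ[K] K :=
  ∑ A : RST n μ, nu s A •
    ((basisMonomials (Fin (n + 1)) K).constr K (fun v =>
      (lcoeff K (0 : Fin (n + 1) →₀ ℕ) ∘ₗ LinearMap.proj A) ∘ₗ dunklPow q s v)) ∘ₗ LinearMap.proj A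

/-- The defining properties of the form: its values on tableaux, the orthogonality of tableaux to
everything of positive degree, and `⟨P x_i, Q⟩ = ⟨P, Q 𝐃_i⟩`. -/
structure IsCanonicalForm (q s : K) (F : VPoly K n μ →ₗ[K] VPoly K n μ →ₗ[K] K) : Prop where
  tableau : ∀ A B : RST n μ, F (tens 1 A) (tens 1 B) = if A = B then nu s A else 0
  degree : ∀ (A B : RST n μ) (v : Fin (n + 1) →₀ ℕ), v ≠ 0 →
    F (tens 1 A) (tens (monomial v 1) B) = 0
  adjoint : ∀ (i : Fin (n + 1)) (P Q : VPoly K n μ), F (mulX i P) Q = F P (dunkl q s i Q)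

/-! ### The value of the square -/

/-- `(a; q)_k = (1 - a)(1 - q a) ⋯ (1 - q^{k-1} a)`. -/
def qPoch (a q : K) (k : ℕ) : K := ∏ j ∈ Finset.range k, (1 - q ^ j * a)

/-- `□(ζ_{v,T}) = ∏_i (q s^m; q)_{v[i]}` with `m = CT_T[r_v[i]]`. -/
noncomputable def box (q s : K) (v : Fin (n + 1) → ℕ) (T : RST n μ) : K :=
  ∏ i, qPoch (q * s ^ sExp v T i) q (v i)

/-- `ρ(a,b) = (a - s⁻¹ b)(a - s b) / (a - b)²`. -/
noncomputable def rho (s a b : K) : K := (a - s⁻¹ * b) * (a - s * b) / (a - b) ^ 2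

/-- `q^{a.1} s^{a.2} ≻ q^{b.1} s^{b.2}`. -/
def SpecGT (a b : ℤ × ℤ) : Prop := b.1 < a.1 ∨ (a.1 = b.1 ∧ a.2 ≤ b.2 - 2)

/-- `χ(i,j) = 1` if `j < i`, and `0` if `j ≥ i`. -/
def chi (i j : Fin (n + 1)) : ℕ := if j < i then 1 else 0

open Classical in
/-- `△(ζ_{v,T})`: the product of `ρ(ζ[j] q^k, ζ[i])` over all `i`, `j` and `k ≥ χ(i,j)` with
`ζ[i] ≻ ζ[j] q^k`; this relation forces `k ≤ v[i]`. -/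
noncomputable def triangle (q s : K) (v : Fin (n + 1) → ℕ) (T : RST n μ) : K :=
  ∏ j, ∏ i, ∏ k ∈ (Finset.range (v i + 1)).filter (fun k => chi i j ≤ k ∧
      SpecGT ((v i : ℤ), sExp v T i) ((v j : ℤ) + (k : ℤ), sExp v T j)),
    rho s (zeta q s v T j * q ^ k) (zeta q s v T i)

end VVMac

open VVMac

/-!
The operators `𝐓_i`, the variables and `𝐰` satisfy the relations of a double affine Hecke algebra.
A defect of such a relation can be moved through the variables, so that it vanishes as soon as it
vanishes on constants, where the relations are those of the seminormal form of the Hecke algebra on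
tableaux (`op_eq_zero`, `isDoubleHecke`). Working formally from the relations, the Dunkl operators
commute (`IsDoubleHecke.dunkl_comm`), which makes them adjoint to the variables (`pairing_mulX`);
`𝐰` permutes them in the way it permutes the variables; and the raising operator `𝚽` shifts the
indices of the generators and of the Cherednik operators `𝛏_i = s⁻¹ 𝐓_i 𝛏_{i+1} 𝐓_i`.

The form has parameters `q⁻¹`, `s⁻¹` on the left and `q`, `s` on the right, and every generator
preserves it: `⟨P 𝐓_i, Q 𝐓_i⟩ = ⟨P 𝐰, Q 𝐰⟩ = ⟨P, Q⟩` (`isUnitary_T`, `isUnitary_W`). Variables on the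
left turn into Dunkl operators on the right, so this reduces to constants. Hence the Cherednik
operators preserve the form too, and their eigenvectors are orthogonal unless the eigenvalues match
(`pairing_eq_zero`).

A vertex `(T, v)` of the graph is encoded by the exponents of its spectral vector (`label`), which
determine it because a tableau is determined by its contents. On labels, the two kinds of arrows that
use `𝐓_i` become one: the exchange of adjacent labels in increasing position. Every vertex other than
the root has an incoming arrow from a vertex of smaller `height`, so every vertex is reached. Any two
incoming arrows complete to a diamond: distant exchanges commute, adjacent ones satisfy the
Yang–Baxter relation, and exchanges pass through `𝚽` (`diamond_far`, `diamond_adjacent`,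
`diamond_affine`, `diamond_affine_last`). Induction on the height shows that the polynomial does not
depend on the path (`IsSpectral.unique`).

The tableaux are eigenvectors of the Cherednik operators by a Jucys–Murphy computation, and each
arrow permutes or shifts the eigenvalues like the labels (`IsSpectral.eigen`). Orthogonality of the
two ends of an exchange then shows that an exchange multiplies `⟨P*, P⟩` by a single `ρ`, and
`P 𝚽 𝐃_N = (1 - q ζ[1]) P 𝐓_1⁻¹ ⋯ 𝐓_{N-1}⁻¹` shows that `𝚽` multiplies it by `1 - q ζ[1]`. The
product `□ △` changes in the same way and agrees with `ν` at the root (`IsSpectral.norm`).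
-/


namespace VVMac

/-! ### Ordered products in a braid monoid -/

section Braid

variable {M : Type*} [Monoid M]

/-- The increasing product `g 0 * g 1 * ⋯ * g (k - 1)`. -/
def ascProd (g : ℕ → M) (k : ℕ) : M := ((List.range k).map g).prod

/-- The decreasing product `g (k - 1) * ⋯ * g 1 * g 0`. -/
def descProd (g : ℕ → M) (k : ℕ) : M := ((List.range k).reverse.map g).prod

@[simp] theorem ascProd_zero (g : ℕ → M) : ascProd g 0 = 1 := rfl

@[simp] theorem descProd_zero (g : ℕ → M) : descProd g 0 = 1 := rfl

theorem ascProd_succ (g : ℕ → M) (k : ℕ) : ascProd g (k + 1) = ascProd g k * g k := by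
  simp [ascProd, List.range_succ]

theorem descProd_succ (g : ℕ → M) (k : ℕ) : descProd g (k + 1) = g k * descProd g k := by
  simp [descProd, List.range_succ]

theorem ascProd_succ_left (g : ℕ → M) (k : ℕ) :
    ascProd g (k + 1) = g 0 * ascProd (fun i => g (i + 1)) k := by
  induction k with
  | zero => simp [ascProd_succ]
  | succ k ih => rw [ascProd_succ, ih, ascProd_succ _ k, mul_assoc]

theorem descProd_succ_right (g : ℕ → M) (k : ℕ) :
    descProd g (k + 1) = descProd (fun i => g (i + 1)) k * g 0 := by
  induction k with
  | zero => simp [descProd_succ]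
  | succ k ih => rw [descProd_succ, ih, descProd_succ _ k, mul_assoc]

theorem commute_ascProd {a : M} {g : ℕ → M} {k : ℕ} (h : ∀ i < k, Commute a (g i)) :
    Commute a (ascProd g k) := by
  induction k with
  | zero => simp
  | succ k ih =>
    rw [ascProd_succ]
    exact (ih fun i hi => h i (by omega)).mul_right (h k (by omega))

theorem commute_descProd {a : M} {g : ℕ → M} {k : ℕ} (h : ∀ i < k, Commute a (g i)) :
    Commute a (descProd g k) := by
  induction k with
  | zero => simp
  | succ k ih =>
    rw [descProd_succ]
    exact (h k (by omega)).mul_right (ih fun i hi => h i (by omega))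

/-- An element that intertwines `g i` and `h i` intertwines the increasing products. -/
theorem semiconj_ascProd {a : M} {g h : ℕ → M} {k : ℕ} (H : ∀ i < k, g i * a = a * h i) :
    ascProd g k * a = a * ascProd h k := by
  induction k with
  | zero => simp
  | succ k ih =>
    rw [ascProd_succ, ascProd_succ, mul_assoc, H k (by omega), ← mul_assoc,
      ih fun i hi => H i (by omega), mul_assoc]

theorem semiconj_descProd {a : M} {g h : ℕ → M} {k : ℕ} (H : ∀ i < k, g i * a = a * h i) :
    descProd g k * a = a * descProd h k := by
  induction k with
  | zero => simp
  | succ k ih =>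
    rw [descProd_succ, descProd_succ, mul_assoc, ih fun i hi => H i (by omega), ← mul_assoc,
      H k (by omega), mul_assoc]

/-- The relations of the braid group on `n + 1` strands for `g 0, …, g (n - 1)`. -/
structure IsBraid (n : ℕ) (g : ℕ → M) : Prop where
  braid : ∀ i, i + 1 < n → g i * g (i + 1) * g i = g (i + 1) * g i * g (i + 1)
  far : ∀ i j, i + 1 < j → j < n → Commute (g i) (g j)

namespace IsBraid

variable {n : ℕ} {g : ℕ → M}

/-- The increasing product shifts the index of a generator down by one. -/
theorem shift_asc (h : IsBraid n g) {k : ℕ} (hk : k ≤ n) {i : ℕ} (hi : i + 1 < k) :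
    g (i + 1) * ascProd g k = ascProd g k * g i := by
  induction k with
  | zero => omega
  | succ k ih =>
    rw [ascProd_succ]
    rcases Nat.lt_or_ge (i + 1) k with h1 | h1
    · rw [← mul_assoc, ih (by omega) h1, mul_assoc, (h.far i k h1 (by omega)).eq, mul_assoc]
    · obtain rfl : k = i + 1 := by omega
      have hc : Commute (g (i + 1)) (ascProd g i) :=
        commute_ascProd fun j hj => (h.far j (i + 1) (by omega) (by omega)).symm
      rw [ascProd_succ]
      calc g (i + 1) * (ascProd g i * g i * g (i + 1))
          = (g (i + 1) * ascProd g i) * g i * g (i + 1) := by simp only [mul_assoc]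
        _ = ascProd g i * (g (i + 1) * g i * g (i + 1)) := by rw [hc.eq]; simp only [mul_assoc]
        _ = ascProd g i * g i * g (i + 1) * g i := by
          rw [← h.braid i (by omega)]; simp only [mul_assoc]

/-- The decreasing product shifts the index of a generator up by one. -/
theorem shift_desc (h : IsBraid n g) {k : ℕ} (hk : k ≤ n) {i : ℕ} (hi : i + 1 < k) :
    g i * descProd g k = descProd g k * g (i + 1) := by
  induction k with
  | zero => omega
  | succ k ih =>
    rw [descProd_succ]
    rcases Nat.lt_or_ge (i + 1) k with h1 | h1
    · rw [← mul_assoc, (h.far i k h1 (by omega)).eq, mul_assoc, ih (by omega) h1, mul_assoc]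
    · obtain rfl : k = i + 1 := by omega
      have hc : Commute (g (i + 1)) (descProd g i) :=
        commute_descProd fun j hj => (h.far j (i + 1) (by omega) (by omega)).symm
      rw [descProd_succ]
      calc g i * (g (i + 1) * (g i * descProd g i))
          = (g i * g (i + 1) * g i) * descProd g i := by simp only [mul_assoc]
        _ = g (i + 1) * g i * (g (i + 1) * descProd g i) := by
          rw [h.braid i (by omega)]; simp only [mul_assoc]
        _ = g (i + 1) * (g i * descProd g i) * g (i + 1) := by rw [hc.eq]; simp only [mul_assoc]

/-- The square of the full increasing product carries the last generator over to the first one. This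
is the relation of the affine element in the extended affine braid group. -/
theorem shift_sq (h : IsBraid (n + 1) g) :
    g 0 * (ascProd g (n + 1) * ascProd g (n + 1))
      = ascProd g (n + 1) * ascProd g (n + 1) * g n := by
  have h1 : ascProd (fun i => g (i + 1)) n * ascProd g (n + 1)
      = ascProd g (n + 1) * ascProd g n :=
    semiconj_ascProd fun i hi => h.shift_asc le_rfl (by omega)
  have h2 : ascProd g (n + 1) * ascProd g (n + 1)
      = g 0 * (ascProd g (n + 1) * ascProd g n) := by
    nth_rw 1 [ascProd_succ_left]
    rw [mul_assoc, h1]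
  have h3 : ascProd g (n + 1) * ascProd g n * g n = ascProd g (n + 1) * ascProd g (n + 1) := by
    rw [mul_assoc, ← ascProd_succ]
  rw [h2, mul_assoc (g 0), h3, h2]

theorem shift_sq_desc (h : IsBraid (n + 1) g) :
    g n * (descProd g (n + 1) * descProd g (n + 1))
      = descProd g (n + 1) * descProd g (n + 1) * g 0 := by
  have h1 : descProd g n * descProd g (n + 1)
      = descProd g (n + 1) * descProd (fun i => g (i + 1)) n :=
    semiconj_descProd fun i hi => h.shift_desc le_rfl (by omega)
  have h2 : descProd g (n + 1) * descProd g (n + 1)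
      = g n * (descProd g (n + 1) * descProd (fun i => g (i + 1)) n) := by
    nth_rw 1 [descProd_succ]
    rw [mul_assoc, h1]
  have h3 : descProd g (n + 1) * descProd (fun i => g (i + 1)) n * g 0
      = descProd g (n + 1) * descProd g (n + 1) := by
    rw [mul_assoc, ← descProd_succ_right]
  nth_rw 2 [h2]
  rw [mul_assoc (g n), h3]

/-- Two ways to write the braid in which one strand goes around all others. -/
theorem desc_mul_asc (h : IsBraid (n + 1) g) :
    descProd g (n + 1) * ascProd (fun i => g (i + 1)) n
      = ascProd g (n + 1) * descProd g n := by
  rw [← semiconj_descProd (g := fun i => g (i + 1))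
    fun i hi => h.shift_asc le_rfl (by omega), descProd_succ_right, ascProd_succ_left g n,
    mul_assoc]

end IsBraid

end Braid

/-! ### Consequences of the double affine Hecke relations -/

section DoubleHecke

variable {K R : Type*} [Field K] [Ring R] [Algebra K R]

/-- The relations between the generators `T 0, …, T (n - 1)`, their inverses `T'`, the commuting
variables `X 0, …, X n` and the affine element `w`, for operators acting on the right. The last
field makes it possible to verify identities after a multiplication by a variable. -/
structure IsDoubleHecke (q s : K) (n : ℕ) (T T' X : ℕ → R) (w : R) : Prop where
  s_ne : s ≠ 0
  inv : ∀ i, T' i = s⁻¹ • (T i + (1 - s) • (1 : R))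
  quad : ∀ i < n, T i * T i = (s - 1) • T i + s • (1 : R)
  isBraid : IsBraid n T
  X_comm : ∀ i j, Commute (X i) (X j)
  X_T : ∀ i < n, X i * T i = (T i + (1 - s) • (1 : R)) * X (i + 1)
  X_T_far : ∀ i < n, ∀ j ≤ n, j ≠ i → j ≠ i + 1 → Commute (X j) (T i)
  X_w : ∀ i < n, X (i + 1) * w = w * X i
  X_zero_w : X 0 * w = q • (w * X n)
  T_w : ∀ i, i + 1 < n → T (i + 1) * w = w * T i
  T_w_w : ∀ m, n = m + 1 → T 0 * (w * w) = w * w * T m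
  cancel : ∀ i ≤ n, ∀ a b : R, a * X i = b * X i → a = b

/-- A family with `Y i = s⁻¹ T i Y (i + 1) T i`, as satisfied by the Cherednik operators and by the
Dunkl operators. -/
structure IsConjFamily (s : K) (n : ℕ) (T Y : ℕ → R) : Prop where
  step : ∀ i < n, Y i = s⁻¹ • (T i * Y (i + 1) * T i)
  last : ∀ j, j + 1 < n → Commute (T j) (Y n)

namespace IsDoubleHecke

variable {q s : K} {n : ℕ} {T T' X : ℕ → R} {w : R}

theorem T_mul_inv (h : IsDoubleHecke q s n T T' X w) {i : ℕ} (hi : i < n) : T i * T' i = 1 := by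
  rw [h.inv, mul_smul_comm, mul_add, h.quad i hi, mul_smul_comm, mul_one]
  have : (s - 1) • T i + s • (1 : R) + (1 - s) • T i = s • (1 : R) := by module
  rw [this, smul_smul, inv_mul_cancel₀ h.s_ne, one_smul]

theorem inv_mul_T (h : IsDoubleHecke q s n T T' X w) {i : ℕ} (hi : i < n) : T' i * T i = 1 := by
  rw [h.inv, smul_mul_assoc, add_mul, h.quad i hi, smul_mul_assoc, one_mul]
  have : (s - 1) • T i + s • (1 : R) + (1 - s) • T i = s • (1 : R) := by module
  rw [this, smul_smul, inv_mul_cancel₀ h.s_ne, one_smul]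

theorem T_mul_inv_mul (h : IsDoubleHecke q s n T T' X w) {i : ℕ} (hi : i < n) (a : R) :
    T i * (T' i * a) = a := by
  rw [← mul_assoc, h.T_mul_inv hi, one_mul]

theorem inv_mul_T_mul (h : IsDoubleHecke q s n T T' X w) {i : ℕ} (hi : i < n) (a : R) :
    T' i * (T i * a) = a := by
  rw [← mul_assoc, h.inv_mul_T hi, one_mul]

theorem commute_inv (h : IsDoubleHecke q s n T T' X w) {i : ℕ} {a : R} (ha : Commute a (T i)) :
    Commute a (T' i) := by
  rw [h.inv]
  exact (ha.add_right ((Commute.one_right a).smul_right _)).smul_right _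

theorem semiconj_inv (h : IsDoubleHecke q s n T T' X w) {i j : ℕ} {a : R}
    (ha : T i * a = a * T j) : T' i * a = a * T' j := by
  rw [h.inv, h.inv, smul_mul_assoc, mul_smul_comm, add_mul, mul_add, ha]
  simp

theorem isBraid_inv (h : IsDoubleHecke q s n T T' X w) : IsBraid n T' where
  far i j hij hj := (h.commute_inv (h.commute_inv (h.isBraid.far i j hij hj)).symm).symm
  braid i hi := by
    have h1 := h.isBraid.braid i hi
    have e1 : (T' i * T' (i + 1) * T' i) * (T i * T (i + 1) * T i) = 1 := by
      simp only [mul_assoc]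
      rw [h.inv_mul_T_mul (by omega), h.inv_mul_T_mul hi, h.inv_mul_T (by omega)]
    have e2 : (T i * T (i + 1) * T i) * (T' (i + 1) * T' i * T' (i + 1)) = 1 := by
      rw [h1]
      simp only [mul_assoc]
      rw [h.T_mul_inv_mul (by omega), h.T_mul_inv_mul (by omega), h.T_mul_inv (by omega)]
    exact left_inv_eq_right_inv e1 e2

theorem X_T' (h : IsDoubleHecke q s n T T' X w) {i : ℕ} (hi : i < n) :
    X i * T i = s • (T' i * X (i + 1)) := by
  rw [h.X_T i hi, h.inv, smul_mul_assoc, smul_smul, mul_inv_cancel₀ h.s_ne, one_smul]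

theorem inv_X (h : IsDoubleHecke q s n T T' X w) {i : ℕ} (hi : i < n) :
    T' i * X (i + 1) = s⁻¹ • (X i * T i) := by
  rw [h.X_T' hi, smul_smul, inv_mul_cancel₀ h.s_ne, one_smul]

theorem X_succ_inv (h : IsDoubleHecke q s n T T' X w) {i : ℕ} (hi : i < n) :
    X (i + 1) * T' i = s⁻¹ • (T i * X i) := by
  have : T i * (T' i * X (i + 1)) * T' i = T i * (s⁻¹ • (X i * T i)) * T' i := by rw [h.inv_X hi]
  rw [h.T_mul_inv_mul hi, mul_smul_comm, smul_mul_assoc] at this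
  rw [this, mul_assoc, mul_assoc, h.T_mul_inv hi, mul_one]

theorem T_X (h : IsDoubleHecke q s n T T' X w) {i : ℕ} (hi : i < n) :
    T i * X i = s • (X (i + 1) * T' i) := by
  rw [h.X_succ_inv hi, smul_smul, mul_inv_cancel₀ h.s_ne, one_smul]

theorem X_inv (h : IsDoubleHecke q s n T T' X w) {i : ℕ} (hi : i < n) :
    X i * T' i = T' i * X (i + 1) + (s⁻¹ * (1 - s)) • X i := by
  rw [h.inv_X hi, h.inv, mul_smul_comm, mul_add, smul_add, mul_smul_comm, mul_one, smul_smul]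

theorem X_inv_far (h : IsDoubleHecke q s n T T' X w) {i j : ℕ} (hi : i < n) (hj : j ≤ n)
    (h1 : j ≠ i) (h2 : j ≠ i + 1) : Commute (X j) (T' i) :=
  h.commute_inv (h.X_T_far i hi j hj h1 h2)

theorem commute_T_X_mul_X (h : IsDoubleHecke q s n T T' X w) {i : ℕ} (hi : i < n) :
    Commute (T i) (X i * X (i + 1)) := by
  have h1 : X i * X (i + 1) * T i = T i * (X i * X (i + 1)) := by
    rw [(h.X_comm i (i + 1)).eq, mul_assoc, h.X_T' hi, mul_smul_comm, ← mul_assoc,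
      h.X_succ_inv hi, smul_mul_assoc, smul_smul, mul_inv_cancel₀ h.s_ne, one_smul, mul_assoc,
      (h.X_comm i (i + 1)).eq]
  exact h1.symm

/-- The last Cherednik operator `T'_{n-1} ⋯ T'_0 w`. -/
def xiLast (n : ℕ) (T' : ℕ → R) (w : R) : R := descProd T' n * w

/-- Moving a variable through `T'_{k-1} ⋯ T'_0`, up to right multiples of `X 0`. -/
theorem X_desc (h : IsDoubleHecke q s n T T' X w) {k : ℕ} (hk : k ≤ n) :
    (∃ a, X k * descProd T' k = a * X 0) ∧
    ∀ j < k, ∃ a, X j * descProd T' k = descProd T' k * X (j + 1) + a * X 0 := by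
  induction k with
  | zero => exact ⟨⟨1, by simp⟩, fun j hj => by omega⟩
  | succ k ih =>
    obtain ⟨⟨a, ha⟩, hb⟩ := ih (by omega)
    refine ⟨⟨s⁻¹ • (T k * a), ?_⟩, fun j hj => ?_⟩
    · rw [descProd_succ, ← mul_assoc, h.X_succ_inv (by omega), smul_mul_assoc, mul_assoc, ha,
        smul_mul_assoc, mul_assoc]
    · rw [descProd_succ]
      rcases Nat.lt_or_ge j k with h1 | h1
      · obtain ⟨b, hb⟩ := hb j h1
        refine ⟨T' k * b, ?_⟩
        rw [← mul_assoc, (h.X_inv_far (by omega) (by omega) (by omega) (by omega) :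
          Commute (X j) (T' k)).eq, mul_assoc, hb, mul_add, mul_assoc, mul_assoc]
      · obtain rfl : j = k := by omega
        refine ⟨(s⁻¹ * (1 - s)) • a, ?_⟩
        have hc : Commute (X (j + 1)) (descProd T' j) :=
          commute_descProd fun i hi => h.X_inv_far (by omega) (by omega) (by omega) (by omega)
        rw [← mul_assoc, h.X_inv (by omega), add_mul, mul_assoc, hc.eq, smul_mul_assoc, ha,
          smul_mul_assoc, mul_assoc]

/-- Modulo right multiples of `X n`, the last Cherednik operator commutes with `X j` for `j < n`
and annihilates `X n`. -/
theorem X_xiLast (h : IsDoubleHecke q s n T T' X w) :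
    (∃ a, X n * xiLast n T' w = a * X n) ∧
    ∀ j < n, ∃ a, X j * xiLast n T' w = xiLast n T' w * X j + a * X n := by
  obtain ⟨⟨a, ha⟩, hb⟩ := h.X_desc le_rfl
  refine ⟨⟨q • (a * w), ?_⟩, fun j hj => ?_⟩
  · rw [xiLast, ← mul_assoc, ha, mul_assoc, h.X_zero_w, mul_smul_comm, smul_mul_assoc, mul_assoc]
  · obtain ⟨b, hb⟩ := hb j hj
    refine ⟨q • (b * w), ?_⟩
    rw [xiLast, ← mul_assoc, hb, add_mul, mul_assoc, h.X_w j hj, mul_assoc, h.X_zero_w,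
      mul_smul_comm, smul_mul_assoc, mul_assoc, mul_assoc]

theorem commute_T_xiLast (h : IsDoubleHecke q s n T T' X w) {j : ℕ} (hj : j + 1 < n) :
    Commute (T j) (xiLast n T' w) := by
  have h1 : T' j * xiLast n T' w = xiLast n T' w * T' j := by
    rw [xiLast, ← mul_assoc, h.isBraid_inv.shift_desc le_rfl hj, mul_assoc,
      h.semiconj_inv (h.T_w j hj), mul_assoc]
  have h2 : T j = s • T' j - (1 - s) • (1 : R) := by
    rw [h.inv, smul_smul, mul_inv_cancel₀ h.s_ne, one_smul]; abel
  rw [h2]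
  exact ((show Commute (T' j) _ from h1).smul_left _).sub_left ((Commute.one_left _).smul_left _)

/-- `T j` commutes with `Y i` unless `j` is `i` or `i - 1`. -/
theorem commute_conj (h : IsDoubleHecke q s n T T' X w) {Y : ℕ → R} (hY : IsConjFamily s n T Y)
    {i : ℕ} (hi : i ≤ n) : ∀ j < n, j ≠ i → j + 1 ≠ i → Commute (T j) (Y i) := by
  induction hd : n - i using Nat.strong_induction_on generalizing i with
  | _ d ih =>
    replace ih : ∀ k, i < k → k ≤ n → ∀ j < n, j ≠ k → j + 1 ≠ k → Commute (T j) (Y k) :=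
      fun k h1 h2 => ih (n - k) (by omega) h2 rfl
    intro j hj h1 h2
    rcases Nat.eq_or_lt_of_le hi with rfl | hi
    · exact hY.last j (by omega)
    rw [hY.step i hi]
    refine Commute.smul_right ?_ _
    rcases eq_or_ne j (i + 1) with rfl | h3
    · rw [hY.step (i + 1) hj]
      have hc : Commute (T i) (Y (i + 2)) :=
        ih (i + 2) (by omega) (by omega) i (by omega) (by omega) (by omega)
      have hb := h.isBraid.braid i hj
      rw [mul_smul_comm, smul_mul_assoc]
      refine Commute.smul_right ?_ _
      show T (i + 1) * (T i * (T (i + 1) * Y (i + 2) * T (i + 1)) * T i)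
        = T i * (T (i + 1) * Y (i + 2) * T (i + 1)) * T i * T (i + 1)
      calc _ = (T (i + 1) * T i * T (i + 1)) * Y (i + 2) * T (i + 1) * T i := by
            simp only [mul_assoc]
        _ = T i * T (i + 1) * (T i * Y (i + 2)) * T (i + 1) * T i := by
            rw [← hb]; simp only [mul_assoc]
        _ = T i * T (i + 1) * Y (i + 2) * (T i * T (i + 1) * T i) := by
            rw [hc.eq]; simp only [mul_assoc]
        _ = _ := by rw [hb]; simp only [mul_assoc]
    · have hc : Commute (T j) (T i) := by
        rcases Nat.lt_or_ge j i with h4 | h4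
        · exact h.isBraid.far j i (by omega) hi
        · exact (h.isBraid.far i j (by omega) hj).symm
      exact (hc.mul_right (ih (i + 1) (by omega) (by omega) j hj h3 (by omega))).mul_right hc

/-- A relation `T i Y (i + 1) = Y i (T i + 1 - s)`. -/
theorem T_conj (h : IsDoubleHecke q s n T T' X w) {Y : ℕ → R} (hY : IsConjFamily s n T Y)
    {i : ℕ} (hi : i < n) : T i * Y (i + 1) = Y i * (T i + (1 - s) • (1 : R)) := by
  have : T i + (1 - s) • (1 : R) = s • T' i := by
    rw [h.inv, smul_smul, mul_inv_cancel₀ h.s_ne, one_smul]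
  rw [this, hY.step i hi, smul_mul_assoc, mul_smul_comm, smul_smul, inv_mul_cancel₀ h.s_ne,
    one_smul, mul_assoc, h.T_mul_inv hi, mul_one]

/-- The first member of the family in terms of any other one. -/
theorem conj_zero (h : IsDoubleHecke q s n T T' X w) {Y : ℕ → R} (hY : IsConjFamily s n T Y)
    {k : ℕ} (hk : k ≤ n) : s ^ k • Y 0 = ascProd T k * Y k * descProd T k := by
  induction k with
  | zero => simp
  | succ k ih =>
    rw [pow_succ', mul_smul, ih (by omega), hY.step k (by omega), ascProd_succ, descProd_succ,
      mul_smul_comm, smul_mul_assoc, smul_smul, mul_inv_cancel₀ h.s_ne, one_smul]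
    simp only [mul_assoc]

theorem desc_inv_cancel (h : IsDoubleHecke q s n T T' X w) {k : ℕ} (hk : k ≤ n) :
    ascProd T k * descProd T' k = 1 := by
  induction k with
  | zero => simp
  | succ k ih =>
    rw [ascProd_succ, descProd_succ, mul_assoc, h.T_mul_inv_mul (by omega), ih (by omega)]

theorem inv_desc_cancel (h : IsDoubleHecke q s n T T' X w) {k : ℕ} (hk : k ≤ n) :
    descProd T' k * ascProd T k = 1 := by
  induction k with
  | zero => simp
  | succ k ih =>
    rw [ascProd_succ, descProd_succ, mul_assoc, ← mul_assoc (descProd T' k), ih (by omega),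
      one_mul, h.inv_mul_T (by omega)]

theorem desc_asc_cancel (h : IsDoubleHecke q s n T T' X w) {k : ℕ} (hk : k ≤ n) :
    descProd T k * ascProd T' k = 1 := by
  induction k with
  | zero => simp
  | succ k ih =>
    rw [descProd_succ, ascProd_succ, mul_assoc, ← mul_assoc (descProd T k), ih (by omega),
      one_mul, h.T_mul_inv (by omega)]

/-- The variables form a family of the same kind, with the inverse generators. -/
theorem asc_X_desc (h : IsDoubleHecke q s n T T' X w) {k : ℕ} (hk : k ≤ n) :
    s ^ k • (ascProd T' k * X k * descProd T' k) = X 0 := by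
  induction k with
  | zero => simp
  | succ k ih =>
    rw [← ih (by omega), pow_succ, mul_smul]
    congr 1
    rw [ascProd_succ, descProd_succ]
    have : s • (T' k * X (k + 1) * T' k) = X k := by
      rw [h.inv_X (by omega), smul_mul_assoc, smul_smul, mul_inv_cancel₀ h.s_ne, one_smul,
        mul_assoc, h.T_mul_inv (by omega), mul_one]
    calc _ = ascProd T' k * (s • (T' k * X (k + 1) * T' k)) * descProd T' k := by
          rw [mul_smul_comm, smul_mul_assoc]; simp only [mul_assoc]
      _ = _ := by rw [this]

/-- Moving the first variable through a decreasing product, which inverts the generators. -/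
theorem desc_X_zero (h : IsDoubleHecke q s n T T' X w) {k : ℕ} (hk : k ≤ n) :
    descProd T k * X 0 = s ^ k • (X k * descProd T' k) := by
  induction k with
  | zero => simp
  | succ k ih =>
    rw [descProd_succ, descProd_succ, mul_assoc, ih (by omega), mul_smul_comm, ← mul_assoc,
      h.T_X (by omega), smul_mul_assoc, smul_smul, ← pow_succ, mul_assoc]

theorem mul_cancel (h : IsDoubleHecke q s n T T' X w) {i j : ℕ} (hi : i ≤ n) (hj : j ≤ n)
    {a b : R} (e : a * (X i * X j) = b * (X i * X j)) : a = b := by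
  rw [← mul_assoc, ← mul_assoc] at e
  exact h.cancel i hi _ _ (h.cancel j hj _ _ e)

theorem inv_w (h : IsDoubleHecke q s n T T' X w) {i : ℕ} (hi : i + 1 < n) :
    T' (i + 1) * w = w * T' i := h.semiconj_inv (h.T_w i hi)

section Last

variable {m : ℕ}

theorem T_xiLast (h : IsDoubleHecke q s (m + 1) T T' X w) :
    T m * xiLast (m + 1) T' w = descProd T' m * w := by
  rw [xiLast, descProd_succ, mul_assoc, h.T_mul_inv_mul (by omega)]

theorem xiLast_w (h : IsDoubleHecke q s (m + 1) T T' X w) :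
    xiLast (m + 1) T' w * w = w * (T m * xiLast (m + 1) T' w * T' m) := by
  have h1 : w * descProd T' m = descProd (fun i => T' (i + 1)) m * w :=
    (semiconj_descProd fun i hi => h.inv_w (by omega)).symm
  have h2 : T' 0 * (w * w) = w * w * T' m := h.semiconj_inv (h.T_w_w m rfl)
  rw [h.T_xiLast, xiLast, descProd_succ_right]
  calc _ = descProd (fun i => T' (i + 1)) m * (T' 0 * (w * w)) := by simp only [mul_assoc]
    _ = descProd (fun i => T' (i + 1)) m * w * w * T' m := by rw [h2]; simp only [mul_assoc]
    _ = _ := by rw [← h1]; simp only [mul_assoc]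

/-- The last two Cherednik operators commute. -/
theorem xiLast_comm (h : IsDoubleHecke q s (m + 1) T T' X w) :
    Commute (xiLast (m + 1) T' w) (T m * xiLast (m + 1) T' w * T m) := by
  set A := descProd T' (m + 1) with hA
  set B := descProd T' m * w with hB
  have hm : m < m + 1 := by omega
  have h1 : w * descProd T' m = descProd (fun i => T' (i + 1)) m * w :=
    (semiconj_descProd fun i hi => h.inv_w (by omega)).symm
  have h2 : T' 0 * (w * w) = w * w * T' m := h.semiconj_inv (h.T_w_w m rfl)
  have hAA : T' m * (A * A) = A * A * T' 0 := h.isBraid_inv.shift_sq_desc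
  have e1 : descProd T' m = T m * A := by rw [hA, descProd_succ, h.T_mul_inv_mul hm]
  have e2 : descProd (fun i => T' (i + 1)) m = A * T 0 := by
    rw [hA, descProd_succ_right, mul_assoc, h.inv_mul_T (by omega), mul_one]
  have hBB : B * B = T m * (A * A * T 0 * (w * w)) := by
    calc B * B = descProd T' m * (w * descProd T' m) * w := by rw [hB]; simp only [mul_assoc]
      _ = descProd T' m * descProd (fun i => T' (i + 1)) m * (w * w) := by
        rw [h1]; simp only [mul_assoc]
      _ = _ := by rw [e1, e2]; simp only [mul_assoc]
  have h3 : T' m * (B * B) = B * B * T' m := by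
    rw [hBB, h.inv_mul_T_mul hm]
    calc A * A * T 0 * (w * w) = T m * (T' m * (A * A)) * T 0 * (w * w) := by
          rw [h.T_mul_inv_mul hm]
      _ = T m * (A * A) * (T' 0 * (T 0 * (w * w))) := by rw [hAA]; simp only [mul_assoc]
      _ = T m * (A * A) * (T 0 * (T' 0 * (w * w))) := by
        rw [h.inv_mul_T_mul (by omega), h.T_mul_inv_mul (by omega)]
      _ = _ := by rw [h2]; simp only [mul_assoc]
  show _ * _ = _ * _
  have e3 : xiLast (m + 1) T' w = T' m * B := by rw [xiLast, descProd_succ, mul_assoc]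
  have e4 : T m * (T' m * B) = B := h.T_mul_inv_mul hm B
  rw [e3, e4]
  calc T' m * B * (B * T m) = T' m * (B * B) * T m := by simp only [mul_assoc]
    _ = B * B := by rw [h3, mul_assoc, h.inv_mul_T hm, mul_one]
    _ = B * (T m * (T' m * B)) := by rw [e4]
    _ = _ := by simp only [mul_assoc]

theorem T_xiLast_X (h : IsDoubleHecke q s (m + 1) T T' X w) :
    T m * xiLast (m + 1) T' w * X m = X (m + 1) * (T m * xiLast (m + 1) T' w) := by
  have hc : Commute (X (m + 1)) (descProd T' m) :=
    commute_descProd fun i hi => h.X_inv_far (by omega) (by omega) (by omega) (by omega)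
  rw [h.T_xiLast, mul_assoc, ← h.X_w m (by omega), ← mul_assoc, ← hc.eq, mul_assoc]

end Last

end IsDoubleHecke

/-- The relations between the Dunkl operators and the double affine Hecke algebra. -/
structure IsDunklFamily (s : K) (n : ℕ) (T T' X : ℕ → R) (w : R) (D : ℕ → R) : Prop where
  step : ∀ i < n, D i = s⁻¹ • (T i * D (i + 1) * T i)
  last_X : D n * X n = 1 - IsDoubleHecke.xiLast n T' w

/-- The Cherednik operators are generated from the last one. -/
structure IsCherednikFamily (s : K) (n : ℕ) (T T' : ℕ → R) (w : R) (Y : ℕ → R) : Prop where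
  step : ∀ i < n, Y i = s⁻¹ • (T i * Y (i + 1) * T i)
  last : Y n = IsDoubleHecke.xiLast n T' w

namespace IsDoubleHecke

variable {q s : K} {n : ℕ} {T T' X D Y : ℕ → R} {w : R}

theorem dunkl_conj (h : IsDoubleHecke q s n T T' X w) (hD : IsDunklFamily s n T T' X w D) :
    IsConjFamily s n T D where
  step := hD.step
  last j hj := by
    refine h.cancel n le_rfl _ _ ?_
    have hx : Commute (X n) (T j) := h.X_T_far j (by omega) n le_rfl (by omega) (by omega)
    rw [mul_assoc, hD.last_X, mul_assoc, ← hx.eq, ← mul_assoc, hD.last_X, mul_sub, sub_mul,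
      (h.commute_T_xiLast hj).eq, mul_one, one_mul]

theorem cherednik_conj (h : IsDoubleHecke q s n T T' X w)
    (hY : IsCherednikFamily s n T T' w Y) : IsConjFamily s n T Y where
  step := hY.step
  last j hj := by rw [hY.last]; exact h.commute_T_xiLast hj

/-- The last but one Dunkl operator undoes the multiplication by its variable up to a conjugate of
the last Cherednik operator. -/
theorem dunkl_pred_X {m : ℕ} (h : IsDoubleHecke q s (m + 1) T T' X w)
    (hD : IsDunklFamily s (m + 1) T T' X w D) :
    D m * X m = 1 - T m * xiLast (m + 1) T' w * T' m := by
  have hm : m < m + 1 := by omega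
  rw [hD.step m hm, smul_mul_assoc, mul_assoc, h.T_X hm, mul_smul_comm, smul_smul,
    inv_mul_cancel₀ h.s_ne, one_smul, ← mul_assoc, mul_assoc (T m), hD.last_X, mul_sub, sub_mul,
    mul_one, h.T_mul_inv hm]

/-- The affine element permutes the Dunkl operators in the way opposite to the variables. -/
theorem w_dunkl (h : IsDoubleHecke q s n T T' X w) (hD : IsDunklFamily s n T T' X w D)
    {i : ℕ} (hi : i < n) : w * D i = D (i + 1) * w := by
  obtain ⟨m, rfl⟩ : ∃ m, n = m + 1 := ⟨n - 1, by omega⟩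
  obtain ⟨d, hd⟩ : ∃ d, m = i + d := ⟨m - i, by omega⟩
  induction d generalizing i with
  | zero =>
    obtain rfl : m = i := by omega
    refine h.cancel m (by omega) _ _ ?_
    rw [mul_assoc, h.dunkl_pred_X hD, mul_assoc (D (m + 1)), ← h.X_w m hi, ← mul_assoc (D (m + 1)),
      hD.last_X, mul_sub, sub_mul, h.xiLast_w, mul_one, one_mul]
  | succ d ih =>
    conv_rhs => rw [hD.step (i + 1) (by omega)]
    rw [hD.step i hi, mul_smul_comm, smul_mul_assoc]
    congr 1
    calc w * (T i * D (i + 1) * T i) = (w * T i) * D (i + 1) * T i := by simp only [mul_assoc]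
      _ = T (i + 1) * (w * D (i + 1)) * T i := by
        rw [← h.T_w i (by omega)]; simp only [mul_assoc]
      _ = T (i + 1) * D (i + 1 + 1) * (w * T i) := by
        rw [ih (by omega) (by omega)]; simp only [mul_assoc]
      _ = _ := by rw [← h.T_w i (by omega)]; simp only [mul_assoc]

theorem w_dunkl_last (h : IsDoubleHecke q s n T T' X w) (hD : IsDunklFamily s n T T' X w D) :
    w * D n = q • (D 0 * w) := by
  refine h.cancel n le_rfl _ _ ?_
  have h0 : D 0 * X 0 = 1 - w * descProd T' n := by
    have hs : s ^ n ≠ 0 := pow_ne_zero _ h.s_ne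
    have e : s ^ n • (D 0 * X 0) = s ^ n • (1 - w * descProd T' n) := by
      rw [← smul_mul_assoc, h.conj_zero (h.dunkl_conj hD) le_rfl, mul_assoc, h.desc_X_zero le_rfl,
        mul_smul_comm]
      congr 1
      rw [mul_assoc, ← mul_assoc (D n), hD.last_X, sub_mul, mul_sub, one_mul,
        h.desc_inv_cancel le_rfl, xiLast]
      congr 1
      rw [mul_assoc, ← mul_assoc, h.desc_inv_cancel le_rfl, one_mul]
    simpa only [inv_smul_smul₀ hs] using congrArg (fun z => (s ^ n)⁻¹ • z) e
  rw [mul_assoc, hD.last_X, smul_mul_assoc, mul_assoc, ← mul_smul_comm, ← h.X_zero_w, ← mul_assoc,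
    h0, mul_sub, sub_mul, mul_one, one_mul, xiLast, mul_assoc]

/-- The last two Dunkl operators commute: after a multiplication by both variables this becomes the
commutation of the last two Cherednik operators. -/
theorem dunkl_comm_last {m : ℕ} (h : IsDoubleHecke q s (m + 1) T T' X w)
    (hD : IsDunklFamily s (m + 1) T T' X w D) : Commute (D m) (D (m + 1)) := by
  have hm : m < m + 1 := by omega
  set ξ := xiLast (m + 1) T' w with hξ
  have ha : D m * X m = 1 - T m * ξ * T' m := h.dunkl_pred_X hD
  have hb : T m * ξ * X m = X (m + 1) * (T m * ξ) := h.T_xiLast_X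
  have hb' : T m * ξ * T' m * X (m + 1) = s⁻¹ • (X (m + 1) * (T m * ξ * T m)) := by
    rw [mul_assoc, h.inv_X hm, mul_smul_comm, ← mul_assoc, hb]; simp only [mul_assoc]
  have hc : ξ * X m = s⁻¹ • (X m * (T m * T m * ξ)) := by
    have : T' m * (T m * ξ * X m) = T' m * (X (m + 1) * (T m * ξ)) := by rw [hb]
    rw [mul_assoc, h.inv_mul_T_mul hm, ← mul_assoc, h.inv_X hm] at this
    rw [this, smul_mul_assoc]; simp only [mul_assoc]
  have hd : ξ * (T m * ξ * T m) = T m * ξ * T m * ξ := h.xiLast_comm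
  refine h.mul_cancel (i := m) (j := m + 1) (by omega) le_rfl ?_
  have e1 : D (m + 1) * D m * (X m * X (m + 1)) = (1 - ξ) * (1 - s⁻¹ • (T m * ξ * T m)) := by
    calc _ = D (m + 1) * (D m * X m) * X (m + 1) := by simp only [mul_assoc]
      _ = D (m + 1) * (X (m + 1) - T m * ξ * T' m * X (m + 1)) := by
        rw [ha, mul_assoc, sub_mul, one_mul]
      _ = D (m + 1) * X (m + 1) * (1 - s⁻¹ • (T m * ξ * T m)) := by
        rw [hb', mul_sub, mul_sub, mul_one, mul_smul_comm, mul_smul_comm, ← mul_assoc]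
      _ = _ := by rw [hD.last_X]
  have e2 : D m * D (m + 1) * (X m * X (m + 1))
      = (1 - T m * ξ * T' m) * (1 - s⁻¹ • (T m * T m * ξ)) := by
    calc _ = D m * (D (m + 1) * X (m + 1)) * X m := by
          rw [(h.X_comm m (m + 1)).eq]; simp only [mul_assoc]
      _ = D m * (X m - ξ * X m) := by rw [hD.last_X, mul_assoc, sub_mul, one_mul]
      _ = D m * X m * (1 - s⁻¹ • (T m * T m * ξ)) := by
        rw [hc, mul_sub, mul_sub, mul_one, mul_smul_comm, mul_smul_comm, ← mul_assoc]
      _ = _ := by rw [ha]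
  rw [e1, e2]
  simp only [sub_mul, one_mul, mul_sub, mul_one, mul_smul_comm]
  rw [hd]
  have e3 : T m * ξ * T' m * (T m * T m * ξ) = T m * ξ * T m * ξ := by
    rw [mul_assoc (T m * ξ), mul_assoc (T m) (T m), h.inv_mul_T_mul hm]; simp only [mul_assoc]
  rw [e3, h.quad m hm, h.inv, mul_smul_comm, mul_add, mul_smul_comm, mul_one, add_mul,
    smul_mul_assoc, smul_mul_assoc, one_mul]
  simp only [smul_add, smul_sub, inv_smul_smul₀ h.s_ne]
  module

/-- The Dunkl operators commute. Conjugation by the generators reduces this to the last two of them.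
-/
theorem dunkl_comm (h : IsDoubleHecke q s n T T' X w) (hD : IsDunklFamily s n T T' X w D)
    {i j : ℕ} (hi : i ≤ n) (hj : j ≤ n) : Commute (D i) (D j) := by
  have hC := h.dunkl_conj hD
  have h1 : ∀ d i, n = i + d → Commute (D i) (D n) := by
    intro d
    induction d with
    | zero => rintro i rfl; exact Commute.refl _
    | succ d ih =>
      rintro i rfl
      rcases Nat.eq_zero_or_pos d with rfl | hd
      · exact h.dunkl_comm_last hD
      · rw [hD.step i (by omega)]
        have hT := h.commute_conj hC le_rfl i (by omega) (by omega) (by omega)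
        exact ((hT.mul_left (ih (i + 1) (by omega))).mul_left hT).smul_left _
  have h2 : ∀ d i j, n = j + d → i < j → Commute (D i) (D j) := by
    intro d
    induction d with
    | zero =>
      intro i j hj hij
      obtain rfl : n = j := hj
      exact h1 (n - i) i (by omega)
    | succ d ih =>
      rintro i j hj hij
      rw [hD.step j (by omega)]
      have hT := (h.commute_conj hC (i := i) (by omega) j (by omega) (by omega) (by omega)).symm
      exact ((hT.mul_right (ih i (j + 1) (by omega) (by omega))).mul_right hT).smul_right _
  rcases lt_trichotomy i j with hij | rfl | hij
  · exact h2 (n - j) i j (by omega) hij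
  · exact Commute.refl _
  · exact (h2 (n - i) j i (by omega) hij).symm

/-- The raising operator `T'_0 ⋯ T'_{n-1} X_n`. -/
def raise (n : ℕ) (T' X : ℕ → R) : R := ascProd T' n * X n

/-- The raising operator shifts the index of a generator. -/
theorem T_raise (h : IsDoubleHecke q s n T T' X w) {i : ℕ} (hi : i + 1 < n) :
    T (i + 1) * raise n T' X = raise n T' X * T i := by
  have h1 := h.isBraid_inv.shift_asc le_rfl hi
  have h2 : ∀ j, T j = s • T' j - (1 - s) • (1 : R) := fun j => by
    rw [h.inv, smul_smul, mul_inv_cancel₀ h.s_ne, one_smul]; abel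
  have h3 : T (i + 1) * ascProd T' n = ascProd T' n * T i := by
    rw [h2, h2, sub_mul, mul_sub, smul_mul_assoc, mul_smul_comm, h1]; simp
  have hx : Commute (X n) (T i) := h.X_T_far i (by omega) n le_rfl (by omega) (by omega)
  rw [raise, ← mul_assoc, h3, mul_assoc, mul_assoc, hx.eq]

/-- The square of the raising operator carries the last generator over to the first one. -/
theorem T_raise_raise {m : ℕ} (h : IsDoubleHecke q s (m + 1) T T' X w) :
    T 0 * (raise (m + 1) T' X * raise (m + 1) T' X)
      = raise (m + 1) T' X * raise (m + 1) T' X * T m := by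
  have hm : m < m + 1 := by omega
  set P := ascProd T' (m + 1) with hP
  have h1 : T' 0 * (P * P) = P * P * T' m := h.isBraid_inv.shift_sq
  have h2 : ∀ j, T j = s • T' j - (1 - s) • (1 : R) := fun j => by
    rw [h.inv, smul_smul, mul_inv_cancel₀ h.s_ne, one_smul]; abel
  have h3 : T 0 * (P * P) = P * P * T m := by
    rw [h2, h2, sub_mul, mul_sub, smul_mul_assoc, mul_smul_comm, h1]; simp
  have hc : Commute (X (m + 1)) (ascProd T' m) :=
    commute_ascProd fun i hi => h.X_inv_far (by omega) (by omega) (by omega) (by omega)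
  have e1 : ascProd T' m = P * T m := by
    rw [hP, ascProd_succ, mul_assoc, h.inv_mul_T hm, mul_one]
  have h4 : raise (m + 1) T' X * raise (m + 1) T' X
      = s⁻¹ • (P * P * (T m * T m) * (X m * X (m + 1))) := by
    calc _ = P * (X (m + 1) * (ascProd T' m * T' m)) * X (m + 1) := by
          rw [raise, ← hP, hP, ascProd_succ]; simp only [mul_assoc]
      _ = P * ascProd T' m * (X (m + 1) * T' m) * X (m + 1) := by
          rw [← mul_assoc (X (m + 1)), hc.eq]; simp only [mul_assoc]
      _ = _ := by
          rw [h.X_succ_inv hm, e1, mul_smul_comm, smul_mul_assoc]; simp only [mul_assoc]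
  rw [h4, mul_smul_comm, smul_mul_assoc]
  congr 1
  calc _ = T 0 * (P * P) * (T m * T m) * (X m * X (m + 1)) := by simp only [mul_assoc]
    _ = P * P * (T m * T m) * (T m * (X m * X (m + 1))) := by rw [h3]; simp only [mul_assoc]
    _ = _ := by rw [(h.commute_T_X_mul_X hm).eq]; simp only [mul_assoc]

/-- The raising operator carries the last Cherednik operator over to the first one, with a factor
`q`. -/
theorem raise_cherednik_last (h : IsDoubleHecke q s n T T' X w)
    (hY : IsCherednikFamily s n T T' w Y) :
    raise n T' X * Y n = q • (Y 0 * raise n T' X) := by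
  have hs : s ^ n ≠ 0 := pow_ne_zero _ h.s_ne
  have e : s ^ n • (raise n T' X * Y n) = s ^ n • (q • (Y 0 * raise n T' X)) := by
    rw [smul_comm (s ^ n) q, ← smul_mul_assoc (s ^ n) (Y 0),
      h.conj_zero (h.cherednik_conj hY) le_rfl, hY.last, raise, xiLast,
      ← mul_assoc (ascProd T n), h.desc_inv_cancel le_rfl, one_mul, mul_assoc w, ← mul_assoc
      (descProd T n), h.desc_asc_cancel le_rfl, one_mul, ← h.X_zero_w, ← h.asc_X_desc le_rfl,
      smul_mul_assoc]
    simp only [mul_assoc]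
  simpa only [inv_smul_smul₀ hs] using congrArg (fun z => (s ^ n)⁻¹ • z) e

/-- The raising operator shifts the index of a Cherednik operator. -/
theorem raise_cherednik (h : IsDoubleHecke q s n T T' X w)
    (hY : IsCherednikFamily s n T T' w Y) {i : ℕ} (hi : i < n) :
    raise n T' X * Y i = Y (i + 1) * raise n T' X := by
  obtain ⟨m, rfl⟩ : ∃ m, n = m + 1 := ⟨n - 1, by omega⟩
  obtain ⟨d, hd⟩ : ∃ d, m = i + d := ⟨m - i, by omega⟩
  induction d generalizing i with
  | zero =>
    obtain rfl : m = i := by omega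
    have hm : m < m + 1 := by omega
    have hc : Commute (X (m + 1)) (descProd T' m) :=
      commute_descProd fun i hi => h.X_inv_far (by omega) (by omega) (by omega) (by omega)
    have h1 : w * ascProd T' m = ascProd (fun i => T' (i + 1)) m * w :=
      (semiconj_ascProd fun i hi => h.inv_w (by omega)).symm
    rw [hY.step m hi, hY.last, h.T_xiLast, raise, mul_smul_comm, xiLast]
    calc s⁻¹ • (ascProd T' (m + 1) * X (m + 1) * (descProd T' m * w * T m))
        = s⁻¹ • (ascProd T' (m + 1) * (X (m + 1) * descProd T' m) * w * T m) := by
          simp only [mul_assoc]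
      _ = s⁻¹ • (ascProd T' (m + 1) * descProd T' m * (X (m + 1) * w) * T m) := by
          rw [hc.eq]; simp only [mul_assoc]
      _ = s⁻¹ • (ascProd T' (m + 1) * descProd T' m * w * (X m * T m)) := by
          rw [h.X_w m hm]; simp only [mul_assoc]
      _ = ascProd T' (m + 1) * descProd T' m * (w * (T' m * X (m + 1))) := by
          rw [h.X_T' hm, mul_smul_comm, smul_smul, inv_mul_cancel₀ h.s_ne, one_smul]
          simp only [mul_assoc]
      _ = descProd T' (m + 1) * (ascProd (fun i => T' (i + 1)) m * w) * (T' m * X (m + 1)) := by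
          rw [← h.isBraid_inv.desc_mul_asc]; simp only [mul_assoc]
      _ = _ := by rw [← h1, ascProd_succ]; simp only [mul_assoc]
  | succ d ih =>
    conv_rhs => rw [hY.step (i + 1) (by omega)]
    rw [hY.step i hi, mul_smul_comm, smul_mul_assoc]
    congr 1
    calc raise (m + 1) T' X * (T i * Y (i + 1) * T i)
        = (raise (m + 1) T' X * T i) * Y (i + 1) * T i := by simp only [mul_assoc]
      _ = T (i + 1) * (raise (m + 1) T' X * Y (i + 1)) * T i := by
        rw [← h.T_raise (by omega)]; simp only [mul_assoc]
      _ = T (i + 1) * Y (i + 1 + 1) * (raise (m + 1) T' X * T i) := by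
        rw [ih (by omega) (by omega)]; simp only [mul_assoc]
      _ = _ := by rw [← h.T_raise (by omega)]; simp only [mul_assoc]

end IsDoubleHecke

end DoubleHecke

/-! ### Consecutive entries of reverse standard tableaux -/

namespace RST

variable {n : ℕ} {μ : YoungDiagram}

theorem eq_of_row_col (A : RST n μ) {i j : Fin (n + 1)} (hr : A.row i = A.row j)
    (hc : A.col i = A.col j) : i = j :=
  A.cell.injective (Subtype.ext (Prod.ext hr hc))

theorem exists_entry (A : RST n μ) {a b : ℕ} (h : (a, b) ∈ μ) :
    ∃ i, A.row i = a ∧ A.col i = b :=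
  ⟨A.cell.symm ⟨(a, b), h⟩, by simp [row], by simp [col]⟩

theorem row_col_mem (A : RST n μ) (i : Fin (n + 1)) : (A.row i, A.col i) ∈ μ :=
  (A.cell i).2

/-- The entries decrease in the componentwise order of the cells. -/
theorem lt_of_le (A : RST n μ) {i j : Fin (n + 1)} (hr : A.row i ≤ A.row j)
    (hc : A.col i ≤ A.col j) (hij : i ≠ j) : j < i := by
  rcases hr.eq_or_lt with hr | hr
  · exact A.row_decr i j hr (lt_of_le_of_ne hc fun h => hij (A.eq_of_row_col hr h))
  rcases hc.eq_or_lt with hc | hc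
  · exact A.col_decr i j hc hr
  obtain ⟨l, hl, hl'⟩ := A.exists_entry (μ.up_left_mem hr.le le_rfl (A.row_col_mem j))
  exact (A.col_decr l j hl' (hl.symm ▸ hr : A.row l < A.row j)).trans
    (A.row_decr i l hl.symm (hl'.symm ▸ hc : A.col i < A.col l))

variable (A : RST n μ) {k l : Fin (n + 1)}

theorem ct_of_row_eq (hkl : (k : ℕ) + 1 = l) (h : A.row k = A.row l) :
    A.ct l - A.ct k = -1 := by
  have hlt : A.col l < A.col k := by
    by_contra hc
    have := A.lt_of_le h.le (not_lt.mp hc) (fun e => by rw [e] at hkl; omega)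
    rw [Fin.lt_def] at this; omega
  have : ¬ A.col l + 1 < A.col k := by
    intro hc
    obtain ⟨j, h1, h2⟩ := A.exists_entry (μ.up_left_mem le_rfl hc.le (A.row_col_mem k))
    have e1 := A.row_decr j k h1 (show A.col j < A.col k by omega)
    have e2 := A.row_decr l j (by rw [← h1] at h; exact h.symm) (show A.col l < A.col j by omega)
    rw [Fin.lt_def] at e1 e2; omega
  unfold ct; omega

theorem ct_of_col_eq (hkl : (k : ℕ) + 1 = l) (h : A.col k = A.col l) :
    A.ct l - A.ct k = 1 := by
  have hlt : A.row l < A.row k := by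
    by_contra hc
    have := A.lt_of_le (not_lt.mp hc) h.le (fun e => by rw [e] at hkl; omega)
    rw [Fin.lt_def] at this; omega
  have : ¬ A.row l + 1 < A.row k := by
    intro hc
    obtain ⟨j, h1, h2⟩ := A.exists_entry (μ.up_left_mem hc.le le_rfl (A.row_col_mem k))
    have e1 := A.col_decr j k h2 (show A.row j < A.row k by omega)
    have e2 := A.col_decr l j (by rw [← h2] at h; exact h.symm) (show A.row l < A.row j by omega)
    rw [Fin.lt_def] at e1 e2; omega
  unfold ct; omega

theorem ct_of_row_lt (hkl : (k : ℕ) + 1 = l) (h : A.row k < A.row l) :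
    A.ct l - A.ct k ≤ -2 := by
  have : A.col l < A.col k := by
    by_contra hc
    have := A.lt_of_le h.le (not_lt.mp hc) (fun e => by rw [e] at hkl; omega)
    rw [Fin.lt_def] at this; omega
  unfold ct; omega

/-- Consecutive entries in different rows and columns are not on adjacent diagonals: otherwise a
third entry would lie between them. -/
theorem ct_of_row_gt (hkl : (k : ℕ) + 1 = l) (h : A.row l < A.row k) (hc : A.col k ≠ A.col l) :
    2 ≤ A.ct l - A.ct k := by
  have : ¬ A.col l < A.col k := by
    intro hc
    obtain ⟨j, h1, h2⟩ := A.exists_entry (μ.up_left_mem le_rfl hc.le (A.row_col_mem k))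
    have e1 := A.row_decr j k h1 (show A.col j < A.col k by omega)
    have e2 := A.col_decr l j h2.symm (show A.row l < A.row j by omega)
    rw [Fin.lt_def] at e1 e2; omega
  unfold ct; omega

/-- Two distinct entries of equal content are at distance at least `3`. -/
theorem ct_ne (hkl : k < l) (h : (l : ℕ) ≤ k + 2) : A.ct k ≠ A.ct l := by
  intro hct
  unfold ct at hct
  have hne : A.row k ≠ A.row l := fun e => hkl.ne (A.eq_of_row_col e (by omega))
  rcases Nat.lt_or_ge (A.row k) (A.row l) with hr | hr
  · exact absurd (A.lt_of_le hr.le (by omega) hkl.ne) hkl.not_gt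
  -- the cells left of and below the cell of `k` hold two different entries between `k` and `l`
  obtain ⟨i, h1, h2⟩ := A.exists_entry (μ.up_left_mem le_rfl (show A.col l ≤ A.col k by omega)
    (A.row_col_mem k))
  obtain ⟨j, h3, h4⟩ := A.exists_entry (μ.up_left_mem hr le_rfl (A.row_col_mem k))
  have e1 := A.row_decr i k h1 (show A.col i < A.col k by omega)
  have e2 := A.col_decr l i h2.symm (show A.row l < A.row i by omega)
  have e3 := A.col_decr j k h4 (show A.row j < A.row k by omega)
  have e4 := A.row_decr l j h3.symm (show A.col l < A.col j by omega)
  have hij : i = j := by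
    apply Fin.ext
    rw [Fin.lt_def] at e1 e2 e3 e4; omega
  rw [hij] at h1
  omega

/-- Exchanging consecutive entries whose contents differ by at least `2` gives a tableau. -/
theorem exists_isSwap (hkl : (k : ℕ) + 1 = l) (h1 : A.ct l - A.ct k ≠ 1)
    (h2 : A.ct l - A.ct k ≠ -1) : ∃ B : RST n μ, IsSwap A B k l := by
  have hr : A.row k ≠ A.row l := fun e => h2 (A.ct_of_row_eq hkl e)
  have hc : A.col k ≠ A.col l := fun e => h1 (A.ct_of_col_eq hkl e)
  have key : ∀ i j : Fin (n + 1), Equiv.swap k l j < Equiv.swap k l i →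
      (Equiv.swap k l i = k → Equiv.swap k l j ≠ l) → (Equiv.swap k l i = l →
      Equiv.swap k l j ≠ k) → j < i := by
    intro i j h3 h4 h5
    have e1 : (k : ℕ) ≠ l := by omega
    have e2 : k ≠ l := fun e => e1 (congrArg _ e)
    simp only [Equiv.swap_apply_def, Fin.lt_def, Fin.ext_iff, ne_eq] at h3 h4 h5 ⊢
    split_ifs at * <;> simp_all <;> omega
  refine ⟨⟨(Equiv.swap k l).trans A.cell, fun i j h3 h4 => ?_, fun i j h3 h4 => ?_⟩, rfl⟩
  · refine key i j (A.row_decr _ _ h3 h4) (fun e e' => ?_) fun e e' => ?_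
    · simp only [Equiv.trans_apply, e, e'] at h3; exact hr h3
    · simp only [Equiv.trans_apply, e, e'] at h3; exact hr h3.symm
  · refine key i j (A.col_decr _ _ h3 h4) (fun e e' => ?_) fun e e' => ?_
    · simp only [Equiv.trans_apply, e, e'] at h3; exact hc h3
    · simp only [Equiv.trans_apply, e, e'] at h3; exact hc h3.symm

variable {A}

theorem IsSwap.ct {B : RST n μ} (h : IsSwap A B k l) (i : Fin (n + 1)) :
    B.ct i = A.ct (Equiv.swap k l i) := by
  simp [RST.ct, RST.row, RST.col, show B.cell = _ from h]

theorem IsSwap.unique {B C : RST n μ} (h : IsSwap A B k l) (h' : IsSwap A C k l) : B = C :=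
  cell_injective ((show B.cell = _ from h).trans (show C.cell = _ from h').symm)

/-- A tableau is determined by its contents. -/
theorem ct_injective {A B : RST n μ} (h : ∀ i, A.ct i = B.ct i) : A = B := by
  have aux : ∀ (A B : RST n μ) (k : Fin (n + 1)), (∀ i, A.ct i = B.ct i) →
      (∀ l, k < l → A.cell l = B.cell l) → A.row k < B.row k → False := by
    intro A B k h ih hr
    have hc := h k
    unfold ct at hc
    obtain ⟨l, h1, h2⟩ := B.exists_entry (μ.up_left_mem hr.le (show A.col k ≤ B.col k by omega)
      (B.row_col_mem k))
    have hl : k < l := B.lt_of_le (i := l) (by omega) (by omega) fun e => by rw [e] at h1; omega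
    have e := ih l hl
    have h3 : A.row l = A.row k := by rw [← h1]; unfold row; rw [e]
    have h4 : A.col l = A.col k := by rw [← h2]; unfold col; rw [e]
    exact hl.ne' (A.eq_of_row_col h3 h4)
  have main : ∀ d : ℕ, ∀ k : Fin (n + 1), n - k = d → A.cell k = B.cell k := by
    intro d
    induction d using Nat.strong_induction_on with
    | _ d ih =>
      intro k hk
      have ih' : ∀ l, k < l → A.cell l = B.cell l := fun l hl =>
        ih (n - l) (by rw [Fin.lt_def] at hl; omega) l rfl
      have hr : A.row k = B.row k := by
        rcases lt_trichotomy (A.row k) (B.row k) with h1 | h1 | h1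
        · exact (aux A B k h ih' h1).elim
        · exact h1
        · exact (aux B A k (fun i => (h i).symm) (fun l hl => (ih' l hl).symm) h1).elim
      have hc := h k
      unfold ct at hc
      exact Subtype.ext (Prod.ext hr (show A.col k = B.col k by omega))
  exact cell_injective (Equiv.ext fun k => main _ k rfl)

theorem IsRoot.not_ct (hA : A.IsRoot) (hkl : (k : ℕ) + 1 = l) : ¬ A.ct k + 2 ≤ A.ct l := by
  intro hct
  have hlt : k < l := by rw [Fin.lt_def]; omega
  rcases (hA l k).mp hlt with hc | ⟨hc, hr⟩
  · unfold ct at hct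
    obtain ⟨j, h1, h2⟩ := A.exists_entry (μ.up_left_mem le_rfl hc.le (A.row_col_mem k))
    have e1 := A.row_decr j k h1 (show A.col j < A.col k by omega)
    have e2 := A.col_decr l j h2.symm (show A.row l < A.row j by omega)
    rw [Fin.lt_def] at e1 e2; omega
  · have := A.ct_of_col_eq hkl hc.symm
    omega

/-- If the contents never increase by two or more from one entry to the next, the tableau is filled
column by column. -/
theorem isRoot_of_not_ct (h : ∀ i : Fin n, ¬ A.ct i.castSucc + 2 ≤ A.ct i.succ) : A.IsRoot := by
  have hs : StrictAnti fun i => toLex (A.col i, A.row i) := by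
    rw [Fin.strictAnti_iff_succ_lt]
    intro i
    have hi : ((i.castSucc : Fin (n + 1)) : ℕ) + 1 = (i.succ : Fin (n + 1)) := by simp
    have hne : i.succ ≠ i.castSucc := fun e => by simp [Fin.ext_iff] at e
    rw [Prod.Lex.toLex_lt_toLex]
    by_contra hcon
    rcases lt_trichotomy (A.col i.castSucc) (A.col i.succ) with hc | hc | hc
    · rcases lt_trichotomy (A.row i.castSucc) (A.row i.succ) with hr | hr | hr
      · have := A.lt_of_le hr.le hc.le hne.symm
        simp [Fin.lt_def] at this
      · have := A.ct_of_row_eq hi hr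
        unfold ct at this; omega
      · have := A.ct_of_row_gt hi hr hc.ne
        exact h i (by omega)
    · have := A.ct_of_col_eq hi hc
      simp only [not_or, not_and] at hcon
      have h2 := hcon.2 hc.symm
      unfold ct at this; omega
    · exact hcon (Or.inl hc)
  intro i j
  rw [← hs.lt_iff_gt, Prod.Lex.toLex_lt_toLex]

end RST

/-! ### The Hecke algebra acting on tableaux -/

open RST MvPolynomial

section Coeff

variable {K : Type*} [Field K]

/-- The diagonal coefficient of `T_i` on a tableau, in terms of `m = CT[i+1] - CT[i]`. -/
noncomputable def diagCoeff (s : K) (m : ℤ) : K := -((1 - s) / (1 - s ^ m))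

/-- The coefficient of the exchanged tableau in the action of `T_i`. It vanishes for `m = ±1`, which
is when the entries are in the same row or column. -/
noncomputable def offCoeff (s : K) (m : ℤ) : K :=
  if m ≤ -2 then 1 else s * (1 - s ^ (m + 1)) * (1 - s ^ (m - 1)) / (1 - s ^ m) ^ 2

theorem offCoeff_one (s : K) : offCoeff s 1 = 0 := by simp [offCoeff]

theorem offCoeff_neg_one (s : K) : offCoeff s (-1) = 0 := by simp [offCoeff]

variable {s : K}

theorem diagCoeff_add_neg (h0 : s ≠ 0) {m : ℤ} (hm : s ^ m ≠ 1) :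
    diagCoeff s m + diagCoeff s (-m) = s - 1 := by
  unfold diagCoeff
  rw [zpow_neg]
  have hz : s ^ m ≠ 0 := zpow_ne_zero _ h0
  generalize s ^ m = z at *
  have h1 : 1 - z ≠ 0 := sub_ne_zero.mpr hm.symm
  have h3 : z - 1 ≠ 0 := sub_ne_zero.mpr hm
  have h4 : 1 - z⁻¹ = (z - 1) / z := by field_simp
  rw [h4]
  field_simp
  ring

theorem offCoeff_mul_neg (h0 : s ≠ 0) {m : ℤ} (hm : s ^ m ≠ 1) :
    offCoeff s m * offCoeff s (-m)
      = (s - 1) * diagCoeff s m + s - diagCoeff s m * diagCoeff s m := by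
  have hm0 : m ≠ 0 := by rintro rfl; simp at hm
  have hz : s ^ m ≠ 0 := zpow_ne_zero _ h0
  have key : ∀ k : ℤ, k = m ∨ k = -m → s * (1 - s ^ (k + 1)) * (1 - s ^ (k - 1)) / (1 - s ^ k) ^ 2
      = (s - 1) * diagCoeff s m + s - diagCoeff s m * diagCoeff s m := by
    intro k hk
    unfold diagCoeff
    rw [zpow_add_one₀ h0, zpow_sub_one₀ h0]
    have h1 : 1 - s ^ m ≠ 0 := sub_ne_zero.mpr hm.symm
    rcases hk with rfl | rfl
    · generalize s ^ k = z at *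
      field_simp
      ring
    · rw [zpow_neg]
      generalize s ^ m = z at *
      have h3 : z - 1 ≠ 0 := sub_ne_zero.mpr hm
      have h4 : 1 - z⁻¹ = (z - 1) / z := by field_simp
      rw [h4]
      field_simp
      ring
  rcases lt_trichotomy m (-1) with h | rfl | h
  · rw [offCoeff, if_pos (by omega), offCoeff, if_neg (by omega), one_mul, key _ (Or.inr rfl)]
  · rw [offCoeff_neg_one, zero_mul, ← key _ (Or.inl rfl)]; simp
  · rcases eq_or_ne m 1 with rfl | h1
    · rw [offCoeff_one, zero_mul, ← key _ (Or.inl rfl)]; simp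
    · rw [offCoeff, if_neg (by omega), offCoeff, if_pos (by omega), mul_one, key _ (Or.inl rfl)]

/-- The relation of the diagonal coefficients behind the braid relation on tableaux. -/
theorem diagCoeff_braid (h0 : s ≠ 0) {m k : ℤ} (hm : s ^ m ≠ 1) (hk : s ^ k ≠ 1)
    (hmk : s ^ (m + k) ≠ 1) :
    diagCoeff s m * diagCoeff s k + diagCoeff s (m + k) * diagCoeff s (-m)
      = diagCoeff s k * diagCoeff s (m + k) := by
  have e : diagCoeff s (-m) = s - 1 - diagCoeff s m := by
    rw [← diagCoeff_add_neg h0 hm]; ring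
  rw [e]
  unfold diagCoeff
  rw [zpow_add₀ h0] at *
  generalize s ^ m = z at *
  generalize s ^ k = y at *
  have h1 : 1 - z ≠ 0 := sub_ne_zero.mpr hm.symm
  have h2 : 1 - y ≠ 0 := sub_ne_zero.mpr hk.symm
  have h3 : 1 - z * y ≠ 0 := sub_ne_zero.mpr hmk.symm
  field_simp
  ring

end Coeff

section Hecke

variable {K : Type*} [Field K] {n : ℕ} {μ : YoungDiagram}

theorem end_ext {f g : Module.End K (VPoly K n μ)}
    (h : ∀ A p, f (tens p A) = g (tens p A)) : f = g :=
  LinearMap.pi_ext h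

theorem tabT_tens (s : K) (i : Fin n) (p : MvPolynomial (Fin (n + 1)) K) (A : RST n μ) :
    tabT s i (tens p A) = ∑ B, tabCoeff s i A B • tens p B := by
  simp only [tabT, LinearMap.sum_apply, LinearMap.smul_apply, LinearMap.comp_apply,
    LinearMap.proj_apply, tens]
  rw [Finset.sum_eq_single A]
  · simp
  · intro C _ hC
    refine Finset.sum_eq_zero fun B _ => ?_
    rw [Pi.single_eq_of_ne hC, map_zero, smul_zero]
  · simp

/-- An arbitrary filling of the diagram by `0, …, n`. -/
abbrev Filling (n : ℕ) (μ : YoungDiagram) := Fin (n + 1) ≃ μ.cells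

open Classical in
/-- The tensor `p ⊗ F`, where a filling `F` that is not a reverse standard tableau counts as `0`. -/
noncomputable def tensF (p : MvPolynomial (Fin (n + 1)) K) (F : Filling n μ) : VPoly K n μ :=
  if h : ∃ A : RST n μ, A.cell = F then tens p h.choose else 0

theorem tensF_cell (p : MvPolynomial (Fin (n + 1)) K) (A : RST n μ) :
    tensF p A.cell = tens p A := by
  have h : ∃ B : RST n μ, B.cell = A.cell := ⟨A, rfl⟩
  rw [tensF, dif_pos h, cell_injective h.choose_spec]

theorem tensF_of_not (p : MvPolynomial (Fin (n + 1)) K) {F : Filling n μ}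
    (h : ¬ ∃ A : RST n μ, A.cell = F) : tensF p F = 0 := dif_neg h

theorem castSucc_eq_succ {i j : Fin n} (h : (i : ℕ) + 1 = j) : j.castSucc = i.succ := by
  ext; simp [← h]

theorem comp_swap_braid {α : Type*} (F : Fin (n + 1) → α) {i j : Fin n} (h : (i : ℕ) + 1 = j) :
    ((F ∘ Equiv.swap i.castSucc i.succ) ∘ Equiv.swap j.castSucc j.succ)
        ∘ Equiv.swap i.castSucc i.succ
      = ((F ∘ Equiv.swap j.castSucc j.succ) ∘ Equiv.swap i.castSucc i.succ)
        ∘ Equiv.swap j.castSucc j.succ := by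
  have e : Equiv.swap i.castSucc i.succ * Equiv.swap j.castSucc j.succ
      * Equiv.swap i.castSucc i.succ = Equiv.swap j.castSucc j.succ
      * Equiv.swap i.castSucc i.succ * Equiv.swap j.castSucc j.succ := by
    rw [castSucc_eq_succ h]
    have h1 : i.castSucc ≠ i.succ := by simp [Fin.ext_iff]
    have h2 : i.castSucc ≠ j.succ := by simp [Fin.ext_iff]; omega
    have h3 : i.succ ≠ j.succ := by simp [Fin.ext_iff]; omega
    have e1 := Equiv.swap_mul_swap_mul_swap h3.symm h2.symm
    have e2 := Equiv.swap_mul_swap_mul_swap h1 h2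
    rw [Equiv.swap_comm i.succ i.castSucc, Equiv.swap_comm j.succ i.succ] at e1
    rw [e1, e2, Equiv.swap_comm]
  funext x
  exact congrArg (fun σ => F (σ x)) e

theorem comp_swap_far {α : Type*} (F : Fin (n + 1) → α) {i j : Fin n} (h : (i : ℕ) + 1 < j) :
    (F ∘ Equiv.swap i.castSucc i.succ) ∘ Equiv.swap j.castSucc j.succ
      = (F ∘ Equiv.swap j.castSucc j.succ) ∘ Equiv.swap i.castSucc i.succ := by
  have hd : Equiv.Perm.Disjoint (Equiv.swap i.castSucc i.succ) (Equiv.swap j.castSucc j.succ) := by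
    intro x
    by_cases h1 : x = i.castSucc ∨ x = i.succ
    · right
      refine Equiv.swap_apply_of_ne_of_ne ?_ ?_ <;> rcases h1 with rfl | rfl <;>
        simp [Fin.ext_iff] <;> omega
    · left
      push Not at h1
      exact Equiv.swap_apply_of_ne_of_ne h1.1 h1.2
  funext x
  exact congrArg (fun σ => F (σ x)) hd.commute.eq

namespace Filling

/-- The filling with the entries `i` and `i + 1` exchanged. -/
def swap (F : Filling n μ) (i : Fin n) : Filling n μ :=
  (Equiv.swap i.castSucc i.succ).trans F

/-- The difference of the contents of `i + 1` and `i`. -/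
def diff (F : Filling n μ) (i : Fin n) : ℤ :=
  (((F i.succ : ℕ × ℕ).2 : ℤ) - (F i.succ : ℕ × ℕ).1)
    - (((F i.castSucc : ℕ × ℕ).2 : ℤ) - (F i.castSucc : ℕ × ℕ).1)

variable (F : Filling n μ) {i j : Fin n}

theorem swap_swap (i : Fin n) : swap (swap F i) i = F := by
  exact Equiv.ext fun x => by simp [swap]

theorem diff_swap (i : Fin n) : diff (swap F i) i = -diff F i := by
  simp [diff, swap]

theorem diff_swap_succ (h : (i : ℕ) + 1 = j) : diff (swap F i) j = diff F i + diff F j := by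
  have h1 : Equiv.swap i.castSucc i.succ j.succ = j.succ :=
    Equiv.swap_apply_of_ne_of_ne (by simp [Fin.ext_iff]; omega) (by simp [Fin.ext_iff]; omega)
  simp [diff, swap, castSucc_eq_succ h, h1]

theorem diff_swap_pred (h : (i : ℕ) + 1 = j) : diff (swap F j) i = diff F i + diff F j := by
  have h1 : Equiv.swap i.succ j.succ i.castSucc = i.castSucc :=
    Equiv.swap_apply_of_ne_of_ne (by simp [Fin.ext_iff]) (by simp [Fin.ext_iff]; omega)
  simp [diff, swap, castSucc_eq_succ h, h1]

theorem swap_braid (h : (i : ℕ) + 1 = j) :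
    swap (swap (swap F i) j) i = swap (swap (swap F j) i) j :=
  Equiv.ext (congrFun (comp_swap_braid F h))

theorem diff_swap_far (h : (i : ℕ) + 1 < j) :
    diff (swap F i) j = diff F j ∧ diff (swap F j) i = diff F i := by
  have h1 : Equiv.swap i.castSucc i.succ j.succ = j.succ :=
    Equiv.swap_apply_of_ne_of_ne (by simp [Fin.ext_iff]; omega) (by simp [Fin.ext_iff]; omega)
  have h2 : Equiv.swap i.castSucc i.succ j.castSucc = j.castSucc :=
    Equiv.swap_apply_of_ne_of_ne (by simp [Fin.ext_iff]; omega) (by simp [Fin.ext_iff]; omega)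
  have h3 : Equiv.swap j.castSucc j.succ i.succ = i.succ :=
    Equiv.swap_apply_of_ne_of_ne (by simp [Fin.ext_iff]; omega) (by simp [Fin.ext_iff]; omega)
  have h4 : Equiv.swap j.castSucc j.succ i.castSucc = i.castSucc :=
    Equiv.swap_apply_of_ne_of_ne (by simp [Fin.ext_iff]; omega) (by simp [Fin.ext_iff]; omega)
  simp [diff, swap, h1, h2, h3, h4]

theorem swap_far (h : (i : ℕ) + 1 < j) : swap (swap F i) j = swap (swap F j) i :=
  Equiv.ext (congrFun (comp_swap_far F h))

end Filling

open Filling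

theorem diff_cell (A : RST n μ) (i : Fin n) :
    diff A.cell i = A.ct i.succ - A.ct i.castSucc := rfl

/-- The seminormal form, written uniformly for all fillings: on a filling that is not a tableau, or
whose exchange is not a tableau, the coefficients that matter vanish. -/
theorem tabT_tensF {s : K} (h0 : s ≠ 0) (h1 : s ≠ 1) (i : Fin n)
    (p : MvPolynomial (Fin (n + 1)) K) (F : Filling n μ) :
    tabT s i (tensF p F) = diagCoeff s (diff F i) • tensF p F
      + offCoeff s (diff F i) • tensF p (swap F i) := by
  have hi : ((i.castSucc : Fin (n + 1)) : ℕ) + 1 = (i.succ : Fin (n + 1)) := by simp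
  have h1' : 1 - s ≠ 0 := sub_ne_zero.mpr h1.symm
  have hoff : ∀ A : RST n μ, ¬ (∃ B : RST n μ, B.cell = swap A.cell i) →
      diff A.cell i = 1 ∨ diff A.cell i = -1 := by
    intro A hA
    by_contra hcon
    push Not at hcon
    obtain ⟨B, hB⟩ := A.exists_isSwap hi hcon.1 hcon.2
    exact hA ⟨B, hB⟩
  by_cases hF : ∃ A : RST n μ, A.cell = F
  · obtain ⟨A, rfl⟩ := hF
    rw [tensF_cell, tabT_tens]
    have hsingle : ∀ c : K, (∀ B, tabCoeff s i A B = if B = A then c else 0) →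
        ∑ B, tabCoeff s i A B • tens p B = c • tens p A := by
      intro c hc
      rw [Finset.sum_eq_single A]
      · rw [hc, if_pos rfl]
      · intro B _ hB
        rw [hc, if_neg hB, zero_smul]
      · simp
    by_cases hr : A.row i.castSucc = A.row i.succ
    · have hm : diff A.cell i = -1 := A.ct_of_row_eq hi hr
      rw [hm, offCoeff_neg_one, zero_smul, add_zero, hsingle s fun B => by simp [tabCoeff, hr]]
      congr 1
      have h3 : s - 1 ≠ 0 := sub_ne_zero.mpr h1
      have h4 : 1 - s⁻¹ = (s - 1) / s := by field_simp
      rw [diagCoeff, zpow_neg_one, h4]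
      field_simp
      ring
    by_cases hc : A.col i.castSucc = A.col i.succ
    · have hm : diff A.cell i = 1 := A.ct_of_col_eq hi hc
      rw [hm, offCoeff_one, zero_smul, add_zero, hsingle (-1) fun B => by simp [tabCoeff, hr, hc]]
      congr 1
      rw [diagCoeff, zpow_one, div_self h1']
    have hm : diff A.cell i ≤ -2 ∧ A.row i.castSucc < A.row i.succ ∨
        2 ≤ diff A.cell i ∧ ¬ A.row i.castSucc < A.row i.succ := by
      rcases lt_or_gt_of_ne hr with h | h
      · exact Or.inl ⟨A.ct_of_row_lt hi h, h⟩
      · exact Or.inr ⟨A.ct_of_row_gt hi h hc, h.not_gt⟩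
    obtain ⟨B, hB⟩ := A.exists_isSwap hi (show diff A.cell i ≠ 1 by omega)
      (show diff A.cell i ≠ -1 by omega)
    have hAB : A ≠ B := by
      rintro rfl
      have := hB.ct i.succ
      rw [Equiv.swap_apply_right] at this
      have : diff A.cell i = 0 := by rw [diff_cell, this, sub_self]
      omega
    have hBc : swap A.cell i = B.cell := (show B.cell = _ from hB).symm
    rw [hBc, tensF_cell, Finset.sum_eq_add A B hAB]
    · congr 2
      · simp [tabCoeff, hr, hc, diagCoeff, diff_cell]
      · rw [diff_cell] at hm ⊢
        simp only [tabCoeff, hr, hc, if_false, hAB.symm, hB, if_true, offCoeff]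
        rcases hm with ⟨h, h'⟩ | ⟨h, h'⟩
        · rw [if_pos h, if_pos h']
        · rw [if_neg h', if_neg (by omega)]
    · intro C _ hC
      have : ¬ IsSwap A C i.castSucc i.succ := fun h => hC.2 (h.unique hB)
      simp [tabCoeff, hr, hc, hC.1, this]
    · simp
    · simp
  · rw [tensF_of_not p hF, map_zero, smul_zero, zero_add]
    by_cases hS : ∃ A : RST n μ, A.cell = swap F i
    · obtain ⟨A, hA⟩ := hS
      have e : F = swap A.cell i := by rw [hA, swap_swap]
      have := hoff A (e ▸ hF)
      have hd : diff F i = -diff A.cell i := by rw [e, diff_swap]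
      rw [hd]
      rcases this with h | h <;> simp [h, offCoeff_one, offCoeff_neg_one]
    · rw [tensF_of_not p hS, smul_zero]

variable {s : K}

theorem tabT_quad (h0 : s ≠ 0) (hs : ∀ m : ℤ, m ≠ 0 → s ^ m ≠ 1) (i : Fin n) :
    (tabT s i * tabT s i : Module.End K (VPoly K n μ)) = (s - 1) • tabT s i + s • 1 := by
  have h1 : s ≠ 1 := by simpa using hs 1 one_ne_zero
  refine end_ext fun A p => ?_
  have hm : s ^ diff A.cell i ≠ 1 := by
    refine hs _ ?_
    rw [diff_cell, sub_ne_zero]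
    exact (A.ct_ne (by simp [Fin.lt_def]) (by simp)).symm
  have e1 := diagCoeff_add_neg h0 hm
  have e2 := offCoeff_mul_neg h0 hm
  simp only [← tensF_cell, Module.End.mul_apply, LinearMap.add_apply, LinearMap.smul_apply,
    Module.End.one_apply, tabT_tensF h0 h1, map_add, map_smul, diff_swap, swap_swap]
  generalize diff A.cell i = m at *
  have e3 : diagCoeff s (-m) = s - 1 - diagCoeff s m := by rw [← e1]; ring
  rw [e3]
  match_scalars
  · linear_combination e2
  · ring

theorem tabT_far (h0 : s ≠ 0) (h1 : s ≠ 1) {i j : Fin n} (h : (i : ℕ) + 1 < j) :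
    Commute (tabT s i : Module.End K (VPoly K n μ)) (tabT s j) := by
  refine end_ext fun A p => ?_
  have e := fun F : Filling n μ => (diff_swap_far F h).1
  have e' := fun F : Filling n μ => (diff_swap_far F h).2
  simp only [← tensF_cell, Module.End.mul_apply, tabT_tensF h0 h1, map_add, map_smul, e, e',
    swap_far _ h]
  module

/-- The braid relation in the seminormal form, checked on the span of the six fillings obtained by
permuting three consecutive entries. -/
theorem tabT_braid (h0 : s ≠ 0) (hs : ∀ m : ℤ, m ≠ 0 → s ^ m ≠ 1) {i j : Fin n}
    (h : (i : ℕ) + 1 = j) :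
    (tabT s i * tabT s j * tabT s i : Module.End K (VPoly K n μ))
      = tabT s j * tabT s i * tabT s j := by
  have h1 : s ≠ 1 := by simpa using hs 1 one_ne_zero
  refine end_ext fun A p => ?_
  have hm : s ^ diff A.cell i ≠ 1 := by
    refine hs _ ?_
    rw [diff_cell, sub_ne_zero]
    exact (A.ct_ne (by simp [Fin.lt_def]) (by simp)).symm
  have hk : s ^ diff A.cell j ≠ 1 := by
    refine hs _ ?_
    rw [diff_cell, sub_ne_zero]
    exact (A.ct_ne (by simp [Fin.lt_def]) (by simp)).symm
  have hmk : s ^ (diff A.cell i + diff A.cell j) ≠ 1 := by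
    refine hs _ ?_
    rw [diff_cell, diff_cell, castSucc_eq_succ h]
    have := A.ct_ne (k := i.castSucc) (l := j.succ) (by simp [Fin.lt_def]; omega)
      (by simp; omega)
    omega
  simp only [← tensF_cell, Module.End.mul_apply, tabT_tensF h0 h1, map_add, map_smul, smul_add,
    diff_swap, swap_swap, diff_swap_succ _ h, diff_swap_pred _ h, swap_braid _ h]
  generalize diff A.cell i = m at *
  generalize diff A.cell j = k at *
  have a1 : -m + (m + k) = k := by ring
  have a2 : m + k + -k = m := by ring
  simp only [a1, a2]
  have hkm : s ^ (k + m) ≠ 1 := by rwa [add_comm]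
  have e1 := diagCoeff_add_neg h0 hm
  have e2 := diagCoeff_add_neg h0 hk
  have e3 := offCoeff_mul_neg h0 hm
  have e4 := offCoeff_mul_neg h0 hk
  have e5 := diagCoeff_braid h0 hm hk hmk
  have e6 := diagCoeff_braid h0 hk hm hkm
  rw [add_comm k m] at e6
  match_scalars
  · linear_combination diagCoeff s (m + k) * (e3 - e4)
      + (diagCoeff s m - diagCoeff s k) * (e5 - diagCoeff s (m + k) * e1)
  · linear_combination offCoeff s m * e5
  · linear_combination -offCoeff s k * e6
  all_goals ring


end Hecke

/-! ### Relations forced by the exchange of generators and variables -/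

section Exchange

variable {K R : Type*} [Field K] [Ring R] [Algebra K R]

/-- If `a` satisfies the exchange relations with `x` and `y`, its quadratic polynomial commutes with
`x` and `y`. -/
theorem quad_exchange {s : K} {a x y : R} (xa : x * a = a * y + (1 - s) • y)
    (ya : y * a = a * x - (1 - s) • y) :
    x * (a * a - ((s - 1) • a + s • (1 : R))) = (a * a - ((s - 1) • a + s • (1 : R))) * x ∧
    y * (a * a - ((s - 1) • a + s • (1 : R))) = (a * a - ((s - 1) • a + s • (1 : R))) * y := by
  have xa' : ∀ t, x * (a * t) = a * (y * t) + (1 - s) • (y * t) := fun t => by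
    rw [← mul_assoc, xa, add_mul, mul_assoc, smul_mul_assoc]
  have ya' : ∀ t, y * (a * t) = a * (x * t) - (1 - s) • (y * t) := fun t => by
    rw [← mul_assoc, ya, sub_mul, mul_assoc, smul_mul_assoc]
  constructor <;>
  · simp only [mul_sub, sub_mul, mul_add, add_mul, mul_assoc, xa', ya', xa, ya, mul_smul_comm,
      smul_mul_assoc, mul_one, one_mul, smul_add, smul_sub]
    module

/-- If `a` and `b` satisfy the quadratic and the exchange relations, the defect of the braid
relation exchanges the variables `x` and `z`. -/
theorem braid_exchange {s : K} {a b x y z : R} (qa : a * a = (s - 1) • a + s • (1 : R))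
    (qb : b * b = (s - 1) • b + s • (1 : R)) (xa : x * a = a * y + (1 - s) • y)
    (ya : y * a = a * x - (1 - s) • y) (za : z * a = a * z) (xb : x * b = b * x)
    (yb : y * b = b * z + (1 - s) • z) (zb : z * b = b * y - (1 - s) • z) :
    x * (a * b * a - b * a * b) = (a * b * a - b * a * b) * z ∧
    y * (a * b * a - b * a * b) = (a * b * a - b * a * b) * y ∧
    z * (a * b * a - b * a * b) = (a * b * a - b * a * b) * x := by
  have xa' : ∀ t, x * (a * t) = a * (y * t) + (1 - s) • (y * t) := fun t => by
    rw [← mul_assoc, xa, add_mul, mul_assoc, smul_mul_assoc]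
  have ya' : ∀ t, y * (a * t) = a * (x * t) - (1 - s) • (y * t) := fun t => by
    rw [← mul_assoc, ya, sub_mul, mul_assoc, smul_mul_assoc]
  have yb' : ∀ t, y * (b * t) = b * (z * t) + (1 - s) • (z * t) := fun t => by
    rw [← mul_assoc, yb, add_mul, mul_assoc, smul_mul_assoc]
  have zb' : ∀ t, z * (b * t) = b * (y * t) - (1 - s) • (z * t) := fun t => by
    rw [← mul_assoc, zb, sub_mul, mul_assoc, smul_mul_assoc]
  have za' : ∀ t, z * (a * t) = a * (z * t) := fun t => by rw [← mul_assoc, za, mul_assoc]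
  have xb' : ∀ t, x * (b * t) = b * (x * t) := fun t => by rw [← mul_assoc, xb, mul_assoc]
  have qa' : ∀ t, a * (a * t) = (s - 1) • (a * t) + s • t := fun t => by
    rw [← mul_assoc, qa, add_mul, smul_mul_assoc, smul_mul_assoc, one_mul]
  have qb' : ∀ t, b * (b * t) = (s - 1) • (b * t) + s • t := fun t => by
    rw [← mul_assoc, qb, add_mul, smul_mul_assoc, smul_mul_assoc, one_mul]
  refine ⟨?_, ?_, ?_⟩ <;>
  · simp only [mul_sub, sub_mul, mul_add, mul_assoc, xa', ya', yb', zb', za', xb', xa, ya, yb, zb,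
      za, xb, qa', qb', mul_smul_comm, smul_add, smul_sub]
    module

/-- The exchange relations between the generators `T` and the variables `X`. -/
structure IsExchange (s : K) (n : ℕ) (T X : ℕ → R) : Prop where
  X_T : ∀ i < n, X i * T i = T i * X (i + 1) + (1 - s) • X (i + 1)
  X_succ_T : ∀ i < n, X (i + 1) * T i = T i * X i - (1 - s) • X (i + 1)
  X_T_far : ∀ i < n, ∀ j ≤ n, j ≠ i → j ≠ i + 1 → X j * T i = T i * X j

namespace IsExchange

variable {s : K} {n : ℕ} {T X : ℕ → R}

theorem quad (h : IsExchange s n T X) {i : ℕ} (hi : i < n) {j : ℕ} (hj : j ≤ n) :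
    ∃ F, X j * (T i * T i - ((s - 1) • T i + s • (1 : R)))
      = (T i * T i - ((s - 1) • T i + s • (1 : R))) * F := by
  have hq := quad_exchange (h.X_T i hi) (h.X_succ_T i hi)
  by_cases h1 : j = i
  · subst h1; exact ⟨_, hq.1⟩
  by_cases h2 : j = i + 1
  · subst h2; exact ⟨_, hq.2⟩
  refine ⟨X j, ?_⟩
  have hc : Commute (X j) (T i) := h.X_T_far i hi j hj h1 h2
  exact ((hc.mul_right hc).sub_right
    ((hc.smul_right _).add_right ((Commute.one_right _).smul_right _))).eq

theorem braid (h : IsExchange s n T X)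
    (hq : ∀ i < n, T i * T i = (s - 1) • T i + s • (1 : R)) {i : ℕ} (hi : i + 1 < n) {j : ℕ}
    (hj : j ≤ n) :
    ∃ F, X j * (T i * T (i + 1) * T i - T (i + 1) * T i * T (i + 1))
      = (T i * T (i + 1) * T i - T (i + 1) * T i * T (i + 1)) * F := by
  have hi' : i < n := by omega
  have hb := braid_exchange (hq i hi') (hq (i + 1) hi) (h.X_T i hi') (h.X_succ_T i hi')
    (h.X_T_far i hi' (i + 1 + 1) (by omega) (by omega) (by omega))
    (h.X_T_far (i + 1) hi i (by omega) (by omega) (by omega)) (h.X_T (i + 1) hi)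
    (h.X_succ_T (i + 1) hi)
  by_cases h1 : j = i
  · subst h1; exact ⟨_, hb.1⟩
  by_cases h2 : j = i + 1
  · subst h2; exact ⟨_, hb.2.1⟩
  by_cases h3 : j = i + 1 + 1
  · subst h3; exact ⟨_, hb.2.2⟩
  refine ⟨X j, ?_⟩
  have hc : Commute (X j) (T i) := h.X_T_far i hi' j hj h1 h2
  have hc' : Commute (X j) (T (i + 1)) := h.X_T_far (i + 1) hi j hj h2 h3
  exact (((hc.mul_right hc').mul_right hc).sub_right ((hc'.mul_right hc).mul_right hc')).eq

theorem far (h : IsExchange s n T X) {i k : ℕ} (hik : i + 1 < k) (hk : k < n) {j : ℕ}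
    (hj : j ≤ n) : ∃ F, X j * (T i * T k - T k * T i) = (T i * T k - T k * T i) * F := by
  -- two generators acting on disjoint pairs of variables can be treated one after the other
  have aux : ∀ a b : R, ∀ l, X l * a = a * X l → X l * b = b * X (l + 1) + (1 - s) • X (l + 1) →
      X (l + 1) * a = a * X (l + 1) → X l * (a * b - b * a) = (a * b - b * a) * X (l + 1) := by
    intro a b l h1 h2 h3
    rw [mul_sub, ← mul_assoc, h1, mul_assoc, h2, ← mul_assoc, h2, add_mul, mul_assoc, h3]
    simp only [mul_add, sub_mul, mul_assoc, mul_smul_comm, smul_mul_assoc, h3]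
    abel
  have aux' : ∀ a b : R, ∀ l, X l * a = a * X l → X (l + 1) * b = b * X l - (1 - s) • X (l + 1) →
      X (l + 1) * a = a * X (l + 1) → X (l + 1) * (a * b - b * a) = (a * b - b * a) * X l := by
    intro a b l h1 h2 h3
    rw [mul_sub, ← mul_assoc, h3, mul_assoc, h2, ← mul_assoc, h2, sub_mul, mul_assoc, h1]
    simp only [mul_sub, sub_mul, mul_assoc, mul_smul_comm, smul_mul_assoc, h3]
    abel
  have hneg : T i * T k - T k * T i = -(T k * T i - T i * T k) := by abel
  have hi : i < n := by omega
  have f1 := h.X_T_far i hi k (by omega) (by omega) (by omega)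
  have f2 := h.X_T_far i hi (k + 1) (by omega) (by omega) (by omega)
  have f3 := h.X_T_far k hk i (by omega) (by omega) (by omega)
  have f4 := h.X_T_far k hk (i + 1) (by omega) (by omega) (by omega)
  by_cases h1 : j = i
  · subst h1
    exact ⟨_, by rw [hneg, mul_neg, aux _ _ _ f3 (h.X_T _ hi) f4, neg_mul]⟩
  by_cases h2 : j = i + 1
  · subst h2
    exact ⟨_, by rw [hneg, mul_neg, aux' _ _ _ f3 (h.X_succ_T _ hi) f4, neg_mul]⟩
  by_cases h3 : j = k
  · subst h3
    exact ⟨_, aux _ _ _ f1 (h.X_T _ hk) f2⟩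
  by_cases h4 : j = k + 1
  · subst h4
    exact ⟨_, aux' _ _ _ f1 (h.X_succ_T _ hk) f2⟩
  have hc : Commute (X j) (T i) := h.X_T_far i hi j hj h1 h2
  have hc' : Commute (X j) (T k) := h.X_T_far k hk j hj h3 h4
  exact ⟨X j, ((hc.mul_right hc').sub_right (hc'.mul_right hc)).eq⟩

variable {q : K} {w : R}

theorem shift_w (h : IsExchange s n T X) (hw : ∀ i < n, X (i + 1) * w = w * X i)
    (hw0 : X 0 * w = q • (w * X n)) {i : ℕ} (hi : i + 1 < n) {j : ℕ} (hj : j ≤ n) :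
    ∃ F, X j * (T (i + 1) * w - w * T i) = (T (i + 1) * w - w * T i) * F := by
  have hi' : i < n := by omega
  by_cases h1 : j = i + 1
  · subst h1
    refine ⟨X (i + 1), ?_⟩
    rw [mul_sub, ← mul_assoc, h.X_T _ hi, ← mul_assoc, hw _ hi', mul_assoc, h.X_T _ hi', add_mul,
      mul_assoc, smul_mul_assoc, hw _ hi]
    simp only [mul_add, sub_mul, mul_assoc, mul_smul_comm]
    abel
  by_cases h2 : j = i + 1 + 1
  · subst h2
    refine ⟨X i, ?_⟩
    rw [mul_sub, ← mul_assoc, h.X_succ_T _ hi, ← mul_assoc, hw _ hi, mul_assoc, h.X_succ_T _ hi',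
      sub_mul, mul_assoc, smul_mul_assoc, hw _ hi, hw _ hi']
    simp only [mul_sub, sub_mul, mul_assoc, mul_smul_comm]
    abel
  have hf := h.X_T_far (i + 1) hi j hj h1 h2
  rcases Nat.eq_zero_or_pos j with rfl | hj0
  · refine ⟨q • X n, ?_⟩
    have hn := h.X_T_far i hi' n le_rfl (by omega) (by omega)
    rw [mul_sub, ← mul_assoc, hf, ← mul_assoc, hw0, mul_assoc, hw0, smul_mul_assoc, mul_assoc w, hn]
    simp only [sub_mul, mul_assoc, mul_smul_comm, smul_sub]
  · obtain ⟨l, rfl⟩ : ∃ l, j = l + 1 := ⟨j - 1, by omega⟩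
    refine ⟨X l, ?_⟩
    have hl := h.X_T_far i hi' l (by omega) (by omega) (by omega)
    rw [mul_sub, ← mul_assoc, hf, ← mul_assoc, hw _ (by omega), mul_assoc, hw _ (by omega),
      mul_assoc w, hl]
    simp only [sub_mul, mul_assoc]

theorem shift_w_w {m : ℕ} {X T : ℕ → R} (h : IsExchange s (m + 1) T X)
    (hw : ∀ i < m + 1, X (i + 1) * w = w * X i)
    (hw0 : X 0 * w = q • (w * X (m + 1))) {j : ℕ} (hj : j ≤ m + 1) :
    ∃ F, X j * (T 0 * (w * w) - w * w * T m) = (T 0 * (w * w) - w * w * T m) * F := by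
  have e0 : X 0 * (w * w) = q • (w * w * X m) := by
    rw [← mul_assoc, hw0, smul_mul_assoc, mul_assoc, hw m (by omega), mul_assoc]
  have e1 : X 1 * (w * w) = q • (w * w * X (m + 1)) := by
    rw [← mul_assoc, hw 0 (by omega), mul_assoc, hw0, mul_smul_comm, mul_assoc]
  rcases Nat.lt_or_ge j 2 with h2 | h2
  · interval_cases j
    · refine ⟨q • X (m + 1), ?_⟩
      rw [mul_sub, ← mul_assoc (X 0), h.X_T 0 (by omega), ← mul_assoc (X 0), e0, smul_mul_assoc,
        mul_assoc (w * w), h.X_T m (by omega), add_mul, mul_assoc, smul_mul_assoc, zero_add, e1]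
      simp only [mul_add, sub_mul, mul_smul_comm, smul_add, smul_sub, mul_assoc]
      module
    · refine ⟨q • X m, ?_⟩
      have := h.X_succ_T 0 (by omega)
      rw [zero_add] at this
      rw [mul_sub, ← mul_assoc (X 1), this, ← mul_assoc (X 1), e1, smul_mul_assoc,
        mul_assoc (w * w),
        h.X_succ_T m (by omega), sub_mul, mul_assoc, smul_mul_assoc, e0, e1]
      simp only [mul_sub, sub_mul, mul_smul_comm, smul_sub, mul_assoc]
      module
  · obtain ⟨l, rfl⟩ : ∃ l, j = l + 1 + 1 := ⟨j - 2, by omega⟩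
    refine ⟨X l, ?_⟩
    have hf := h.X_T_far 0 (by omega) (l + 1 + 1) hj (by omega) (by omega)
    have hl := h.X_T_far m (by omega) l (by omega) (by omega) (by omega)
    have e2 : X (l + 1 + 1) * (w * w) = w * w * X l := by
      rw [← mul_assoc, hw _ (by omega), mul_assoc, hw _ (by omega), mul_assoc]
    rw [mul_sub, ← mul_assoc (X _), hf, mul_assoc, e2, ← mul_assoc (X _), e2, mul_assoc (w * w), hl]
    simp only [sub_mul, mul_assoc]

end IsExchange

/-- The product of the adjacent transpositions moves the first variable to the last place. -/
theorem X_mul_ascProd {X σ : ℕ → R} {n : ℕ} (h1 : ∀ i < n, X i * σ i = σ i * X (i + 1))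
    (h2 : ∀ i < n, X (i + 1) * σ i = σ i * X i)
    (h3 : ∀ i < n, ∀ j ≤ n, j ≠ i → j ≠ i + 1 → X j * σ i = σ i * X j) {k : ℕ} (hk : k ≤ n) :
    X 0 * ascProd σ k = ascProd σ k * X k ∧
    (∀ j < k, X (j + 1) * ascProd σ k = ascProd σ k * X j) ∧
    ∀ j ≤ n, k < j → X j * ascProd σ k = ascProd σ k * X j := by
  induction k with
  | zero => simp
  | succ k ih =>
    obtain ⟨i1, i2, i3⟩ := ih (by omega)
    have hk' : k < n := by omega
    refine ⟨?_, fun j hj => ?_, fun j hj hkj => ?_⟩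
    · rw [ascProd_succ, ← mul_assoc, i1, mul_assoc, h1 k hk', mul_assoc]
    · rw [ascProd_succ, ← mul_assoc]
      rcases Nat.lt_or_ge j k with h | h
      · rw [i2 j h, mul_assoc, h3 k hk' j (by omega) (by omega) (by omega), mul_assoc]
      · obtain rfl : j = k := by omega
        rw [i3 (j + 1) (by omega) (by omega), mul_assoc, h2 j hk', mul_assoc]
    · rw [ascProd_succ, ← mul_assoc, i3 j hj (by omega), mul_assoc,
        h3 k hk' j hj (by omega) (by omega), mul_assoc]

end Exchange

open RST MvPolynomial MulOpposite

/-! ### The double affine Hecke algebra acting on vector valued polynomials -/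

section Operators

variable {K : Type*} [Field K] {n : ℕ} {μ : YoungDiagram}

theorem onX_tens (f : Module.End K (MvPolynomial (Fin (n + 1)) K))
    (p : MvPolynomial (Fin (n + 1)) K) (A : RST n μ) : onX f (tens p A) = tens (f p) A := by
  ext1 B
  by_cases h : B = A
  · subst h; simp [onX, tens]
  · simp [onX, tens, h]

theorem mulX_tens (j : Fin (n + 1)) (p : MvPolynomial (Fin (n + 1)) K) (A : RST n μ) :
    mulX j (tens p A) = tens (X j * p) A := onX_tens _ p A

theorem mulX_apply (j : Fin (n + 1)) (P : VPoly K n μ) (A : RST n μ) :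
    mulX j P A = X j * P A := rfl

theorem tens_add (p r : MvPolynomial (Fin (n + 1)) K) (A : RST n μ) :
    tens (p + r) A = tens p A + tens r A := Pi.single_add _ _ _

theorem tens_smul (c : K) (p : MvPolynomial (Fin (n + 1)) K) (A : RST n μ) :
    tens (c • p) A = c • tens p A := Pi.single_smul _ _ _

theorem commute_onX_tabT (s : K) (i : Fin n) (f : Module.End K (MvPolynomial (Fin (n + 1)) K)) :
    Commute (onX f : Module.End K (VPoly K n μ)) (tabT s i) := by
  refine end_ext fun A p => ?_
  simp only [Module.End.mul_apply, onX_tens, tabT_tens, map_sum, map_smul]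

theorem mulX_comm (i j : Fin (n + 1)) :
    Commute (mulX i : Module.End K (VPoly K n μ)) (mulX j) := by
  refine end_ext fun A p => ?_
  simp only [Module.End.mul_apply, mulX_tens]
  congr 1; ring

theorem mulX_injective (j : Fin (n + 1)) :
    Function.Injective (mulX j : VPoly K n μ → VPoly K n μ) := by
  intro P Q h
  ext1 A
  have := congrFun h A
  rw [mulX_apply, mulX_apply] at this
  exact mul_left_cancel₀ (X_ne_zero j) this

/-- Induction on the degree: a space of vector valued polynomials that contains the tableaux and is
closed under multiplication by the variables is everything. -/
theorem mem_of_mulX (S : Submodule K (VPoly K n μ)) (h1 : ∀ A, tens 1 A ∈ S)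
    (hX : ∀ j, ∀ P ∈ S, mulX j P ∈ S) (P : VPoly K n μ) : P ∈ S := by
  have h2 : ∀ A p, tens p A ∈ S := by
    intro A p
    induction p using MvPolynomial.induction_on with
    | C a =>
      have : tens (C a) A = a • tens 1 A := by rw [← tens_smul, smul_eq_C_mul, mul_one]
      rw [this]
      exact S.smul_mem _ (h1 A)
    | add p r hp hr => rw [tens_add]; exact S.add_mem hp hr
    | mul_X p j hp => rw [mul_comm, ← mulX_tens]; exact hX j _ hp
  have : P = ∑ A, tens (P A) A := (Finset.univ_sum_single P).symm
  rw [this]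
  exact S.sum_mem fun A _ => h2 A _

/-- The constants `1 ⊗ V_μ`. -/
noncomputable def constants (K : Type*) [Field K] (n : ℕ) (μ : YoungDiagram) :
    Submodule K (VPoly K n μ) :=
  Submodule.span K (Set.range fun A : RST n μ => tens 1 A)

theorem tens_one_mem (A : RST n μ) : tens 1 A ∈ constants K n μ :=
  Submodule.subset_span ⟨A, rfl⟩

theorem constants_induction {S : Submodule K (VPoly K n μ)} (h : ∀ A, tens 1 A ∈ S)
    {P : VPoly K n μ} (hP : P ∈ constants K n μ) : P ∈ S :=
  Submodule.span_le.mpr (by rintro _ ⟨A, rfl⟩; exact h A) hP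

theorem tabT_mem (s : K) (i : Fin n) {P : VPoly K n μ} (hP : P ∈ constants K n μ) :
    tabT s i P ∈ constants K n μ := by
  refine constants_induction (S := (constants K n μ).comap (tabT s i)) (fun A => ?_) hP
  rw [Submodule.mem_comap, tabT_tens]
  exact Submodule.sum_mem _ fun B _ => Submodule.smul_mem _ _ (tens_one_mem B)

theorem onX_const {f : Module.End K (MvPolynomial (Fin (n + 1)) K)} {c : K} (hf : f 1 = C c)
    {P : VPoly K n μ} (hP : P ∈ constants K n μ) : onX f P = c • P := by
  have h : P ∈ LinearMap.ker (onX f - c • LinearMap.id) := by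
    refine constants_induction (fun A => ?_) hP
    rw [LinearMap.mem_ker, LinearMap.sub_apply, onX_tens, hf, LinearMap.smul_apply,
      LinearMap.id_apply, ← tens_smul, smul_eq_C_mul, mul_one, sub_self]
  simpa [sub_eq_zero] using h

/-! #### Divided differences -/

theorem swapX_mul (i : Fin n) (p r : MvPolynomial (Fin (n + 1)) K) :
    swapX i (p * r) = swapX i p * swapX i r := map_mul (rename _) p r

theorem swapX_X (i : Fin n) (j : Fin (n + 1)) :
    swapX i (X j : MvPolynomial (Fin (n + 1)) K) = X (Equiv.swap i.castSucc i.succ j) :=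
  rename_X _ _

theorem swapX_one (i : Fin n) : swapX i (1 : MvPolynomial (Fin (n + 1)) K) = 1 :=
  map_one (rename _)

theorem divDiff_X_mul (i : Fin n) (p : MvPolynomial (Fin (n + 1)) K) :
    divDiff i (X i.castSucc * p) = p + X i.succ * divDiff i p := by
  apply mul_left_cancel₀ (X_sub_X_ne_zero (K := K) i)
  rw [divDiff_spec, swapX_mul, swapX_X, Equiv.swap_apply_left]
  linear_combination -X i.succ * divDiff_spec i p

theorem divDiff_X_succ_mul (i : Fin n) (p : MvPolynomial (Fin (n + 1)) K) :
    divDiff i (X i.succ * p) = X i.castSucc * divDiff i p - p := by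
  apply mul_left_cancel₀ (X_sub_X_ne_zero (K := K) i)
  rw [divDiff_spec, swapX_mul, swapX_X, Equiv.swap_apply_right]
  linear_combination -X i.castSucc * divDiff_spec i p

theorem divDiff_X_mul_far (i : Fin n) {j : Fin (n + 1)} (h1 : j ≠ i.castSucc) (h2 : j ≠ i.succ)
    (p : MvPolynomial (Fin (n + 1)) K) : divDiff i (X j * p) = X j * divDiff i p := by
  apply mul_left_cancel₀ (X_sub_X_ne_zero (K := K) i)
  rw [divDiff_spec, swapX_mul, swapX_X, Equiv.swap_apply_of_ne_of_ne h1 h2]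
  linear_combination -X j * divDiff_spec i p

theorem divDiff_one (i : Fin n) : divDiff i (1 : MvPolynomial (Fin (n + 1)) K) = 0 := by
  apply mul_left_cancel₀ (X_sub_X_ne_zero (K := K) i)
  rw [divDiff_spec, swapX_one, sub_self, mul_zero]

theorem deltaX_apply (s : K) (i : Fin n) (p : MvPolynomial (Fin (n + 1)) K) :
    deltaX s i p = (1 - s) • (X i.succ * divDiff i p) := rfl

/-! #### Exchange relations -/

theorem boldT_tens (s : K) (i : Fin n) (p : MvPolynomial (Fin (n + 1)) K) (A : RST n μ) :
    boldT s i (tens p A) = tens (deltaX s i p) A + tabT s i (tens (swapX i p) A) := by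
  simp [boldT, onX_tens]

theorem tabT_tens_X (s : K) (i : Fin n) (j : Fin (n + 1)) (p : MvPolynomial (Fin (n + 1)) K)
    (A : RST n μ) : tabT s i (tens (X j * p) A) = mulX j (tabT s i (tens p A)) := by
  rw [← mulX_tens]
  exact (LinearMap.congr_fun (commute_onX_tabT s i (LinearMap.mulLeft K (X j))).eq (tens p A)).symm

theorem boldT_mulX (s : K) (i : Fin n) (P : VPoly K n μ) :
    boldT s i (mulX i.castSucc P) = mulX i.succ (boldT s i P) + (1 - s) • mulX i.succ P := by
  suffices h : boldT s i * mulX i.castSucc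
      = (mulX i.succ * boldT s i + (1 - s) • mulX i.succ : Module.End K (VPoly K n μ)) from
    LinearMap.congr_fun h P
  refine end_ext fun A p => ?_
  simp only [Module.End.mul_apply, LinearMap.add_apply, LinearMap.smul_apply, mulX_tens,
    boldT_tens, swapX_mul, swapX_X, Equiv.swap_apply_left, tabT_tens_X, map_add, deltaX_apply,
    divDiff_X_mul, mul_add, smul_add, tens_add, tens_smul, map_smul]
  abel

theorem boldT_mulX_succ (s : K) (i : Fin n) (P : VPoly K n μ) :
    boldT s i (mulX i.succ P) = mulX i.castSucc (boldT s i P) - (1 - s) • mulX i.succ P := by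
  suffices h : boldT s i * mulX i.succ
      = (mulX i.castSucc * boldT s i - (1 - s) • mulX i.succ : Module.End K (VPoly K n μ)) from
    LinearMap.congr_fun h P
  refine end_ext fun A p => ?_
  simp only [Module.End.mul_apply, LinearMap.sub_apply, LinearMap.smul_apply, mulX_tens,
    boldT_tens, swapX_mul, swapX_X, Equiv.swap_apply_right, tabT_tens_X, map_add, deltaX_apply,
    divDiff_X_succ_mul, tens_smul, map_smul]
  rw [mul_sub, mul_left_comm, sub_eq_add_neg (X _ * _), tens_add,
    show -(X i.succ * p) = (-1 : K) • (X i.succ * p) by simp, tens_smul]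
  module

theorem boldT_mulX_far (s : K) (i : Fin n) {j : Fin (n + 1)} (h1 : j ≠ i.castSucc)
    (h2 : j ≠ i.succ) (P : VPoly K n μ) : boldT s i (mulX j P) = mulX j (boldT s i P) := by
  suffices h : boldT s i * mulX j = (mulX j * boldT s i : Module.End K (VPoly K n μ)) from
    LinearMap.congr_fun h P
  refine end_ext fun A p => ?_
  simp only [Module.End.mul_apply, mulX_tens, boldT_tens, swapX_mul, swapX_X,
    Equiv.swap_apply_of_ne_of_ne h1 h2, tabT_tens_X, map_add, deltaX_apply,
    divDiff_X_mul_far i h1 h2, mul_smul_comm]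
  rw [mul_left_comm]

theorem boldT_const (s : K) (i : Fin n) {P : VPoly K n μ} (hP : P ∈ constants K n μ) :
    boldT s i P = tabT s i P := by
  have h1 : onX (deltaX s i) P = (0 : K) • P :=
    onX_const (by rw [deltaX_apply, divDiff_one, mul_zero, smul_zero, map_zero]) hP
  have h2 : onX (swapX i) P = (1 : K) • P := onX_const (by rw [swapX_one, map_one]) hP
  rw [boldT, LinearMap.add_apply, LinearMap.comp_apply, h1, h2, zero_smul, one_smul, zero_add]

/-! #### Operators acting on the right -/

/-- The ring of operators that act on the right: the product `a * b` is "first `a`, then `b`". -/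
abbrev ROp (K : Type*) [Field K] (n : ℕ) (μ : YoungDiagram) := (Module.End K (VPoly K n μ))ᵐᵒᵖ

theorem opSeq_eq (l : List (Module.End K (VPoly K n μ))) : op (opSeq l) = (l.map op).prod := by
  have : ∀ (l : List (Module.End K (VPoly K n μ))) (f : Module.End K (VPoly K n μ)),
      op (l.foldl (fun acc f => f ∘ₗ acc) f) = op f * (l.map op).prod := by
    intro l
    induction l with
    | nil => intro f; simp
    | cons a l ih =>
      intro f
      rw [List.foldl_cons, ih, List.map_cons, List.prod_cons, ← mul_assoc]
      rfl
  rw [opSeq, this]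
  exact one_mul _

/-- A family indexed by the adjacent pairs as a family indexed by all natural numbers. -/
def extFam {α : Type*} [Zero α] (f : Fin n → α) (k : ℕ) : α := if h : k < n then f ⟨k, h⟩ else 0

theorem extFam_of_lt {α : Type*} [Zero α] (f : Fin n → α) {k : ℕ} (h : k < n) :
    extFam f k = f ⟨k, h⟩ := dif_pos h

theorem extFam_val {α : Type*} [Zero α] (f : Fin n → α) (i : Fin n) : extFam f i = f i :=
  dif_pos i.2

theorem map_finRange_prod {f : Fin n → ROp K n μ} {g : ℕ → ROp K n μ} (h : ∀ i : Fin n, g i = f i) :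
    ((List.finRange n).map f).prod = ascProd g n := by
  rw [ascProd, ← List.map_coe_finRange_eq_range, List.map_map]
  congr 2
  funext i
  exact (h i).symm

theorem map_finRange_reverse_prod {f : Fin n → ROp K n μ} {g : ℕ → ROp K n μ}
    (h : ∀ i : Fin n, g i = f i) :
    ((List.finRange n).reverse.map f).prod = descProd g n := by
  rw [descProd, ← List.map_coe_finRange_eq_range, ← List.map_reverse, List.map_map]
  congr 2
  funext i
  exact (h i).symm

/-- `𝐓_i` as an operator acting on the right. -/
noncomputable def rT (μ : YoungDiagram) (n : ℕ) (s : K) : ℕ → ROp K n μ :=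
  extFam fun i => op (boldT s i)

/-- `𝐓_i⁻¹` as an operator acting on the right. -/
noncomputable def rT' (μ : YoungDiagram) (n : ℕ) (s : K) (k : ℕ) : ROp K n μ :=
  s⁻¹ • (rT μ n s k + (1 - s) • (1 : ROp K n μ))

/-- The variables as operators acting on the right. -/
noncomputable def rX (K : Type*) [Field K] (μ : YoungDiagram) (n : ℕ) (k : ℕ) : ROp K n μ :=
  op (mulX (Fin.ofNat (n + 1) k))

/-- `𝐰` as an operator acting on the right. -/
noncomputable def rW (μ : YoungDiagram) (n : ℕ) (q s : K) : ROp K n μ := op (boldW q s)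

theorem rX_castSucc (i : Fin n) : rX K μ n i = op (mulX i.castSucc) := by
  have : Fin.ofNat (n + 1) i = i.castSucc := by
    apply Fin.ext; simp [Fin.ofNat, Nat.mod_eq_of_lt (by omega : (i : ℕ) < n + 1)]
  rw [rX, this]

theorem rX_val (i : Fin (n + 1)) : rX K μ n i = op (mulX i) := by
  have : Fin.ofNat (n + 1) i = i := by
    apply Fin.ext; simp [Fin.ofNat, Nat.mod_eq_of_lt i.2]
  rw [rX, this]

theorem rX_succ (i : Fin n) : rX K μ n (i + 1) = op (mulX i.succ) := by
  rw [← Fin.val_succ, rX_val]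

theorem rX_last : rX K μ n n = op (mulX (Fin.last n)) := rX_val (Fin.last n)

theorem rX_zero : rX K μ n 0 = op (mulX 0) := rX_val 0

theorem rT_val (s : K) (i : Fin n) : rT μ n s i = op (boldT s i) := extFam_val _ i

theorem rT'_val (s : K) (i : Fin n) : rT' μ n s i = op (boldTinv s i) := by
  rw [rT', rT_val]; rfl

theorem isExchange (s : K) : IsExchange s n (rT μ n s) (rX K μ n) where
  X_T i hi := by
    lift i to Fin n using hi
    rw [rT_val, rX_castSucc, rX_succ]
    exact congrArg op (LinearMap.ext fun P => boldT_mulX s i P)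
  X_succ_T i hi := by
    lift i to Fin n using hi
    rw [rT_val, rX_castSucc, rX_succ]
    exact congrArg op (LinearMap.ext fun P => boldT_mulX_succ s i P)
  X_T_far i hi j hj h1 h2 := by
    lift i to Fin n using hi
    obtain ⟨j, rfl⟩ : ∃ l : Fin (n + 1), (l : ℕ) = j := ⟨⟨j, by omega⟩, rfl⟩
    rw [rT_val, rX_val]
    exact congrArg op (LinearMap.ext fun P => boldT_mulX_far s i
      (fun e => h1 (by simp [e])) (fun e => h2 (by simp [e])) P)

/-- An operator that vanishes on the tableaux and can be moved through the variables is zero. -/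
theorem op_eq_zero {E : ROp K n μ} (h1 : ∀ P ∈ constants K n μ, E.unop P = 0)
    (hX : ∀ j ≤ n, ∃ F, rX K μ n j * E = E * F) : E = 0 := by
  have : E.unop = 0 := by
    refine LinearMap.ext fun P => ?_
    refine mem_of_mulX (LinearMap.ker E.unop) (fun A => h1 _ (tens_one_mem A)) (fun j P hP => ?_) P
    obtain ⟨F, hF⟩ := hX j (by omega)
    rw [rX_val] at hF
    have e := LinearMap.congr_fun (congrArg unop hF) P
    simp only [unop_mul, unop_op, Module.End.mul_apply] at e
    rw [LinearMap.mem_ker, e, LinearMap.mem_ker.mp hP, map_zero]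
  exact unop_injective this

variable {q s : K}

/-- `T_i` on tableaux, as an operator acting on the right. -/
noncomputable def rTab (μ : YoungDiagram) (n : ℕ) (s : K) : ℕ → ROp K n μ :=
  extFam fun i => op (tabT s i)

theorem rTab_mem (i : ℕ) {P : VPoly K n μ} (hP : P ∈ constants K n μ) :
    (rTab μ n s i).unop P ∈ constants K n μ := by
  by_cases hi : i < n
  · rw [rTab, extFam_of_lt _ hi]; exact tabT_mem s _ hP
  · rw [rTab, extFam, dif_neg hi]; exact Submodule.zero_mem _

theorem rT_const (i : ℕ) {P : VPoly K n μ} (hP : P ∈ constants K n μ) :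
    (rT μ n s i).unop P = (rTab μ n s i).unop P := by
  by_cases hi : i < n
  · rw [rT, rTab, extFam_of_lt _ hi, extFam_of_lt _ hi]; exact boldT_const s _ hP
  · rw [rT, rTab, extFam, extFam, dif_neg hi, dif_neg hi]

theorem rTab_quad (h0 : s ≠ 0) (hs : ∀ m : ℤ, m ≠ 0 → s ^ m ≠ 1) {i : ℕ} (hi : i < n) :
    rTab μ n s i * rTab μ n s i = (s - 1) • rTab μ n s i + s • 1 := by
  rw [rTab, extFam_of_lt _ hi]
  exact congrArg op (tabT_quad h0 hs _)

theorem rTab_isBraid (h0 : s ≠ 0) (hs : ∀ m : ℤ, m ≠ 0 → s ^ m ≠ 1) :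
    IsBraid n (rTab μ n s) where
  braid i hi := by
    rw [rTab, extFam_of_lt _ hi, extFam_of_lt _ (show i < n by omega)]
    have := congrArg op (tabT_braid (n := n) (μ := μ) h0 hs (i := ⟨i, by omega⟩)
      (j := ⟨i + 1, hi⟩) rfl)
    simpa only [op_mul, mul_assoc] using this
  far i j hij hj := by
    rw [rTab, extFam_of_lt _ hj, extFam_of_lt _ (show i < n by omega)]
    have h1 : s ≠ 1 := by simpa using hs 1 one_ne_zero
    exact (tabT_far h0 h1 (i := ⟨i, by omega⟩) (j := ⟨j, hj⟩) hij).op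

/-- The defect of the quadratic relation vanishes on constants, where `𝐓_i` is `T_i`, and moves
through the variables. -/
theorem rT_quad (h0 : s ≠ 0) (hs : ∀ m : ℤ, m ≠ 0 → s ^ m ≠ 1) {i : ℕ} (hi : i < n) :
    rT μ n s i * rT μ n s i = (s - 1) • rT μ n s i + s • 1 := by
  refine sub_eq_zero.mp (op_eq_zero (fun P hP => ?_) fun j hj => (isExchange s).quad hi hj)
  have e := LinearMap.congr_fun (congrArg unop (rTab_quad (μ := μ) h0 hs hi)) P
  simp only [unop_sub, unop_mul, unop_add, unop_smul, unop_one, Module.End.mul_apply,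
    LinearMap.sub_apply, LinearMap.add_apply, LinearMap.smul_apply] at e ⊢
  rw [rT_const i hP, rT_const i (rTab_mem i hP), e, sub_self]

theorem rT_isBraid (h0 : s ≠ 0) (hs : ∀ m : ℤ, m ≠ 0 → s ^ m ≠ 1) : IsBraid n (rT μ n s) where
  braid i hi := by
    refine sub_eq_zero.mp (op_eq_zero (fun P hP => ?_) fun j hj =>
      (isExchange s).braid (fun i hi => rT_quad h0 hs hi) hi hj)
    have e := LinearMap.congr_fun (congrArg unop ((rTab_isBraid (μ := μ) h0 hs).braid i hi)) P
    simp only [unop_sub, unop_mul, Module.End.mul_apply, LinearMap.sub_apply] at e ⊢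
    rw [rT_const i hP, rT_const _ (rTab_mem i hP), rT_const _ (rTab_mem _ (rTab_mem i hP)),
      rT_const _ hP, rT_const _ (rTab_mem _ hP), rT_const _ (rTab_mem _ (rTab_mem _ hP)), e,
      sub_self]
  far i j hij hj := by
    refine sub_eq_zero.mp (op_eq_zero (fun P hP => ?_) fun l hl =>
      (isExchange s).far hij hj hl)
    have e := LinearMap.congr_fun
      (congrArg unop ((rTab_isBraid (μ := μ) h0 hs).far i j hij hj).eq) P
    simp only [unop_sub, unop_mul, Module.End.mul_apply, LinearMap.sub_apply] at e ⊢
    rw [rT_const i hP, rT_const _ (rTab_mem i hP), rT_const j hP, rT_const _ (rTab_mem j hP), e,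
      sub_self]

/-! #### The affine element -/

/-- The adjacent transpositions of the variables, as operators acting on the right. -/
noncomputable def rSwap (K : Type*) [Field K] (μ : YoungDiagram) (n : ℕ) : ℕ → ROp K n μ :=
  extFam fun i => op (onX (swapX i))

theorem rW_eq (q s : K) : rW μ n q s
    = op (onX (tauX q)) * ascProd (rSwap K μ n) n * ascProd (rTab μ n s) n := by
  rw [rW, boldW, opSeq_eq, List.map_append, List.map_append, List.prod_append, List.prod_append,
    List.map_map, List.map_map]
  simp only [List.map_cons, List.map_nil, List.prod_cons, List.prod_nil, mul_one]
  rw [rSwap, rTab, ← map_finRange_prod (extFam_val _), ← map_finRange_prod (extFam_val _)]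
  rfl

theorem tauX_mul (p r : MvPolynomial (Fin (n + 1)) K) : tauX q (p * r) = tauX q p * tauX q r :=
  map_mul (aeval _) p r

theorem tauX_one : tauX q (1 : MvPolynomial (Fin (n + 1)) K) = 1 := map_one (aeval _)

theorem tauX_X (j : Fin (n + 1)) : tauX q (X j : MvPolynomial (Fin (n + 1)) K)
    = if j = 0 then C q * X j else X j := aeval_X _ _

theorem rX_tau_zero : rX K μ n 0 * op (onX (tauX q)) = q • (op (onX (tauX q)) * rX K μ n 0) := by
  rw [rX_zero]
  refine congrArg op (end_ext fun A p => ?_)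
  show onX (tauX q) (mulX 0 (tens p A)) = q • mulX 0 (onX (tauX q) (tens p A))
  rw [mulX_tens, onX_tens, onX_tens, mulX_tens, tauX_mul, tauX_X, if_pos rfl, ← tens_smul,
    smul_eq_C_mul, mul_assoc]

theorem rX_tau_succ (i : Fin n) :
    rX K μ n (i + 1) * op (onX (tauX q)) = op (onX (tauX q)) * rX K μ n (i + 1) := by
  rw [rX_succ]
  refine congrArg op (end_ext fun A p => ?_)
  simp only [unop_op, Module.End.mul_apply, mulX_tens, onX_tens, tauX_mul, tauX_X, Fin.succ_ne_zero,
    if_false]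

theorem rX_ascProd_rSwap :
    rX K μ n 0 * ascProd (rSwap K μ n) n = ascProd (rSwap K μ n) n * rX K μ n n ∧
    ∀ j < n, rX K μ n (j + 1) * ascProd (rSwap K μ n) n = ascProd (rSwap K μ n) n * rX K μ n j := by
  have key : ∀ (i : Fin n) (j l : Fin (n + 1)), Equiv.swap i.castSucc i.succ j = l →
      rX K μ n j * rSwap K μ n i = rSwap K μ n i * rX K μ n l := by
    intro i j l h
    rw [rX_val, rX_val, rSwap, extFam_val]
    refine congrArg op (end_ext fun A p => ?_)
    simp only [unop_op, Module.End.mul_apply, mulX_tens, onX_tens, swapX_mul, swapX_X, h]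
  have := X_mul_ascProd (X := rX K μ n) (σ := rSwap K μ n) (n := n)
    (fun i hi => key ⟨i, hi⟩ (Fin.castSucc ⟨i, hi⟩) (Fin.succ ⟨i, hi⟩) (Equiv.swap_apply_left _ _))
    (fun i hi => key ⟨i, hi⟩ (Fin.succ ⟨i, hi⟩) (Fin.castSucc ⟨i, hi⟩) (Equiv.swap_apply_right _ _))
    (fun i hi j hj h1 h2 => key ⟨i, hi⟩ ⟨j, by omega⟩ ⟨j, by omega⟩
      (Equiv.swap_apply_of_ne_of_ne (by simp [Fin.ext_iff, h1]) (by simp [Fin.ext_iff, h2]))) le_rfl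
  exact ⟨this.1, this.2.1⟩

theorem commute_rX_rTab (j : ℕ) : Commute (rX K μ n j) (ascProd (rTab μ n s) n) := by
  refine commute_ascProd fun i hi => ?_
  rw [rTab, extFam_of_lt _ hi]
  exact (commute_onX_tabT s _ _).op

theorem rX_rW_zero : rX K μ n 0 * rW μ n q s = q • (rW μ n q s * rX K μ n n) := by
  rw [rW_eq, ← mul_assoc, ← mul_assoc, rX_tau_zero, smul_mul_assoc, smul_mul_assoc,
    mul_assoc (op _),
    rX_ascProd_rSwap.1, mul_assoc, mul_assoc, (commute_rX_rTab n).eq]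
  simp only [mul_assoc]

theorem rX_rW_succ {i : ℕ} (hi : i < n) :
    rX K μ n (i + 1) * rW μ n q s = rW μ n q s * rX K μ n i := by
  rw [rW_eq, ← mul_assoc, ← mul_assoc, rX_tau_succ ⟨i, hi⟩, mul_assoc (op _),
    rX_ascProd_rSwap.2 i hi, mul_assoc, mul_assoc, (commute_rX_rTab i).eq]
  simp only [mul_assoc]

theorem ascProd_rTab_mem (k : ℕ) {P : VPoly K n μ} (hP : P ∈ constants K n μ) :
    (ascProd (rTab μ n s) k).unop P ∈ constants K n μ := by
  induction k with
  | zero => exact hP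
  | succ k ih => rw [ascProd_succ]; exact rTab_mem k ih

theorem rW_const {P : VPoly K n μ} (hP : P ∈ constants K n μ) :
    (rW μ n q s).unop P = (ascProd (rTab μ n s) n).unop P := by
  have h1 : onX (tauX q) P = P := by
    rw [onX_const (c := 1) (by rw [tauX_one, map_one]) hP, one_smul]
  have h2 : ∀ k, (ascProd (rSwap K μ n) k).unop P = P ∨ n < k := by
    intro k
    induction k with
    | zero => left; rfl
    | succ k ih =>
      by_cases hk : k < n
      · left
        rw [ascProd_succ, unop_mul, Module.End.mul_apply, ih.resolve_right (by omega), rSwap,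
          extFam_of_lt _ hk, unop_op, onX_const (c := 1) (by rw [swapX_one, map_one]) hP, one_smul]
      · right; omega
  rw [rW_eq, unop_mul, unop_mul, Module.End.mul_apply, Module.End.mul_apply, unop_op, h1,
    (h2 n).resolve_right (by omega)]

/-- The operators of the construction satisfy the double affine Hecke relations. -/
theorem isDoubleHecke (h0 : s ≠ 0) (hs : ∀ m : ℤ, m ≠ 0 → s ^ m ≠ 1) :
    IsDoubleHecke q s n (rT μ n s) (rT' μ n s) (rX K μ n) (rW μ n q s) where
  s_ne := h0
  inv _ := rfl
  quad _ hi := rT_quad h0 hs hi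
  isBraid := rT_isBraid h0 hs
  X_comm i j := (mulX_comm _ _).op
  X_T i hi := by
    rw [(isExchange s).X_T i hi, add_mul, smul_mul_assoc, one_mul]
  X_T_far i hi j hj h1 h2 := (isExchange s).X_T_far i hi j hj h1 h2
  X_w i hi := rX_rW_succ hi
  X_zero_w := rX_rW_zero
  T_w i hi := by
    refine sub_eq_zero.mp (op_eq_zero (fun P hP => ?_) fun j hj =>
      (isExchange s).shift_w (fun i hi => rX_rW_succ hi) rX_rW_zero hi hj)
    have e := LinearMap.congr_fun
      (congrArg unop ((rTab_isBraid (μ := μ) h0 hs).shift_asc le_rfl hi)) P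
    simp only [unop_sub, unop_mul, Module.End.mul_apply, LinearMap.sub_apply] at e ⊢
    rw [rT_const _ hP, rW_const hP, rW_const (rTab_mem _ hP), rT_const _ (ascProd_rTab_mem n hP), e,
      sub_self]
  T_w_w m hm := by
    subst hm
    refine sub_eq_zero.mp (op_eq_zero (fun P hP => ?_) fun j hj =>
      (isExchange s).shift_w_w (fun i hi => rX_rW_succ hi) rX_rW_zero hj)
    have e := LinearMap.congr_fun
      (congrArg unop ((rTab_isBraid (μ := μ) h0 hs).shift_sq)) P
    simp only [unop_sub, unop_mul, Module.End.mul_apply, LinearMap.sub_apply] at e ⊢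
    have h1 := rTab_mem (s := s) 0 hP
    have h2 := ascProd_rTab_mem (s := s) (m + 1) h1
    have h3 := ascProd_rTab_mem (s := s) (m + 1) hP
    rw [rT_const _ hP, rW_const h1, rW_const h2, rW_const hP, rW_const h3,
      rT_const _ (ascProd_rTab_mem _ h3), e, sub_self]
  cancel i hi a b h := by
    refine unop_injective (LinearMap.ext fun P => mulX_injective (Fin.ofNat (n + 1) i) ?_)
    exact LinearMap.congr_fun (congrArg unop h) P

end Operators

/-! ### Dunkl operators and Cherednik operators -/

section Dunkl

variable {K : Type*} [Field K] {n : ℕ} {μ : YoungDiagram} {q s : K}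

/-- No monomial in `q` and `s` other than the trivial one equals `1`. -/
structure Generic (q s : K) : Prop where
  q_ne : q ≠ 0
  s_ne : s ≠ 0
  eq_zero : ∀ a b : ℤ, q ^ a * s ^ b = 1 → a = 0 ∧ b = 0

namespace Generic

theorem inv (h : Generic q s) : Generic q⁻¹ s⁻¹ where
  q_ne := inv_ne_zero h.q_ne
  s_ne := inv_ne_zero h.s_ne
  eq_zero a b e := by
    have := h.eq_zero (-a) (-b) (by simpa [zpow_neg] using e)
    omega

theorem s_zpow_ne (h : Generic q s) (m : ℤ) (hm : m ≠ 0) : s ^ m ≠ 1 := fun e =>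
  hm (h.eq_zero 0 m (by simpa using e)).2

theorem isDoubleHecke (h : Generic q s) :
    IsDoubleHecke q s n (rT μ n s) (rT' μ n s) (rX K μ n) (rW μ n q s) :=
  VVMac.isDoubleHecke h.s_ne h.s_zpow_ne

end Generic

theorem cherednikLast_eq (q s : K) :
    op (cherednikLast q s : Module.End K (VPoly K n μ))
      = IsDoubleHecke.xiLast n (rT' μ n s) (rW μ n q s) := by
  rw [cherednikLast, opSeq_eq, List.map_append, List.prod_append, List.map_map,
    IsDoubleHecke.xiLast, ← map_finRange_reverse_prod (f := op ∘ fun i => boldTinv s i) (rT'_val s)]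
  simp [rW]

theorem ascProd_rT_const (k : ℕ) {P : VPoly K n μ} (hP : P ∈ constants K n μ) :
    (ascProd (rT μ n s) k).unop P = (ascProd (rTab μ n s) k).unop P := by
  induction k with
  | zero => rfl
  | succ k ih =>
    rw [ascProd_succ, ascProd_succ, unop_mul, unop_mul, Module.End.mul_apply,
      Module.End.mul_apply, ih, rT_const _ (ascProd_rTab_mem k hP)]

theorem rT'_mem (i : ℕ) {P : VPoly K n μ} (hP : P ∈ constants K n μ) :
    (rT' μ n s i).unop P ∈ constants K n μ := by
  rw [rT', unop_smul, unop_add, unop_smul, LinearMap.smul_apply, LinearMap.add_apply, rT_const _ hP]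
  exact Submodule.smul_mem _ _ (Submodule.add_mem _ (rTab_mem i hP) (Submodule.smul_mem _ _ hP))

theorem descProd_rT'_mem (k : ℕ) {P : VPoly K n μ} (hP : P ∈ constants K n μ) :
    (descProd (rT' μ n s) k).unop P ∈ constants K n μ := by
  induction k generalizing P with
  | zero => exact hP
  | succ k ih => rw [descProd_succ]; exact ih (rT'_mem k hP)

/-- The last Cherednik operator fixes the constants, because `𝐰` acts on them as `T_1 ⋯ T_{N-1}`. -/
theorem cherednikLast_const (h : Generic q s) {P : VPoly K n μ} (hP : P ∈ constants K n μ) :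
    cherednikLast q s P = P := by
  rw [← unop_op (cherednikLast q s), cherednikLast_eq, IsDoubleHecke.xiLast, unop_mul,
    Module.End.mul_apply, rW_const (descProd_rT'_mem n hP), ← ascProd_rT_const _
    (descProd_rT'_mem n hP), ← Module.End.mul_apply, ← unop_mul,
    h.isDoubleHecke.inv_desc_cancel le_rfl]
  rfl

/-- `P (1 - 𝛏_N)` is divisible by the last variable. -/
theorem sub_cherednikLast_mem (h : Generic q s) (P : VPoly K n μ) :
    ∃ Q, P - cherednikLast q s P = mulX (Fin.last n) Q := by
  suffices H : P ∈ (LinearMap.range (mulX (Fin.last n) : Module.End K (VPoly K n μ))).comap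
      (LinearMap.id - cherednikLast q s) by
    obtain ⟨Q, hQ⟩ := H
    exact ⟨Q, hQ.symm⟩
  refine mem_of_mulX _ (fun A => ?_) (fun j P hP => ?_) P
  · rw [Submodule.mem_comap, LinearMap.sub_apply, cherednikLast_const h (tens_one_mem A),
      LinearMap.id_apply, sub_self]
    exact Submodule.zero_mem _
  · obtain ⟨Q, hQ⟩ := hP
    rw [LinearMap.sub_apply, LinearMap.id_apply] at hQ
    rw [Submodule.mem_comap, LinearMap.sub_apply, LinearMap.id_apply]
    obtain ⟨⟨a, ha⟩, hb⟩ := h.isDoubleHecke (n := n) (μ := μ) |>.X_xiLast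
    rw [← cherednikLast_eq] at ha
    rcases Nat.lt_or_ge j n with hj | hj
    · obtain ⟨b, hb⟩ := hb j hj
      rw [← cherednikLast_eq, rX_val, rX_last] at hb
      have e : cherednikLast q s (mulX j P)
          = mulX j (cherednikLast q s P) + mulX (Fin.last n) (b.unop P) :=
        LinearMap.congr_fun (congrArg unop hb) P
      refine ⟨mulX j Q - b.unop P, ?_⟩
      rw [e, map_sub, ← Module.End.mul_apply, (mulX_comm _ _).eq, Module.End.mul_apply, hQ, map_sub]
      abel
    · obtain rfl : j = Fin.last n := Fin.ext (by simp; omega)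
      rw [rX_last] at ha
      have e : cherednikLast q s (mulX (Fin.last n) P) = mulX (Fin.last n) (a.unop P) :=
        LinearMap.congr_fun (congrArg unop ha) P
      exact ⟨P - a.unop P, by rw [e, map_sub]⟩

theorem mulX_divLastX (P : VPoly K n μ) :
    onX divLastX (mulX (Fin.last n) P) = P := by
  ext1 A
  show (X (Fin.last n) * P A).divMonomial (Finsupp.single (Fin.last n) 1) = P A
  exact X_mul_divMonomial _ _

/-- The Dunkl operators as operators acting on the right. -/
noncomputable def rD (μ : YoungDiagram) (n : ℕ) (q s : K) (k : ℕ) : ROp K n μ :=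
  op (dunkl q s (Fin.ofNat (n + 1) k))

theorem rD_val (q s : K) (i : Fin (n + 1)) : rD μ n q s i = op (dunkl q s i) := by
  have : Fin.ofNat (n + 1) i = i := by
    apply Fin.ext; simp [Fin.ofNat, Nat.mod_eq_of_lt i.2]
  rw [rD, this]

theorem dunkl_castSucc (q s : K) (i : Fin n) :
    (dunkl q s i.castSucc : Module.End K (VPoly K n μ))
      = s⁻¹ • opSeq [boldT s i, dunkl q s i.succ, boldT s i] :=
  Fin.reverseInduction_castSucc (motive := fun _ => Module.End K (VPoly K n μ)) _

theorem dunkl_last (q s : K) :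
    (dunkl q s (Fin.last n) : Module.End K (VPoly K n μ))
      = onX divLastX ∘ₗ (LinearMap.id - cherednikLast q s) :=
  Fin.reverseInduction_last (motive := fun _ => Module.End K (VPoly K n μ))

theorem isDunklFamily (h : Generic q s) :
    IsDunklFamily s n (rT μ n s) (rT' μ n s) (rX K μ n) (rW μ n q s) (rD μ n q s) where
  step i hi := by
    lift i to Fin n using hi
    have e1 : rD μ n q s i = op (dunkl q s i.castSucc) := rD_val q s i.castSucc
    have e2 : rD μ n q s (i + 1) = op (dunkl q s i.succ) := rD_val q s i.succ
    rw [e1, e2, rT_val, dunkl_castSucc, op_smul, opSeq_eq]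
    simp [mul_assoc]
  last_X := by
    have e1 : rD μ n q s n = op (dunkl q s (Fin.last n)) := rD_val q s (Fin.last n)
    rw [← cherednikLast_eq, e1, rX_last, dunkl_last, ← op_one, ← op_sub, ← op_mul]
    refine congrArg op (LinearMap.ext fun P => ?_)
    obtain ⟨Q, hQ⟩ := sub_cherednikLast_mem h P
    rw [Module.End.mul_apply, LinearMap.comp_apply, LinearMap.sub_apply, LinearMap.sub_apply,
      LinearMap.id_apply, Module.End.one_apply, hQ, mulX_divLastX]

/-- The Cherednik operators `𝛏_i = s⁻¹ 𝐓_i 𝛏_{i+1} 𝐓_i`, as operators acting on the right, indexed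
by the distance from the last one. -/
noncomputable def rXiAux (μ : YoungDiagram) (n : ℕ) (q s : K) : ℕ → ROp K n μ
  | 0 => IsDoubleHecke.xiLast n (rT' μ n s) (rW μ n q s)
  | d + 1 => s⁻¹ • (rT μ n s (n - (d + 1)) * rXiAux μ n q s d * rT μ n s (n - (d + 1)))

/-- The Cherednik operators as operators acting on the right. -/
noncomputable def rXi (μ : YoungDiagram) (n : ℕ) (q s : K) (k : ℕ) : ROp K n μ :=
  rXiAux μ n q s (n - k)

theorem isCherednikFamily (q s : K) :
    IsCherednikFamily s n (rT μ n s) (rT' μ n s) (rW μ n q s) (rXi μ n q s) where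
  step i hi := by
    rw [rXi, rXi, show n - i = n - (i + 1) + 1 by omega, rXiAux,
      show n - (n - (i + 1) + 1) = i by omega]
  last := by rw [rXi, Nat.sub_self, rXiAux]

/-! ### The bilinear form -/

/-- In a product of powers of commuting elements, raising one exponent by one gives one more factor,
which may be written first. -/
theorem prod_pow_add_single {M ι : Type*} [Monoid M] [DecidableEq ι] {f : ι → M}
    (hf : ∀ i j, Commute (f i) (f j)) (v : ι → ℕ) (i : ι) {l : List ι} (hl : l.Nodup) :
    (l.map fun j => f j ^ (v j + if j = i then 1 else 0)).prod
      = (if i ∈ l then f i else 1) * (l.map fun j => f j ^ v j).prod := by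
  induction l with
  | nil => simp
  | cons a l ih =>
    rw [List.nodup_cons] at hl
    rw [List.map_cons, List.prod_cons, ih hl.2, List.map_cons, List.prod_cons]
    by_cases ha : a = i
    · subst ha
      rw [if_neg hl.1, if_pos rfl, if_pos List.mem_cons_self, pow_succ', one_mul, mul_assoc]
    · have hm : (i ∈ a :: l) ↔ i ∈ l := by
        rw [List.mem_cons]; exact or_iff_right fun e => ha e.symm
      simp only [ha, if_false, add_zero, hm]
      rw [← mul_assoc, ← mul_assoc]
      congr 1
      split_ifs
      · exact ((hf a i).pow_left _).eq
      · simp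

theorem dunkl_commute (h : Generic q s) (i j : Fin (n + 1)) :
    Commute (dunkl q s i : Module.End K (VPoly K n μ)) (dunkl q s j) := by
  have := h.isDoubleHecke.dunkl_comm (isDunklFamily (n := n) (μ := μ) h) (i := i) (j := j)
    (by omega) (by omega)
  rw [rD_val, rD_val] at this
  exact this.unop

theorem dunklPow_add_single (h : Generic q s) (v : Fin (n + 1) →₀ ℕ) (i : Fin (n + 1)) :
    (dunklPow q s (v + Finsupp.single i 1) : Module.End K (VPoly K n μ))
      = dunklPow q s v * dunkl q s i := by
  apply op_injective
  rw [dunklPow, opSeq_eq, op_mul, dunklPow, opSeq_eq, List.map_map, List.map_map]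
  have := prod_pow_add_single (f := fun j => (op (dunkl q s j) : ROp K n μ))
    (fun a b => (dunkl_commute h a b).op) v i (List.nodup_finRange (n + 1))
  rw [if_pos (List.mem_finRange i)] at this
  rw [show (op ∘ fun j => dunkl q s j ^ v j)
    = fun j => (op (dunkl q s j) : ROp K n μ) ^ v j from rfl, ← this]
  congr 2
  funext j
  simp only [Function.comp_apply, Finsupp.add_apply, Finsupp.single_apply, op_pow, eq_comm (a := i)]

theorem dunklPow_zero (q s : K) : (dunklPow q s 0 : Module.End K (VPoly K n μ)) = 1 := by
  apply op_injective
  rw [dunklPow, opSeq_eq]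
  refine List.prod_eq_one fun x hx => ?_
  simpa using hx

theorem pairing_tens_monomial (q s : K) (v : Fin (n + 1) →₀ ℕ) (A : RST n μ) (Q : VPoly K n μ) :
    pairing q s (tens (monomial v 1) A) Q = nu s A * coeff 0 (dunklPow q s v Q A) := by
  rw [pairing, LinearMap.sum_apply, LinearMap.sum_apply, Finset.sum_eq_single A]
  · rw [LinearMap.smul_apply, LinearMap.smul_apply, LinearMap.comp_apply, LinearMap.proj_apply,
      show (tens (monomial v 1) A : VPoly K n μ) A = basisMonomials (Fin (n + 1)) K v by
        simp [tens], Module.Basis.constr_basis]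
    rfl
  · intro B _ hB
    rw [LinearMap.smul_apply, LinearMap.smul_apply, LinearMap.comp_apply, LinearMap.proj_apply,
      show (tens (monomial v 1) A : VPoly K n μ) B = 0 by simp [tens, hB], map_zero,
      LinearMap.zero_apply, smul_zero]
  · simp

theorem pairing_tens_one (q s : K) (A : RST n μ) (Q : VPoly K n μ) :
    pairing q s (tens 1 A) Q = nu s A * coeff 0 (Q A) := by
  have := pairing_tens_monomial q s 0 A Q
  rwa [dunklPow_zero] at this

theorem mem_of_monomial (S : Submodule K (VPoly K n μ))
    (h : ∀ A v, tens (monomial v 1) A ∈ S) (P : VPoly K n μ) : P ∈ S := by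
  have h2 : ∀ A p, tens p A ∈ S := by
    intro A p
    have hle : Submodule.span K (Set.range (basisMonomials (Fin (n + 1)) K))
        ≤ S.comap (LinearMap.single K (fun _ : RST n μ => MvPolynomial (Fin (n + 1)) K) A) := by
      rw [Submodule.span_le]
      rintro _ ⟨v, rfl⟩
      rw [coe_basisMonomials]
      exact h A v
    rw [Module.Basis.span_eq] at hle
    exact hle (Submodule.mem_top (x := p))
  have : P = ∑ A, tens (P A) A := (Finset.univ_sum_single P).symm
  rw [this]
  exact S.sum_mem fun A _ => h2 A _

/-- The adjoint of the multiplication by a variable is a Dunkl operator, since the Dunkl operators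
commute. -/
theorem pairing_mulX (h : Generic q s) (i : Fin (n + 1)) (P Q : VPoly K n μ) :
    pairing q s (mulX i P) Q = pairing q s P (dunkl q s i Q) := by
  have : P ∈ LinearMap.ker (pairing q s ∘ₗ mulX i - (pairing q s).compl₂ (dunkl q s i)) := by
    refine mem_of_monomial _ (fun A v => ?_) P
    rw [LinearMap.mem_ker]
    refine LinearMap.ext fun Q => ?_
    rw [LinearMap.sub_apply, LinearMap.sub_apply, LinearMap.comp_apply, LinearMap.compl₂_apply,
      mulX_tens, show (X i * monomial v 1 : MvPolynomial (Fin (n + 1)) K)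
        = monomial (v + Finsupp.single i 1) 1 by rw [X, monomial_mul, one_mul (1 : K), add_comm v],
      pairing_tens_monomial, pairing_tens_monomial, dunklPow_add_single h]
    exact sub_self _
  have e := LinearMap.congr_fun (LinearMap.mem_ker.mp this) Q
  rw [LinearMap.sub_apply, LinearMap.sub_apply, LinearMap.comp_apply, LinearMap.compl₂_apply] at e
  exact sub_eq_zero.mp e

theorem isCanonicalForm (h : Generic q s) :
    IsCanonicalForm (n := n) (μ := μ) q s (pairing q s) where
  tableau A B := by
    rw [pairing_tens_one]
    by_cases hAB : A = B
    · subst hAB; simp [tens]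
    · simp [tens, hAB]
  degree A B v hv := by
    rw [pairing_tens_one]
    by_cases hAB : A = B
    · subst hAB; simp [tens, hv]
    · simp [tens, hAB]
  adjoint := pairing_mulX h

end Dunkl

/-! ### Products over pairs -/

section PairProd

variable {M α : Type*} [CommMonoid M] {n : ℕ}

/-- The product of `g (e i) (e j)` over all `i < j`. -/
def pairProd (g : α → α → M) (e : Fin n → α) : M :=
  ∏ p ∈ (Finset.univ : Finset (Fin n × Fin n)).filter (fun p => p.1 < p.2),
    g (e p.1) (e p.2)

/-- Exchanging adjacent entries of `e` changes only the factor of this pair. -/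
theorem pairProd_swap (g : α → α → M) (e : Fin (n + 1) → α) (i : Fin n) :
    pairProd g (e ∘ Equiv.swap i.castSucc i.succ) * g (e i.castSucc) (e i.succ)
      = pairProd g e * g (e i.succ) (e i.castSucc) := by
  set S := (Finset.univ : Finset (Fin (n + 1) × Fin (n + 1))).filter (fun p => p.1 < p.2)
    with hS
  set σ := Equiv.swap i.castSucc i.succ with hσ
  have hmem : (i.castSucc, i.succ) ∈ S := by
    rw [hS, Finset.mem_filter]; exact ⟨Finset.mem_univ _, Fin.castSucc_lt_succ⟩
  have h1 := Finset.mul_prod_erase S (fun p => g (e (σ p.1)) (e (σ p.2))) hmem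
  have h2 := Finset.mul_prod_erase S (fun p => g (e p.1) (e p.2)) hmem
  have hmap : ∀ p ∈ S.erase (i.castSucc, i.succ),
      (σ p.1, σ p.2) ∈ S.erase (i.castSucc, i.succ) := by
    rintro ⟨a, b⟩ hp
    simp only [hS, hσ, Finset.mem_erase, ne_eq, Prod.mk.injEq, Finset.mem_filter,
      Finset.mem_univ, true_and, Equiv.swap_apply_def, Fin.lt_def, Fin.ext_iff, Fin.val_castSucc,
      Fin.val_succ] at hp ⊢
    split_ifs <;> (try simp only [Fin.val_castSucc, Fin.val_succ]) <;> omega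
  have h3 : ∏ p ∈ S.erase (i.castSucc, i.succ), g (e (σ p.1)) (e (σ p.2))
      = ∏ p ∈ S.erase (i.castSucc, i.succ), g (e p.1) (e p.2) := by
    refine Finset.prod_nbij' (fun p => (σ p.1, σ p.2)) (fun p => (σ p.1, σ p.2)) hmap hmap ?_ ?_ ?_
    · intro p _; simp [hσ]
    · intro p _; simp [hσ]
    · intro p _; rfl
  simp only [hσ, Equiv.swap_apply_left, Equiv.swap_apply_right] at h1
  have e1 : pairProd g (e ∘ σ) = ∏ p ∈ S, g (e (σ p.1)) (e (σ p.2)) := rfl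
  have e2 : pairProd g e = ∏ p ∈ S, g (e p.1) (e p.2) := rfl
  rw [e1, e2, ← h1, ← h2, ← hσ, h3]
  rw [mul_right_comm, mul_comm (g (e i.succ) _), mul_right_comm]

end PairProd

/-! ### Unitarity of the generators -/

section Unitary

variable {K : Type*} [Field K] {n : ℕ} {μ : YoungDiagram} {q s : K}

open Filling

/-- The factor of `ν` that belongs to a pair with contents `a` and `b`. -/
noncomputable def nuFactor (s : K) (a b : ℤ) : K :=
  if a - b ≤ -2 then (1 - s ^ (b - a - 1)) * (1 - s ^ (b - a + 1)) / (1 - s ^ (b - a)) ^ 2 else 1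

theorem nu_eq (s : K) (A : RST n μ) : nu s A = pairProd (nuFactor s) A.ct := by
  unfold nu pairProd nuFactor
  rw [← Finset.prod_filter, Finset.filter_filter]

/-- The effect of an exchange of consecutive entries on `ν`. -/
theorem nu_swap {A B : RST n μ} {i : Fin n} (hB : IsSwap A B i.castSucc i.succ)
    (hd : diff A.cell i ≤ -2) : nu s B = nu s A * nuFactor s (A.ct i.succ) (A.ct i.castSucc) := by
  have e : B.ct = A.ct ∘ Equiv.swap i.castSucc i.succ := funext hB.ct
  have h1 : nuFactor s (A.ct i.castSucc) (A.ct i.succ) = 1 := by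
    rw [diff_cell] at hd
    rw [nuFactor, if_neg (by omega)]
  rw [nu_eq, nu_eq, e, ← pairProd_swap, h1, mul_one]

theorem pairing_const_mulX {P : VPoly K n μ} (hP : P ∈ constants K n μ) (j : Fin (n + 1))
    (Q : VPoly K n μ) : pairing q s P (mulX j Q) = 0 := by
  have : P ∈ LinearMap.ker ((pairing q s).flip (mulX j Q)) := by
    refine constants_induction (fun A => ?_) hP
    rw [LinearMap.mem_ker, LinearMap.flip_apply, pairing_tens_one, mulX_apply,
      mul_comm (X j), coeff_mul_X', if_neg (by simp), mul_zero]
  exact this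

theorem pairing_const_boldT_mulX {P : VPoly K n μ} (hP : P ∈ constants K n μ) (i : Fin n)
    (j : Fin (n + 1)) (Q : VPoly K n μ) : pairing q s P (boldT s i (mulX j Q)) = 0 := by
  by_cases h1 : j = i.castSucc
  · rw [h1, boldT_mulX, map_add, map_smul, pairing_const_mulX hP, pairing_const_mulX hP]; simp
  by_cases h2 : j = i.succ
  · rw [h2, boldT_mulX_succ, map_sub, map_smul, pairing_const_mulX hP, pairing_const_mulX hP]; simp
  rw [boldT_mulX_far s i h1 h2, pairing_const_mulX hP]

theorem tensF_apply (F : Filling n μ) (B : RST n μ) :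
    (tensF 1 F : VPoly K n μ) B = if F = B.cell then 1 else 0 := by
  by_cases h : ∃ A : RST n μ, A.cell = F
  · obtain ⟨A, rfl⟩ := h
    rw [tensF_cell]
    by_cases hAB : B = A
    · subst hAB; simp [tens]
    · rw [if_neg fun e => hAB (cell_injective e.symm)]; simp [tens, hAB]
  · rw [tensF_of_not _ h, if_neg fun e => h ⟨B, e.symm⟩]; rfl

theorem pairing_tens_tensF (A : RST n μ) (F : Filling n μ) :
    pairing q s (tens 1 A) (tensF 1 F) = if F = A.cell then nu s A else 0 := by
  rw [pairing_tens_one, tensF_apply]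
  split_ifs <;> simp

theorem pairing_tensF_tens (F : Filling n μ) (B : RST n μ) :
    pairing q s (tensF 1 F) (tens 1 B) = if F = B.cell then nu s B else 0 := by
  by_cases h : ∃ A : RST n μ, A.cell = F
  · obtain ⟨A, rfl⟩ := h
    rw [← tensF_cell 1 B, tensF_cell 1 A, pairing_tens_tensF]
    by_cases hAB : A = B
    · subst hAB; simp
    · rw [if_neg fun e => hAB (cell_injective e.symm), if_neg fun e => hAB (cell_injective e)]
  · rw [tensF_of_not _ h, if_neg fun e => h ⟨B, e.symm⟩, map_zero, LinearMap.zero_apply]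

theorem diagCoeff_inv (h0 : s ≠ 0) {m : ℤ} (hm : s ^ m ≠ 1) :
    diagCoeff s⁻¹ m = s⁻¹ * (diagCoeff s m + (1 - s)) := by
  unfold diagCoeff
  rw [inv_zpow]
  have hz : s ^ m ≠ 0 := zpow_ne_zero _ h0
  generalize s ^ m = z at *
  have h1 : 1 - z ≠ 0 := sub_ne_zero.mpr hm.symm
  have h3 : z - 1 ≠ 0 := sub_ne_zero.mpr hm
  have h4 : 1 - z⁻¹ = (z - 1) / z := by field_simp
  rw [h4]
  field_simp
  ring

theorem offCoeff_inv_of_two_le (h0 : s ≠ 0) {a b : ℤ} (hm : s ^ (b - a) ≠ 1) (h : 2 ≤ b - a) :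
    offCoeff s⁻¹ (b - a) = s⁻¹ * nuFactor s a b ∧
      offCoeff s (b - a) = s * nuFactor s a b := by
  rw [offCoeff, if_neg (by omega), offCoeff, if_neg (by omega), nuFactor, if_pos (by omega)]
  refine ⟨?_, by ring⟩
  simp only [inv_zpow]
  rw [zpow_add_one₀ h0, zpow_sub_one₀ h0]
  have hz : s ^ (b - a) ≠ 0 := zpow_ne_zero _ h0
  generalize s ^ (b - a) = z at *
  have h1 : 1 - z ≠ 0 := sub_ne_zero.mpr hm.symm
  have h3 : z - 1 ≠ 0 := sub_ne_zero.mpr hm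
  have h4 : 1 - z⁻¹ = (z - 1) / z := by field_simp
  rw [h4]
  field_simp
  ring

theorem boldTinv_apply (i : Fin n) (Q : VPoly K n μ) :
    boldTinv s i Q = s⁻¹ • (boldT s i Q + (1 - s) • Q) := rfl

/-- On tableaux, `T_i` with the reciprocal parameter and `T_i⁻¹` are adjoint: the weights `ν` make
up for the asymmetry of the seminormal form. -/
theorem pairing_T_tens (h : Generic q s) (i : Fin n) (A B : RST n μ) :
    pairing q s (boldT s⁻¹ i (tens 1 A)) (tens 1 B)
      = pairing q s (tens 1 A) (boldTinv s i (tens 1 B)) := by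
  have h1 : s ≠ 1 := by simpa using h.s_zpow_ne 1 one_ne_zero
  have hne : ∀ A : RST n μ, diff A.cell i ≠ 0 := fun A => by
    rw [diff_cell, sub_ne_zero]
    exact (A.ct_ne (by simp [Fin.lt_def]) (by simp)).symm
  have hsw : ∀ A : RST n μ, swap A.cell i ≠ A.cell := fun A e => by
    have := congrArg (fun F : Filling n μ => diff F i) e
    simp only [diff_swap] at this
    have := hne A
    omega
  rw [boldTinv_apply, boldT_const _ _ (tens_one_mem A), boldT_const _ _ (tens_one_mem B),
    ← tensF_cell, ← tensF_cell 1 B, tabT_tensF (inv_ne_zero h.s_ne) (inv_ne_one.mpr h1),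
    tabT_tensF h.s_ne h1]
  simp only [map_add, map_smul, LinearMap.add_apply, LinearMap.smul_apply, smul_eq_mul]
  rw [tensF_cell 1 B, tensF_cell 1 A, pairing_tensF_tens, ← tensF_cell 1 B, pairing_tens_tensF,
    pairing_tens_tensF]
  by_cases hAB : A = B
  · subst hAB
    rw [if_neg (hsw A), if_pos rfl, diagCoeff_inv h.s_ne (h.s_zpow_ne _ (hne A))]
    ring
  · rw [if_neg fun e => hAB (cell_injective e.symm)]
    by_cases hS : swap A.cell i = B.cell
    · have hS' : swap B.cell i = A.cell := by rw [← hS, swap_swap]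
      have hBA : IsSwap A B i.castSucc i.succ := hS.symm
      have hAB' : IsSwap B A i.castSucc i.succ := hS'.symm
      have hd : diff B.cell i = -diff A.cell i := by rw [← hS, diff_swap]
      rw [if_pos hS, if_pos hS', hd]
      have hA := hne A
      rcases lt_trichotomy (diff A.cell i) (-1) with hl | hl | hl
      · have := (offCoeff_inv_of_two_le (s := s) h.s_ne (a := A.ct i.succ) (b := A.ct i.castSucc)
          (h.s_zpow_ne _ (by rw [diff_cell] at hl; omega)) (by rw [diff_cell] at hl; omega)).2
        have hd' : -diff A.cell i = A.ct i.castSucc - A.ct i.succ := by rw [diff_cell]; ring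
        rw [offCoeff, if_pos (by omega), hd', this, nu_swap hBA (by omega)]
        have := h.s_ne
        field_simp
        ring
      · rw [hl, neg_neg, offCoeff_one, offCoeff_neg_one]; ring
      · rcases (show diff A.cell i = 1 ∨ 2 ≤ diff A.cell i by omega) with h2 | h2
        · rw [h2, offCoeff_one, offCoeff_neg_one]; ring
        · have e1 : B.ct i.succ = A.ct i.castSucc := by
            rw [hBA.ct, Equiv.swap_apply_right]
          have e2 : B.ct i.castSucc = A.ct i.succ := by
            rw [hBA.ct, Equiv.swap_apply_left]
          have := (offCoeff_inv_of_two_le (s := s) h.s_ne (a := A.ct i.castSucc)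
            (b := A.ct i.succ) (h.s_zpow_ne _ (by rw [diff_cell] at h2; omega))
            (by rw [diff_cell] at h2; omega)).1
          rw [← diff_cell] at this
          rw [nu_swap hAB' (show diff B.cell i ≤ -2 by omega), e1, e2]
          rw [this, offCoeff, if_pos (by omega)]
          ring
    · rw [if_neg hS, if_neg fun e => hS (by rw [← e, swap_swap])]
      ring

/-- The generators are exchanged with the Dunkl operators in the way dual to the variables. -/
theorem boldTinv_dunkl (h : Generic q s) (i : Fin n) (Q : VPoly K n μ) :
    boldTinv s i (dunkl q s i.castSucc Q) = s⁻¹ • dunkl q s i.succ (boldT s i Q) := by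
  have hD := (isDunklFamily (n := n) (μ := μ) h).step i i.2
  have e : rD μ n q s i * rT' μ n s i = s⁻¹ • (rT μ n s i * rD μ n q s (i + 1)) := by
    rw [hD, smul_mul_assoc, mul_assoc, h.isDoubleHecke.T_mul_inv i.2, mul_one]
  rw [rT'_val, rT_val, show rD μ n q s i = op (dunkl q s i.castSucc) from rD_val q s i.castSucc,
    show rD μ n q s (i + 1) = op (dunkl q s i.succ) from rD_val q s i.succ] at e
  exact LinearMap.congr_fun (congrArg unop e) Q

theorem dunkl_boldTinv (h : Generic q s) (i : Fin n) (Q : VPoly K n μ) :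
    dunkl q s i.castSucc (boldTinv s i Q) = s⁻¹ • boldT s i (dunkl q s i.succ Q) := by
  have hD := (isDunklFamily (n := n) (μ := μ) h).step i i.2
  have e : rT' μ n s i * rD μ n q s i = s⁻¹ • (rD μ n q s (i + 1) * rT μ n s i) := by
    rw [hD, mul_smul_comm, mul_assoc, h.isDoubleHecke.inv_mul_T_mul i.2]
  rw [rT'_val, rT_val, show rD μ n q s i = op (dunkl q s i.castSucc) from rD_val q s i.castSucc,
    show rD μ n q s (i + 1) = op (dunkl q s i.succ) from rD_val q s i.succ] at e
  exact LinearMap.congr_fun (congrArg unop e) Q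

theorem boldTinv_dunkl_far (h : Generic q s) (i : Fin n) {j : Fin (n + 1)} (h1 : j ≠ i.castSucc)
    (h2 : j ≠ i.succ) (Q : VPoly K n μ) :
    boldTinv s i (dunkl q s j Q) = dunkl q s j (boldTinv s i Q) := by
  have hD := isDunklFamily (n := n) (μ := μ) h
  have e := (h.isDoubleHecke.commute_conj (h.isDoubleHecke.dunkl_conj hD) (i := j) (by omega) i i.2
    (fun e => h1 (Fin.ext e.symm)) (fun e => h2 (Fin.ext (by rw [← e, Fin.val_succ])))).symm
  have e := (h.isDoubleHecke.commute_inv e).eq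
  rw [rD_val, rT'_val] at e
  exact LinearMap.congr_fun (congrArg unop e) Q

/-- Forms that agree on constants on the left agree, if agreement is preserved by the variables. -/
theorem bilin_ext {F G : VPoly K n μ →ₗ[K] VPoly K n μ →ₗ[K] K}
    (h1 : ∀ A Q, F (tens 1 A) Q = G (tens 1 A) Q)
    (hX : ∀ j P, (∀ Q, F P Q = G P Q) → ∀ Q, F (mulX j P) Q = G (mulX j P) Q)
    (P Q : VPoly K n μ) : F P Q = G P Q := by
  have hP : P ∈ LinearMap.ker (F - G) := by
    refine mem_of_mulX _ (fun A => ?_) (fun j P hP => ?_) P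
    · exact LinearMap.ext fun Q => sub_eq_zero.mpr (h1 A Q)
    · exact LinearMap.ext fun Q => sub_eq_zero.mpr (hX j P (fun Q => sub_eq_zero.mp
        (LinearMap.congr_fun (LinearMap.mem_ker.mp hP) Q)) Q)
  exact sub_eq_zero.mp (LinearMap.congr_fun (LinearMap.mem_ker.mp hP) Q)

theorem lin_ext {f g : VPoly K n μ →ₗ[K] K} (h1 : ∀ A, f (tens 1 A) = g (tens 1 A))
    (hX : ∀ j P, f (mulX j P) = g (mulX j P)) (P : VPoly K n μ) : f P = g P := by
  have hP : P ∈ LinearMap.ker (f - g) :=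
    mem_of_mulX _ (fun A => sub_eq_zero.mpr (h1 A)) (fun j P _ => sub_eq_zero.mpr (hX j P)) P
  exact sub_eq_zero.mp hP

/-- The adjoint of `𝐓_i` for the reciprocal parameters is `𝐓_i⁻¹`. Multiplication by variables on
the left turns into Dunkl operators on the right, which satisfy the dual exchange relations. -/
theorem pairing_T (h : Generic q s) (i : Fin n) (P Q : VPoly K n μ) :
    pairing q s (boldT s⁻¹ i P) Q = pairing q s P (boldTinv s i Q) := by
  refine bilin_ext (F := pairing q s ∘ₗ boldT s⁻¹ i) (G := (pairing q s).compl₂ (boldTinv s i))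
    (fun A Q => ?_) (fun j P hP Q => ?_) P Q
  · refine lin_ext (f := (pairing q s ∘ₗ boldT s⁻¹ i) (tens 1 A))
      (g := ((pairing q s).compl₂ (boldTinv s i)) (tens 1 A)) (fun B => ?_) (fun j Q => ?_) Q
    · exact pairing_T_tens h i A B
    · have hc : boldT s⁻¹ i (tens 1 A) ∈ constants K n μ := by
        rw [boldT_const _ _ (tens_one_mem A)]
        exact tabT_mem _ _ (tens_one_mem A)
      rw [LinearMap.comp_apply, LinearMap.compl₂_apply, boldTinv_apply, map_smul, map_add, map_smul,
        pairing_const_boldT_mulX (tens_one_mem A), pairing_const_mulX (tens_one_mem A),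
        pairing_const_mulX hc]
      simp
  · simp only [LinearMap.comp_apply, LinearMap.compl₂_apply] at hP ⊢
    have hs := h.s_ne
    by_cases h1 : j = i.castSucc
    · rw [h1, boldT_mulX, map_add, map_smul, LinearMap.add_apply, LinearMap.smul_apply,
        pairing_mulX h, pairing_mulX h, pairing_mulX h, hP, boldTinv_apply, dunkl_boldTinv h]
      simp only [map_add, map_smul, smul_eq_mul]
      field_simp
      ring
    by_cases h2 : j = i.succ
    · rw [h2, boldT_mulX_succ, map_sub, map_smul, LinearMap.sub_apply, LinearMap.smul_apply,
        pairing_mulX h, pairing_mulX h, pairing_mulX h, hP, boldTinv_dunkl h, boldTinv_apply]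
      simp only [map_add, map_smul, smul_eq_mul]
      field_simp
      ring
    · rw [boldT_mulX_far _ _ h1 h2, pairing_mulX h, pairing_mulX h, hP,
        boldTinv_dunkl_far h i h1 h2]

/-- A pair of operators, the first one for the reciprocal parameters, that preserves the form. -/
def IsUnitary (q s : K) (a b : ROp K n μ) : Prop :=
  ∀ P Q, pairing q s (a.unop P) (b.unop Q) = pairing q s P Q

namespace IsUnitary

variable {a b c d : ROp K n μ}

theorem one : IsUnitary q s (1 : ROp K n μ) 1 := fun _ _ => rfl

theorem mul (h1 : IsUnitary q s a b) (h2 : IsUnitary q s c d) : IsUnitary q s (a * c) (b * d) :=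
  fun P Q => (h2 _ _).trans (h1 P Q)

theorem smul (h : IsUnitary q s a b) {x y : K} (hxy : x * y = 1) :
    IsUnitary q s (x • a) (y • b) := fun P Q => by
  rw [unop_smul, unop_smul, LinearMap.smul_apply, LinearMap.smul_apply, map_smul,
    map_smul, LinearMap.smul_apply, smul_smul, mul_comm, hxy, one_smul, h]

theorem ascProd {a b : ℕ → ROp K n μ} {k : ℕ} (h : ∀ i < k, IsUnitary q s (a i) (b i)) :
    IsUnitary q s (ascProd a k) (ascProd b k) := by
  induction k with
  | zero => exact one
  | succ k ih =>
    rw [ascProd_succ, ascProd_succ]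
    exact (ih fun i hi => h i (by omega)).mul (h k (by omega))

theorem descProd {a b : ℕ → ROp K n μ} {k : ℕ} (h : ∀ i < k, IsUnitary q s (a i) (b i)) :
    IsUnitary q s (descProd a k) (descProd b k) := by
  induction k with
  | zero => exact one
  | succ k ih =>
    rw [descProd_succ, descProd_succ]
    exact (h k (by omega)).mul (ih fun i hi => h i (by omega))

end IsUnitary

theorem isUnitary_T (h : Generic q s) {i : ℕ} (hi : i < n) :
    IsUnitary q s (rT μ n s⁻¹ i) (rT μ n s i) := fun P Q => by
  lift i to Fin n using hi
  have e : boldTinv s i (boldT s i Q) = Q := by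
    have := h.isDoubleHecke (n := n) (μ := μ) |>.T_mul_inv i.2
    rw [rT_val, rT'_val] at this
    exact LinearMap.congr_fun (congrArg unop this) Q
  rw [rT_val, rT_val, unop_op, unop_op, pairing_T h, e]

theorem isUnitary_T' (h : Generic q s) {i : ℕ} (hi : i < n) :
    IsUnitary q s (rT' μ n s⁻¹ i) (rT' μ n s i) := fun P Q => by
  rw [← isUnitary_T h hi, ← Module.End.mul_apply, ← Module.End.mul_apply, ← unop_mul, ← unop_mul,
    h.isDoubleHecke.inv_mul_T hi, h.inv.isDoubleHecke.inv_mul_T hi]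
  rfl

/-- The affine element preserves the form: multiplication by variables on the left turns into Dunkl
operators on the right, which `𝐰` permutes in the corresponding way. -/
theorem isUnitary_W (h : Generic q s) :
    IsUnitary q s (rW μ n q⁻¹ s⁻¹) (rW μ n q s) := by
  have hL := h.isDoubleHecke (n := n) (μ := μ)
  have hD := isDunklFamily (n := n) (μ := μ) h
  have hX : ∀ (q s : K) (i : Fin n) (P : VPoly K n μ), (rW μ n q s).unop (mulX i.succ P)
      = mulX i.castSucc ((rW μ n q s).unop P) := fun q s i P => by
    have e := rX_rW_succ (μ := μ) (q := q) (s := s) i.2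
    rw [rX_castSucc, rX_succ] at e
    exact LinearMap.congr_fun (congrArg unop e) P
  have hX0 : ∀ (q s : K) (P : VPoly K n μ), (rW μ n q s).unop (mulX 0 P)
      = q • mulX (Fin.last n) ((rW μ n q s).unop P) := fun q s P => by
    have e := rX_rW_zero (n := n) (μ := μ) (q := q) (s := s)
    rw [rX_zero, rX_last] at e
    exact LinearMap.congr_fun (congrArg unop e) P
  have hDs : ∀ (i : Fin n) (Q : VPoly K n μ), dunkl q s i.castSucc ((rW μ n q s).unop Q)
      = (rW μ n q s).unop (dunkl q s i.succ Q) := fun i Q => by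
    have e := hL.w_dunkl hD i.2
    rw [show rD μ n q s i = op (dunkl q s i.castSucc) from rD_val q s i.castSucc,
      show rD μ n q s (i + 1) = op (dunkl q s i.succ) from rD_val q s i.succ] at e
    exact LinearMap.congr_fun (congrArg unop e) Q
  have hDl : ∀ Q : VPoly K n μ, dunkl q s (Fin.last n) ((rW μ n q s).unop Q)
      = q • (rW μ n q s).unop (dunkl q s 0 Q) := fun Q => by
    have e := hL.w_dunkl_last hD
    rw [show rD μ n q s n = op (dunkl q s (Fin.last n)) from rD_val q s (Fin.last n),
      show rD μ n q s 0 = op (dunkl q s 0) from rD_val q s 0] at e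
    exact LinearMap.congr_fun (congrArg unop e) Q
  have hc : ∀ (q s : K) (A : RST n μ), (rW μ n q s).unop (tens 1 A) ∈ constants K n μ :=
    fun q s A => by
      rw [rW_const (tens_one_mem A)]; exact ascProd_rTab_mem n (tens_one_mem A)
  intro P Q
  refine bilin_ext (F := (pairing q s).compl₁₂ (rW μ n q⁻¹ s⁻¹).unop (rW μ n q s).unop)
    (G := pairing q s) (fun A Q => ?_) (fun j P hP Q => ?_) P Q
  · refine lin_ext (f := ((pairing q s).compl₁₂ (rW μ n q⁻¹ s⁻¹).unop (rW μ n q s).unop) (tens 1 A))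
      (g := pairing q s (tens 1 A)) (fun B => ?_) (fun j Q => ?_) Q
    · rw [LinearMap.compl₁₂_apply, rW_const (tens_one_mem A), rW_const (tens_one_mem B),
        ← ascProd_rT_const _ (tens_one_mem A), ← ascProd_rT_const _ (tens_one_mem B)]
      exact IsUnitary.ascProd (fun i hi => isUnitary_T h hi) _ _
    · rw [LinearMap.compl₁₂_apply, pairing_const_mulX (tens_one_mem A)]
      refine Fin.cases ?_ (fun i => ?_) j
      · rw [hX0, map_smul, pairing_const_mulX (hc _ _ A), smul_zero]
      · rw [hX, pairing_const_mulX (hc _ _ A)]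
  · simp only [LinearMap.compl₁₂_apply] at hP ⊢
    refine Fin.cases ?_ (fun i => ?_) j
    · rw [hX0, map_smul, LinearMap.smul_apply, pairing_mulX h, pairing_mulX h, hDl, map_smul, hP,
        smul_smul, inv_mul_cancel₀ h.q_ne, one_smul]
    · rw [hX, pairing_mulX h, pairing_mulX h, hDs, hP]

/-- The Cherednik operators preserve the form. -/
theorem isUnitary_Xi (h : Generic q s) (k : ℕ) (hk : k ≤ n) :
    IsUnitary q s (rXi μ n q⁻¹ s⁻¹ k) (rXi μ n q s k) := by
  obtain ⟨d, hd⟩ : ∃ d, n = k + d := ⟨n - k, by omega⟩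
  induction d generalizing k with
  | zero =>
    obtain rfl : n = k := hd
    rw [(isCherednikFamily _ _).last, (isCherednikFamily _ _).last]
    exact (IsUnitary.descProd fun i hi => isUnitary_T' h hi).mul (isUnitary_W h)
  | succ d ih =>
    rw [(isCherednikFamily _ _).step k (by omega), (isCherednikFamily _ _).step k (by omega)]
    have hT := isUnitary_T (n := n) (μ := μ) h (i := k) (by omega)
    exact ((hT.mul (ih (k + 1) (by omega) (by omega))).mul hT).smul
      (by rw [inv_inv, mul_inv_cancel₀ h.s_ne])

/-- Eigenvectors of a Cherednik operator and of its counterpart for the reciprocal parameters are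
orthogonal, unless the eigenvalues are reciprocal. -/
theorem pairing_eq_zero (h : Generic q s) {P Q : VPoly K n μ} {k : ℕ} (hk : k ≤ n) {x y : K}
    (hP : (rXi μ n q⁻¹ s⁻¹ k).unop P = x • P) (hQ : (rXi μ n q s k).unop Q = y • Q)
    (hxy : x * y ≠ 1) : pairing q s P Q = 0 := by
  have e := isUnitary_Xi h k hk P Q
  rw [hP, hQ, map_smul, map_smul, LinearMap.smul_apply, smul_smul, smul_eq_mul] at e
  have : (y * x - 1) * pairing q s P Q = 0 := by rw [sub_mul, e, one_mul, sub_self]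
  rcases mul_eq_zero.mp this with h' | h'
  · exact absurd (by rw [mul_comm]; exact sub_eq_zero.mp h') hxy
  · exact h'

end Unitary

/-! ### Ranks and spectral labels -/

section Labels

variable {n : ℕ} {μ : YoungDiagram}

/-- `j` precedes `i` in the stable decreasing rearrangement of `v`. -/
def Precedes (v : Fin (n + 1) → ℕ) (j i : Fin (n + 1)) : Prop :=
  (j < i ∧ v i ≤ v j) ∨ (i < j ∧ v i < v j)

theorem Precedes.trans {v : Fin (n + 1) → ℕ} {i j k : Fin (n + 1)} (h1 : Precedes v i j)
    (h2 : Precedes v j k) : Precedes v i k := by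
  unfold Precedes at *
  rcases eq_or_ne i k with rfl | h <;> omega

theorem precedes_irrefl (v : Fin (n + 1) → ℕ) (i : Fin (n + 1)) : ¬ Precedes v i i := by
  unfold Precedes
  omega

theorem precedes_total (v : Fin (n + 1) → ℕ) {i j : Fin (n + 1)} (h : i ≠ j) :
    Precedes v i j ∨ Precedes v j i := by
  unfold Precedes
  omega

open Classical in
theorem val_rank (v : Fin (n + 1) → ℕ) (i : Fin (n + 1)) :
    (rank v i : ℕ) = (Finset.univ.filter fun j => Precedes v j i).card := by
  unfold rank Precedes
  simp only
  congr

theorem rank_injective (v : Fin (n + 1) → ℕ) : Function.Injective (rank v) := by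
  classical
  have key : ∀ i j, Precedes v i j → (rank v i : ℕ) < rank v j := fun i j h => by
    rw [val_rank, val_rank]
    refine Finset.card_lt_card ((Finset.ssubset_iff_of_subset fun k hk => ?_).mpr ⟨i, ?_, ?_⟩)
    · simp only [Finset.mem_filter, Finset.mem_univ, true_and] at hk ⊢
      exact hk.trans h
    · simpa using h
    · simpa using precedes_irrefl v i
  intro i j h
  by_contra hij
  rcases precedes_total v hij with h' | h'
  · exact (key _ _ h').ne (congrArg Fin.val h)
  · exact (key _ _ h').ne (congrArg Fin.val h.symm)

/-- A permutation that matches the orders of precedence matches the ranks. -/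
theorem rank_congr {v w : Fin (n + 1) → ℕ} (σ : Equiv.Perm (Fin (n + 1)))
    (h : ∀ i j, Precedes w j i ↔ Precedes v (σ j) (σ i)) (i : Fin (n + 1)) :
    rank w i = rank v (σ i) := by
  classical
  apply Fin.ext
  rw [val_rank, val_rank]
  refine Finset.card_bij (fun j _ => σ j) (fun j hj => ?_) (fun _ _ _ _ e => σ.injective e)
    fun j hj => ⟨σ.symm j, ?_, by simp⟩
  · simpa [h] using hj
  · simpa [h] using hj

theorem rank_comp_swap {v : Fin (n + 1) → ℕ} {k : Fin n} (hv : v k.castSucc ≠ v k.succ)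
    (i : Fin (n + 1)) : rank (v ∘ Equiv.swap k.castSucc k.succ) i
      = rank v (Equiv.swap k.castSucc k.succ i) := by
  refine rank_congr (Equiv.swap k.castSucc k.succ) (fun i j => ?_) i
  have h1 : ∀ i : Fin (n + 1), i = k.castSucc ∨ i = k.succ ∨
      (Equiv.swap k.castSucc k.succ i = i ∧ i ≠ k.castSucc ∧ i ≠ k.succ) := fun i => by
    by_cases ha : i = k.castSucc
    · exact Or.inl ha
    by_cases hb : i = k.succ
    · exact Or.inr (Or.inl hb)
    exact Or.inr (Or.inr ⟨Equiv.swap_apply_of_ne_of_ne ha hb, ha, hb⟩)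
  unfold Precedes
  simp only [Function.comp_apply]
  rcases h1 i with rfl | rfl | ⟨hi, hi1, hi2⟩ <;> rcases h1 j with rfl | rfl | ⟨hj, hj1, hj2⟩ <;>
    simp only [Equiv.swap_apply_left, Equiv.swap_apply_right, *] <;>
    simp only [Fin.lt_def, ne_eq, Fin.ext_iff, Fin.val_castSucc, Fin.val_succ] at * <;> omega

theorem rank_succ_of_eq {v : Fin (n + 1) → ℕ} {k : Fin n} (hv : v k.castSucc = v k.succ) :
    (rank v k.castSucc : ℕ) + 1 = rank v k.succ := by
  classical
  rw [val_rank, val_rank]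
  have e : (Finset.univ.filter fun j => Precedes v j k.succ)
      = insert k.castSucc (Finset.univ.filter fun j => Precedes v j k.castSucc) := by
    ext j
    simp only [Finset.mem_filter, Finset.mem_univ, true_and, Finset.mem_insert]
    unfold Precedes
    by_cases ha : j = k.castSucc
    · subst ha
      simp [hv]
    by_cases hb : j = k.succ
    · subst hb
      simp [hv, ha, Fin.castSucc_le_succ]
    · simp only [Fin.lt_def, Fin.ext_iff, Fin.val_castSucc, Fin.val_succ] at *
      omega
  rw [e, Finset.card_insert_of_notMem (by simpa using precedes_irrefl v k.castSucc)]

theorem rank_zero (i : Fin (n + 1)) : rank (0 : Fin (n + 1) → ℕ) i = i := by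
  classical
  apply Fin.ext
  rw [val_rank]
  have : (Finset.univ.filter fun j => Precedes (0 : Fin (n + 1) → ℕ) j i) = Finset.Iio i := by
    ext j
    simp [Precedes]
  rw [this, Fin.card_Iio]

theorem affineV_castSucc (v : Fin (n + 1) → ℕ) (i : Fin n) : affineV v i.castSucc = v i.succ :=
  Fin.snoc_castSucc ..

theorem affineV_last (v : Fin (n + 1) → ℕ) : affineV v (Fin.last n) = v 0 + 1 := Fin.snoc_last ..

theorem finRotate_castSucc (i : Fin n) : finRotate (n + 1) i.castSucc = i.succ := by
  rw [finRotate_apply, Fin.coeSucc_eq_succ]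

theorem rank_affineV (v : Fin (n + 1) → ℕ) (i : Fin (n + 1)) :
    rank (affineV v) i = rank v (finRotate (n + 1) i) := by
  refine rank_congr (finRotate (n + 1)) (fun i j => ?_) i
  unfold Precedes
  refine Fin.lastCases ?_ (fun a => ?_) i <;> refine Fin.lastCases ?_ (fun b => ?_) j
  · simp
  · rw [affineV_castSucc, affineV_last, finRotate_castSucc, finRotate_last]
    simp only [Fin.lt_def, Fin.val_castSucc, Fin.val_succ, Fin.val_last, Fin.val_zero]
    omega
  · rw [affineV_castSucc, affineV_last, finRotate_castSucc, finRotate_last]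
    simp only [Fin.lt_def, Fin.val_castSucc, Fin.val_succ, Fin.val_last, Fin.val_zero]
    omega
  · rw [affineV_castSucc, affineV_castSucc, finRotate_castSucc, finRotate_castSucc]
    simp only [Fin.lt_def, Fin.val_castSucc, Fin.val_succ]
    omega

theorem SpecGT.trans {a b c : ℤ × ℤ} (h1 : SpecGT a b) (h2 : SpecGT b c) : SpecGT a c := by
  unfold SpecGT at *
  omega

theorem SpecGT.asymm {a b : ℤ × ℤ} (h : SpecGT a b) : ¬ SpecGT b a := by
  unfold SpecGT at *
  omega

theorem SpecGT.ne {a b : ℤ × ℤ} (h : SpecGT a b) : a ≠ b := by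
  rintro rfl
  exact h.asymm h

/-- The exponents `(a, m)` of the entries `q^a s^m` of the spectral vector of `(T, v)`. -/
def label (v : Fin (n + 1) → ℕ) (T : RST n μ) (i : Fin (n + 1)) : ℤ × ℤ := (v i, sExp v T i)

/-- The effect of the affine action on labels. -/
def affineL (e : Fin (n + 1) → ℤ × ℤ) : Fin (n + 1) → ℤ × ℤ :=
  Fin.snoc (α := fun _ => ℤ × ℤ) (fun i : Fin n => e i.succ) (e 0 + (1, 0))

@[simp] theorem affineL_castSucc (e : Fin (n + 1) → ℤ × ℤ) (i : Fin n) :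
    affineL e i.castSucc = e i.succ :=
  Fin.snoc_castSucc (α := fun _ => ℤ × ℤ) ..

@[simp] theorem affineL_last (e : Fin (n + 1) → ℤ × ℤ) :
    affineL e (Fin.last n) = e 0 + (1, 0) :=
  Fin.snoc_last (α := fun _ => ℤ × ℤ) ..

theorem affineL_injective : Function.Injective (affineL (n := n)) := fun e f h => by
  funext i
  refine Fin.cases ?_ (fun i => ?_) i
  · simpa using congrFun h (Fin.last n)
  · simpa using congrFun h i.castSucc

/-- A spectral vector determines the pair `(T, v)`, because the contents determine a tableau. -/
theorem label_injective {v w : Fin (n + 1) → ℕ} {T U : RST n μ} (h : label v T = label w U) :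
    v = w ∧ T = U := by
  have hv : v = w := funext fun i => by
    have := congrArg Prod.fst (congrFun h i)
    simpa [label] using this
  subst hv
  refine ⟨rfl, ct_injective fun k => ?_⟩
  obtain ⟨i, rfl⟩ := (Finite.injective_iff_surjective.mp (rank_injective v)) k
  exact congrArg Prod.snd (congrFun h i)

theorem label_comp_swap {v : Fin (n + 1) → ℕ} (T : RST n μ) {k : Fin n}
    (hv : v k.castSucc ≠ v k.succ) : label (v ∘ Equiv.swap k.castSucc k.succ) T
      = label v T ∘ Equiv.swap k.castSucc k.succ :=
  funext fun i => by
    simp only [label, sExp, rank_comp_swap hv, Function.comp_apply]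

theorem label_isSwap {v : Fin (n + 1) → ℕ} {T U : RST n μ} {k : Fin n}
    (hv : v k.castSucc = v k.succ) (hU : IsSwap T U (rank v k.castSucc) (rank v k.succ)) :
    label v U = label v T ∘ Equiv.swap k.castSucc k.succ :=
  funext fun i => by
    have h1 : v (Equiv.swap k.castSucc k.succ i) = v i := by
      rw [Equiv.swap_apply_def]
      split_ifs with h1 h2
      · rw [h1, hv]
      · rw [h2, hv]
      · rfl
    simp only [label, sExp, hU.ct, Function.comp_apply, h1, (rank_injective v).swap_apply]

theorem label_affineV (v : Fin (n + 1) → ℕ) (T : RST n μ) :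
    label (affineV v) T = affineL (label v T) :=
  funext fun i => by
    refine Fin.lastCases ?_ (fun i => ?_) i
    · rw [affineL_last]
      simp [label, sExp, rank_affineV, affineV_last]
    · rw [affineL_castSucc]
      simp only [label, sExp, rank_affineV, affineV_castSucc, finRotate_castSucc]

/-- The labels of the pairs `(T, v)`. -/
def IsLabel (μ : YoungDiagram) (e : Fin (n + 1) → ℤ × ℤ) : Prop :=
  ∃ (v : Fin (n + 1) → ℕ) (T : RST n μ), e = label v T

theorem IsLabel.nonneg {e : Fin (n + 1) → ℤ × ℤ} (h : IsLabel μ e) (i : Fin (n + 1)) :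
    0 ≤ (e i).1 := by
  obtain ⟨v, T, rfl⟩ := h
  exact Int.natCast_nonneg _

theorem exists_isSwap_rank {v : Fin (n + 1) → ℕ} {T : RST n μ} {k : Fin n}
    (hv : v k.castSucc = v k.succ)
    (h : SpecGT (label v T k.succ) (label v T k.castSucc) ∨
      SpecGT (label v T k.castSucc) (label v T k.succ)) :
    ∃ U : RST n μ, IsSwap T U (rank v k.castSucc) (rank v k.succ) := by
  simp only [SpecGT, label, hv, lt_self_iff_false, false_or, true_and, sExp] at h
  exact exists_isSwap T (rank_succ_of_eq hv) (by omega) (by omega)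

theorem IsLabel.swap {e : Fin (n + 1) → ℤ × ℤ} (he : IsLabel μ e) {k : Fin n}
    (h : SpecGT (e k.succ) (e k.castSucc) ∨ SpecGT (e k.castSucc) (e k.succ)) :
    IsLabel μ (e ∘ Equiv.swap k.castSucc k.succ) := by
  obtain ⟨v, T, rfl⟩ := he
  by_cases hv : v k.castSucc = v k.succ
  · obtain ⟨U, hU⟩ := exists_isSwap_rank hv h
    exact ⟨v, U, (label_isSwap hv hU).symm⟩
  · exact ⟨_, T, (label_comp_swap T hv).symm⟩

theorem IsLabel.affine {e : Fin (n + 1) → ℤ × ℤ} (he : IsLabel μ e) : IsLabel μ (affineL e) := by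
  obtain ⟨v, T, rfl⟩ := he
  exact ⟨_, T, (label_affineV v T).symm⟩

theorem IsLabel.exists_affineL {e : Fin (n + 1) → ℤ × ℤ} (he : IsLabel μ e)
    (h : 0 < (e (Fin.last n)).1) : ∃ e', IsLabel μ e' ∧ affineL e' = e := by
  obtain ⟨v, T, rfl⟩ := he
  have h : 0 < v (Fin.last n) := by simpa [label] using h
  refine ⟨_, ⟨Fin.cons (v (Fin.last n) - 1) fun i => v i.castSucc, T, rfl⟩, ?_⟩
  rw [← label_affineV]
  congr 1
  funext i
  refine Fin.lastCases ?_ (fun i => ?_) i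
  · rw [affineV_last, Fin.cons_zero]; omega
  · rw [affineV_castSucc, Fin.cons_succ]

/-- A vertex of the graph without incoming arrows is the root. -/
theorem IsLabel.eq_root {e : Fin (n + 1) → ℤ × ℤ} (he : IsLabel μ e)
    (h1 : ∀ k : Fin n, ¬ SpecGT (e k.castSucc) (e k.succ)) (h2 : (e (Fin.last n)).1 ≤ 0) :
    ∃ T : RST n μ, T.IsRoot ∧ e = label 0 T := by
  obtain ⟨v, T, rfl⟩ := he
  have hmono : Monotone v := Fin.monotone_iff_le_succ.mpr fun k => by
    have := h1 k
    simp only [SpecGT, label] at this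
    omega
  have hv : v = 0 := funext fun i => by
    have := hmono (Fin.le_last i)
    have h2 : v (Fin.last n) = 0 := by simpa [label] using h2
    simp only [Pi.zero_apply]
    omega
  subst hv
  refine ⟨T, isRoot_of_not_ct fun i hi => h1 i (Or.inr ⟨rfl, ?_⟩), rfl⟩
  simp only [label, sExp, rank_zero]
  omega

theorem IsRoot.not_specGT {T : RST n μ} (hT : T.IsRoot) (k : Fin n) :
    ¬ SpecGT (label 0 T k.castSucc) (label 0 T k.succ) := by
  rintro (h | ⟨-, h⟩)
  · simp [label] at h
  · simp only [label, sExp, rank_zero] at h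
    exact hT.not_ct (k := k.castSucc) (l := k.succ) (by simp) (by omega)

/-! ### Induction on labels -/

open Classical in
/-- The number of pairs in decreasing position. -/
noncomputable def inversions (e : Fin (n + 1) → ℤ × ℤ) : ℕ :=
  Multiplicative.toAdd
    (pairProd (fun a b => Multiplicative.ofAdd (if SpecGT a b then 1 else 0)) e)

theorem inversions_swap {e : Fin (n + 1) → ℤ × ℤ} {k : Fin n}
    (h : SpecGT (e k.castSucc) (e k.succ)) :
    inversions (e ∘ Equiv.swap k.castSucc k.succ) + 1 = inversions e := by
  classical
  have := congrArg Multiplicative.toAdd (pairProd_swap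
    (fun a b => Multiplicative.ofAdd (if SpecGT a b then 1 else 0)) e k)
  simpa only [inversions, h, h.asymm, if_true, if_false, ofAdd_zero, mul_one, toAdd_mul,
    toAdd_ofAdd] using this

/-- The measure that increases along the arrows of the graph. -/
noncomputable def height (e : Fin (n + 1) → ℤ × ℤ) : ℕ ×ₗ ℕ :=
  toLex ((∑ i, (e i).1).toNat, inversions e)

theorem height_swap {e : Fin (n + 1) → ℤ × ℤ} {k : Fin n}
    (h : SpecGT (e k.castSucc) (e k.succ)) :
    height (e ∘ Equiv.swap k.castSucc k.succ) < height e := by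
  have e1 : ∑ i, ((e ∘ Equiv.swap k.castSucc k.succ) i).1 = ∑ i, (e i).1 :=
    Equiv.sum_comp (Equiv.swap k.castSucc k.succ) fun i => (e i).1
  rw [height, e1, height, Prod.Lex.toLex_lt_toLex]
  exact Or.inr ⟨rfl, by have := inversions_swap h; omega⟩

theorem sum_affineL (e : Fin (n + 1) → ℤ × ℤ) : ∑ i, (affineL e i).1 = ∑ i, (e i).1 + 1 := by
  rw [Fin.sum_univ_castSucc, Fin.sum_univ_succ]
  simp
  ring

theorem height_lt_affineL {e : Fin (n + 1) → ℤ × ℤ} (he : IsLabel μ e) :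
    height e < height (affineL e) := by
  have : 0 ≤ ∑ i, (e i).1 := Finset.sum_nonneg fun i _ => he.nonneg i
  rw [height, height, sum_affineL, Prod.Lex.toLex_lt_toLex]
  exact Or.inl (by simp only; omega)

end Labels

/-! ### The Yang–Baxter relation -/

section YangBaxter

variable {K R : Type*} [Field K] [Ring R] [Algebra K R] {q s : K} {n : ℕ} {T T' X : ℕ → R} {w : R}

theorem IsDoubleHecke.yang_baxter (h : IsDoubleHecke q s n T T' X w) {i : ℕ} (hi : i + 1 < n)
    {a b c : K} (habc : b * (s - 1) + a * b + b * c = a * c) :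
    (T i + a • (1 : R)) * (T (i + 1) + b • (1 : R)) * (T i + c • (1 : R))
      = (T (i + 1) + c • (1 : R)) * (T i + b • (1 : R)) * (T (i + 1) + a • (1 : R)) := by
  have e1 : (T i + a • (1 : R)) * (T (i + 1) + b • (1 : R)) * (T i + c • (1 : R))
      = T i * T (i + 1) * T i + c • (T i * T (i + 1)) + a • (T (i + 1) * T i) + b • (T i * T i)
        + (a * b + b * c) • T i + (a * c) • T (i + 1) + (a * b * c) • (1 : R) := by
    simp only [mul_add, add_mul, smul_mul_assoc, mul_smul_comm, mul_one, one_mul]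
    module
  have e2 : (T (i + 1) + c • (1 : R)) * (T i + b • (1 : R)) * (T (i + 1) + a • (1 : R))
      = T (i + 1) * T i * T (i + 1) + c • (T i * T (i + 1)) + a • (T (i + 1) * T i)
        + b • (T (i + 1) * T (i + 1)) + (a * b + b * c) • T (i + 1) + (a * c) • T i
        + (a * b * c) • (1 : R) := by
    simp only [mul_add, add_mul, smul_mul_assoc, mul_smul_comm, mul_one, one_mul]
    module
  rw [e1, e2, h.isBraid.braid i hi, h.quad i (by omega), h.quad (i + 1) hi, ← habc]
  module

end YangBaxter

/-! ### The Yang–Baxter graph on labels -/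

section Graph

variable {K : Type*} [Field K] {n : ℕ} {μ : YoungDiagram} {q s : K}

/-- The entry `q^a s^m` of the spectral vector with exponents `(a, m)`. -/
def weight (q s : K) (a : ℤ × ℤ) : K := q ^ a.1 * s ^ a.2

theorem zeta_eq (q s : K) (v : Fin (n + 1) → ℕ) (T : RST n μ) (i : Fin (n + 1)) :
    zeta q s v T i = weight q s (label v T i) := by
  simp [zeta, weight, label]

theorem Generic.weight_ne_zero (h : Generic q s) (a : ℤ × ℤ) : weight q s a ≠ 0 :=
  mul_ne_zero (zpow_ne_zero _ h.q_ne) (zpow_ne_zero _ h.s_ne)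

theorem Generic.weight_add (h : Generic q s) (a b : ℤ × ℤ) :
    weight q s (a + b) = weight q s a * weight q s b := by
  simp only [weight, Prod.fst_add, Prod.snd_add, zpow_add₀ h.q_ne, zpow_add₀ h.s_ne]
  ring

theorem Generic.weight_injective (h : Generic q s) : Function.Injective (weight q s) := by
  intro a b e
  have h1 : weight q s (a - b) * weight q s b = weight q s b := by
    rw [← h.weight_add, sub_add_cancel, e]
  have h2 := h.eq_zero _ _ (mul_eq_right₀ (h.weight_ne_zero b) |>.mp h1)
  simp only [Prod.fst_sub, Prod.snd_sub] at h2
  exact Prod.ext (by omega) (by omega)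

/-- The scalar in the intertwiner `𝐓_i + (1 - s) / (1 - ζ[i+1] / ζ[i])`, in terms of the exponents
`a`, `b` of `ζ[i]`, `ζ[i+1]`. -/
def stepCoeff (q s : K) (a b : ℤ × ℤ) : K := (1 - s) / (1 - weight q s b / weight q s a)

theorem Generic.stepCoeff_mul (h : Generic q s) {a b : ℤ × ℤ} (hab : a ≠ b) :
    stepCoeff q s a b * (weight q s a - weight q s b) = (1 - s) * weight q s a := by
  have h1 := h.weight_ne_zero a
  have h2 : weight q s a - weight q s b ≠ 0 := sub_ne_zero.mpr (h.weight_injective.ne hab)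
  have h3 : 1 - weight q s b / weight q s a = (weight q s a - weight q s b) / weight q s a := by
    field_simp
  rw [stepCoeff, h3]
  field_simp

theorem Generic.stepCoeff_add (h : Generic q s) (a b c : ℤ × ℤ) :
    stepCoeff q s (a + c) (b + c) = stepCoeff q s a b := by
  rw [stepCoeff, h.weight_add, h.weight_add, mul_div_mul_right _ _ (h.weight_ne_zero c)]
  rfl

theorem Generic.stepCoeff_yang_baxter (h : Generic q s) {x y z : ℤ × ℤ} (hxy : x ≠ y) (hxz : x ≠ z)
    (hyz : y ≠ z) : stepCoeff q s x z * (s - 1) + stepCoeff q s x y * stepCoeff q s x z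
      + stepCoeff q s x z * stepCoeff q s y z = stepCoeff q s x y * stepCoeff q s y z := by
  have e1 := h.stepCoeff_mul hxy
  have e2 := h.stepCoeff_mul hxz
  have e3 := h.stepCoeff_mul hyz
  have h1 : weight q s x - weight q s y ≠ 0 := sub_ne_zero.mpr (h.weight_injective.ne hxy)
  have h2 : weight q s x - weight q s z ≠ 0 := sub_ne_zero.mpr (h.weight_injective.ne hxz)
  have h3 : weight q s y - weight q s z ≠ 0 := sub_ne_zero.mpr (h.weight_injective.ne hyz)
  rw [← eq_div_iff h1] at e1
  rw [← eq_div_iff h2] at e2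
  rw [← eq_div_iff h3] at e3
  rw [e1, e2, e3]
  field_simp
  ring

/-- The intertwiner `𝐓_k + c` as an operator acting on the right. -/
noncomputable def rStep (μ : YoungDiagram) (n : ℕ) (s c : K) (k : ℕ) : ROp K n μ :=
  rT μ n s k + c • 1

/-- The raising operator as an operator acting on the right. -/
noncomputable def rRaise (μ : YoungDiagram) (n : ℕ) (s : K) : ROp K n μ :=
  IsDoubleHecke.raise n (rT' μ n s) (rX K μ n)

theorem op_raising (s : K) : op (raising s : Module.End K (VPoly K n μ)) = rRaise μ n s := by
  rw [raising, opSeq_eq, List.map_append, List.prod_append, List.map_map, rRaise,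
    IsDoubleHecke.raise, ← map_finRange_prod (f := op ∘ fun i => boldTinv s i) (rT'_val s), rX_last]
  simp

/-- `IsSpectral q s e P`: the polynomial `P` is obtained along a path from the root to the vertex
with label `e`. On labels, the arrows of the graph that exchange entries of `v` and those that exchange
entries of the tableau become the same: an exchange of adjacent labels. -/
inductive IsSpectral (q s : K) : (Fin (n + 1) → ℤ × ℤ) → VPoly K n μ → Prop
  | root (T : RST n μ) (hT : T.IsRoot) : IsSpectral q s (label 0 T) (tens 1 T)
  | swap (e : Fin (n + 1) → ℤ × ℤ) (P : VPoly K n μ) (k : Fin n)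
      (hP : IsSpectral q s (e ∘ Equiv.swap k.castSucc k.succ) P)
      (h : SpecGT (e k.castSucc) (e k.succ)) :
      IsSpectral q s e ((rStep μ n s (stepCoeff q s (e k.succ) (e k.castSucc)) k).unop P)
  | affine (e : Fin (n + 1) → ℤ × ℤ) (P : VPoly K n μ) (hP : IsSpectral q s e P) :
      IsSpectral q s (affineL e) ((rRaise μ n s).unop P)

theorem comp_swap_swap {α : Type*} (e : Fin (n + 1) → α) (i j : Fin (n + 1)) :
    (e ∘ Equiv.swap i j) ∘ Equiv.swap i j = e :=
  funext fun x => by simp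

theorem IsSpectral.isLabel {e : Fin (n + 1) → ℤ × ℤ} {P : VPoly K n μ}
    (h : IsSpectral q s e P) : IsLabel μ e := by
  induction h with
  | root T hT => exact ⟨0, T, rfl⟩
  | swap e P k hP h ih =>
    have := ih.swap (k := k) (Or.inl (by simpa using h))
    rwa [comp_swap_swap] at this
  | affine e P hP ih => exact ih.affine

theorem rStep_apply (c : K) (k : Fin n) (P : VPoly K n μ) :
    (rStep μ n s c k).unop P = boldT s k P + c • P := by
  rw [rStep, rT_val]
  rfl

theorem IsMacdonald.isSpectral {T : RST n μ} {v : Fin (n + 1) → ℕ} {P : VPoly K n μ}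
    (h : IsMacdonald q s T v P) : IsSpectral q s (label v T) P := by
  have key : ∀ (v : Fin (n + 1) → ℕ) (T : RST n μ) (k : Fin n) (P : VPoly K n μ)
      (e : Fin (n + 1) → ℤ × ℤ), IsSpectral q s (label v T) P →
      e = label v T ∘ Equiv.swap k.castSucc k.succ →
      SpecGT (label v T k.succ) (label v T k.castSucc) →
      IsSpectral q s e (stepPoly q s v T k P) := by
    intro v T k P e hP he hgt
    have := IsSpectral.swap e P k (by rwa [he, comp_swap_swap]) (by simpa [he] using hgt)
    rw [rStep_apply] at this
    simpa [he, stepPoly, stepCoeff, zeta_eq] using this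
  induction h with
  | root T hT => exact .root T hT
  | step T v P k hP hv ih =>
    refine key v T k P _ ih (label_comp_swap T hv.ne) (Or.inl ?_)
    simpa [label] using hv
  | jump T U v P k hP hv hU hct ih =>
    refine key v T k P _ ih (label_isSwap hv hU) (Or.inr ⟨by simp [label, hv], ?_⟩)
    simp only [label, sExp]
    omega
  | affine T v P hP ih =>
    rw [label_affineV, ← unop_op (raising s), op_raising]
    exact .affine _ _ ih

theorem IsSpectral.exists_isMacdonald {e : Fin (n + 1) → ℤ × ℤ} {P : VPoly K n μ}
    (h : IsSpectral q s e P) : ∃ v T, e = label v T ∧ IsMacdonald q s T v P := by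
  induction h with
  | root T hT => exact ⟨0, T, rfl, .root T hT⟩
  | swap e P k hP h ih =>
    obtain ⟨v, T, he, hM⟩ := ih
    have he' : e = label v T ∘ Equiv.swap k.castSucc k.succ := by rw [← he, comp_swap_swap]
    have hgt : SpecGT (label v T k.succ) (label v T k.castSucc) := by simpa [he'] using h
    have hpoly : (rStep μ n s (stepCoeff q s (e k.succ) (e k.castSucc)) k).unop P
        = stepPoly q s v T k P := by
      rw [rStep_apply]
      simp [he', stepPoly, stepCoeff, zeta_eq]
    rw [hpoly]
    by_cases hv : v k.castSucc = v k.succ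
    · obtain ⟨U, hU⟩ := exists_isSwap_rank hv (Or.inl hgt)
      refine ⟨v, U, he'.trans (label_isSwap hv hU).symm, .jump T U v P k hM hv hU ?_⟩
      simp only [SpecGT, label, hv, lt_self_iff_false, false_or, true_and, sExp] at hgt
      omega
    · refine ⟨_, T, he'.trans (label_comp_swap T hv).symm, .step T v P k hM ?_⟩
      simp only [SpecGT, label] at hgt
      omega
  | affine e P hP ih =>
    obtain ⟨v, T, rfl, hM⟩ := ih
    refine ⟨_, T, (label_affineV v T).symm, ?_⟩
    rw [← op_raising, unop_op]
    exact .affine T v P hM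

theorem isSpectral_iff {T : RST n μ} {v : Fin (n + 1) → ℕ} {P : VPoly K n μ} :
    IsSpectral q s (label v T) P ↔ IsMacdonald q s T v P := by
  refine ⟨fun h => ?_, IsMacdonald.isSpectral⟩
  obtain ⟨w, U, he, hM⟩ := h.exists_isMacdonald
  obtain ⟨rfl, rfl⟩ := label_injective he
  exact hM

/-- Every vertex is reached from the root. -/
theorem IsLabel.exists_isSpectral (q s : K) {e : Fin (n + 1) → ℤ × ℤ} (he : IsLabel μ e) :
    ∃ P : VPoly K n μ, IsSpectral q s e P := by
  induction hh : height e using WellFoundedLT.induction generalizing e with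
  | ind h ih =>
    subst hh
    by_cases h1 : ∃ k : Fin n, SpecGT (e k.castSucc) (e k.succ)
    · obtain ⟨k, hk⟩ := h1
      obtain ⟨P, hP⟩ := ih _ (height_swap hk) (he.swap (Or.inr hk)) rfl
      exact ⟨_, .swap e P k hP hk⟩
    by_cases h2 : 0 < (e (Fin.last n)).1
    · obtain ⟨e', he', rfl⟩ := he.exists_affineL h2
      obtain ⟨P, hP⟩ := ih _ (height_lt_affineL he') he' rfl
      exact ⟨_, .affine e' P hP⟩
    · obtain ⟨T, hT, rfl⟩ := he.eq_root (not_exists.mp h1) (not_lt.mp h2)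
      exact ⟨_, .root T hT⟩

/-! #### Local confluence -/

theorem comp_swap_apply_of_lt {e : Fin (n + 1) → ℤ × ℤ} {i : Fin n} {a : Fin (n + 1)}
    (h : (a : ℕ) < i ∨ (i : ℕ) + 1 < a) : (e ∘ Equiv.swap i.castSucc i.succ) a = e a := by
  rw [Function.comp_apply, Equiv.swap_apply_of_ne_of_ne]
  · rintro rfl
    simp at h
  · rintro rfl
    simp at h

/-- Exchanges at distant positions commute. -/
theorem diamond_far (h : Generic q s) {e : Fin (n + 1) → ℤ × ℤ} (he : IsLabel μ e) {i j : Fin n}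
    (hij : (i : ℕ) + 1 < j) (hi : SpecGT (e i.castSucc) (e i.succ))
    (hj : SpecGT (e j.castSucc) (e j.succ)) :
    ∃ P Q : VPoly K n μ, IsSpectral q s (e ∘ Equiv.swap i.castSucc i.succ) P ∧
      IsSpectral q s (e ∘ Equiv.swap j.castSucc j.succ) Q ∧
      (rStep μ n s (stepCoeff q s (e i.succ) (e i.castSucc)) i).unop P
        = (rStep μ n s (stepCoeff q s (e j.succ) (e j.castSucc)) j).unop Q := by
  have a1 := comp_swap_apply_of_lt (e := e) (i := i) (a := j.castSucc) (Or.inr (by simpa using hij))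
  have a2 := comp_swap_apply_of_lt (e := e) (i := i) (a := j.succ) (Or.inr (by simp; omega))
  have a3 := comp_swap_apply_of_lt (e := e) (i := j) (a := i.castSucc) (Or.inl (by simp; omega))
  have a4 := comp_swap_apply_of_lt (e := e) (i := j) (a := i.succ) (Or.inl (by simpa using hij))
  have hcomm : (e ∘ Equiv.swap i.castSucc i.succ) ∘ Equiv.swap j.castSucc j.succ
      = (e ∘ Equiv.swap j.castSucc j.succ) ∘ Equiv.swap i.castSucc i.succ := comp_swap_far e hij
  have hj' : SpecGT ((e ∘ Equiv.swap i.castSucc i.succ) j.castSucc)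
      ((e ∘ Equiv.swap i.castSucc i.succ) j.succ) := by rwa [a1, a2]
  have hi' : SpecGT ((e ∘ Equiv.swap j.castSucc j.succ) i.castSucc)
      ((e ∘ Equiv.swap j.castSucc j.succ) i.succ) := by rwa [a3, a4]
  obtain ⟨R, hR⟩ := ((he.swap (Or.inr hi)).swap (Or.inr hj')).exists_isSpectral q s
  have hP := IsSpectral.swap _ R j hR hj'
  have hQ := IsSpectral.swap _ R i (hcomm ▸ hR) hi'
  rw [a1, a2] at hP
  rw [a3, a4] at hQ
  refine ⟨_, _, hP, hQ, ?_⟩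
  rw [← Module.End.mul_apply, ← Module.End.mul_apply, ← unop_mul, ← unop_mul]
  congr 2
  have hc : Commute (rT μ n s i) (rT μ n s j) := h.isDoubleHecke.isBraid.far _ _ hij j.2
  exact ((hc.add_right ((Commute.one_right _).smul_right _)).add_left
    (((Commute.one_left _).smul_left _))).symm.eq

/-- The Yang–Baxter hexagon. -/
theorem diamond_adjacent (h : Generic q s) {e : Fin (n + 1) → ℤ × ℤ} (he : IsLabel μ e)
    {i j : Fin n} (hij : (i : ℕ) + 1 = j) (hi : SpecGT (e i.castSucc) (e i.succ))
    (hj : SpecGT (e j.castSucc) (e j.succ)) :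
    ∃ P Q : VPoly K n μ, IsSpectral q s (e ∘ Equiv.swap i.castSucc i.succ) P ∧
      IsSpectral q s (e ∘ Equiv.swap j.castSucc j.succ) Q ∧
      (rStep μ n s (stepCoeff q s (e i.succ) (e i.castSucc)) i).unop P
        = (rStep μ n s (stepCoeff q s (e j.succ) (e j.castSucc)) j).unop Q := by
  have hc : j.castSucc = i.succ := castSucc_eq_succ hij
  obtain ⟨y, hy⟩ : ∃ y, e i.succ = y := ⟨_, rfl⟩
  obtain ⟨z, hz⟩ : ∃ z, e i.castSucc = z := ⟨_, rfl⟩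
  obtain ⟨x, hx⟩ : ∃ x, e j.succ = x := ⟨_, rfl⟩
  rw [hc] at hj ⊢
  rw [hz, hy] at hi
  rw [hy, hx] at hj
  rw [hx, hy, hz]
  have n1 : i.castSucc ≠ i.succ := by simp [Fin.ext_iff]
  have n2 : i.castSucc ≠ j.succ := by simp [Fin.ext_iff]; omega
  have n3 : i.succ ≠ j.succ := by simp [Fin.ext_iff]; omega
  set σ := Equiv.swap i.castSucc i.succ with hσ
  set τ := Equiv.swap i.succ j.succ with hτ
  have s1 : σ i.castSucc = i.succ := Equiv.swap_apply_left _ _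
  have s2 : σ i.succ = i.castSucc := Equiv.swap_apply_right _ _
  have s3 : σ j.succ = j.succ := Equiv.swap_apply_of_ne_of_ne n2.symm n3.symm
  have t1 : τ i.castSucc = i.castSucc := Equiv.swap_apply_of_ne_of_ne n1 n2
  have t2 : τ i.succ = j.succ := Equiv.swap_apply_left _ _
  have t3 : τ j.succ = i.succ := Equiv.swap_apply_right _ _
  have hbraid : ((e ∘ σ) ∘ τ) ∘ σ = ((e ∘ τ) ∘ σ) ∘ τ := by
    have := comp_swap_braid e hij
    rwa [hc] at this
  -- the labels `z ≻ y ≻ x` at the three positions are permuted in all six ways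
  have hA1 := he.swap (k := i) (Or.inr (by rwa [hz, hy]))
  have hA2 := hA1.swap (k := j) (Or.inr (by
    rw [hc]; simp only [← hσ, Function.comp_apply, s2, s3, hz, hx]; exact hi.trans hj))
  have hA3 := hA2.swap (k := i) (Or.inr (by
    rw [hc]; simp only [← hσ, ← hτ, Function.comp_apply, s1, s3, t1, t2, hy, hx]; exact hj))
  rw [hc, ← hσ, ← hτ] at hA3
  obtain ⟨R, hR⟩ := hA3.exists_isSpectral q s
  have hP1 := IsSpectral.swap ((e ∘ σ) ∘ τ) R i hR (by
    simp only [Function.comp_apply, s1, s3, t1, t2, hy, hx]; exact hj)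
  have hP2 := IsSpectral.swap (e ∘ σ) _ j (by rw [hc]; exact hP1) (by
    rw [hc]; simp only [Function.comp_apply, s2, s3, hz, hx]; exact hi.trans hj)
  rw [hbraid] at hR
  have hQ1 := IsSpectral.swap ((e ∘ τ) ∘ σ) R j (by rw [hc]; exact hR) (by
    rw [hc]; simp only [Function.comp_apply, s2, s3, t1, t3, hz, hy]; exact hi)
  have hQ2 := IsSpectral.swap (e ∘ τ) _ i hQ1 (by
    simp only [Function.comp_apply, t1, t2, hz, hx]; exact hi.trans hj)
  simp only [hc, Function.comp_apply, s1, s2, s3, t1, t2, t3, hx, hy, hz] at hP2 hQ2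
  refine ⟨_, _, hP2, hQ2, ?_⟩
  simp only [← Module.End.mul_apply, ← unop_mul]
  congr 2
  rw [← hij]
  exact h.isDoubleHecke.yang_baxter (by omega) (h.stepCoeff_yang_baxter hj.ne.symm
    (hi.trans hj).ne.symm hi.ne.symm)

/-- An exchange that does not involve the last position commutes with the affine arrows, up to a
shift of the position. -/
theorem diamond_affine (h : Generic q s) {e : Fin (n + 1) → ℤ × ℤ} (he : IsLabel μ e) {i j : Fin n}
    (hij : (i : ℕ) + 1 = j) (hi : SpecGT (affineL e i.castSucc) (affineL e i.succ)) :
    ∃ P Q : VPoly K n μ, IsSpectral q s (affineL e ∘ Equiv.swap i.castSucc i.succ) P ∧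
      IsSpectral q s e Q ∧
      (rStep μ n s (stepCoeff q s (affineL e i.succ) (affineL e i.castSucc)) i).unop P
        = (rRaise μ n s).unop Q := by
  have hc : j.castSucc = i.succ := castSucc_eq_succ hij
  rw [← hc, affineL_castSucc, affineL_castSucc, ← hc] at hi ⊢
  obtain ⟨R, hR⟩ := (he.swap (Or.inr hi)).exists_isSpectral q s
  have hP := IsSpectral.affine _ R hR
  have hQ := IsSpectral.swap e R j hR hi
  have haff : affineL (e ∘ Equiv.swap j.castSucc j.succ)
      = affineL e ∘ Equiv.swap i.castSucc j.castSucc := by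
    have n0 : (0 : Fin (n + 1)) ≠ j.castSucc := by simp [Fin.ext_iff]; omega
    have n1 : (0 : Fin (n + 1)) ≠ j.succ := by simp [Fin.ext_iff]
    funext a
    refine Fin.lastCases ?_ (fun a => ?_) a
    · rw [affineL_last, Function.comp_apply, Function.comp_apply,
        Equiv.swap_apply_of_ne_of_ne n0 n1, Equiv.swap_apply_of_ne_of_ne, affineL_last]
      · simp [Fin.ext_iff]; omega
      · simp [Fin.ext_iff]; omega
    · have e1 : Equiv.swap i.castSucc j.castSucc a.castSucc = (Equiv.swap i j a).castSucc := by
        rw [(Fin.castSucc_injective n).swap_apply]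
      have e2 : Equiv.swap i.succ j.succ a.succ = (Equiv.swap i j a).succ := by
        rw [(Fin.succ_injective n).swap_apply]
      rw [affineL_castSucc, Function.comp_apply, Function.comp_apply, e1, affineL_castSucc, hc, e2]
  rw [haff] at hP
  refine ⟨_, _, hP, hQ, ?_⟩
  simp only [← Module.End.mul_apply, ← unop_mul]
  congr 2
  have := h.isDoubleHecke (n := n) (μ := μ) |>.T_raise (i := i) (by omega)
  rw [rStep, rStep, mul_add, add_mul, rRaise, ← hij, this, mul_smul_comm, smul_mul_assoc, mul_one,
    one_mul]

/-- An exchange at the last position commutes with the square of the affine arrows. -/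
theorem diamond_affine_last (h : Generic q s) {e : Fin (n + 1) → ℤ × ℤ} (he : IsLabel μ e)
    {i : Fin n} (hin : (i : ℕ) + 1 = n)
    (hi : SpecGT (affineL e i.castSucc) (affineL e i.succ)) :
    ∃ P Q : VPoly K n μ, IsSpectral q s (affineL e ∘ Equiv.swap i.castSucc i.succ) P ∧
      IsSpectral q s e Q ∧
      (rStep μ n s (stepCoeff q s (affineL e i.succ) (affineL e i.castSucc)) i).unop P
        = (rRaise μ n s).unop Q := by
  obtain ⟨m, rfl⟩ : ∃ m, n = m + 1 := ⟨n - 1, by omega⟩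
  obtain rfl : i = Fin.last m := Fin.ext (by simpa using hin)
  rw [Fin.succ_last, affineL_last, affineL_castSucc, Fin.succ_last] at hi ⊢
  have h0 := he.nonneg 0
  have hlast : 0 < (e (Fin.last (m + 1))).1 := by
    have : SpecGT (e (Fin.last (m + 1))) (e 0 + (1, 0)) := hi
    simp only [SpecGT, Prod.fst_add] at this
    omega
  obtain ⟨f, hf, rfl⟩ := he.exists_affineL hlast
  have e0 : affineL f 0 = f (Fin.succ 0) := affineL_castSucc f 0
  rw [affineL_last, e0] at hi ⊢
  rw [h.stepCoeff_add]
  have hf1 : SpecGT (f (Fin.castSucc 0)) (f (Fin.succ 0)) := by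
    simp only [SpecGT, Prod.fst_add, Prod.snd_add, Fin.castSucc_zero] at hi ⊢
    omega
  obtain ⟨R, hR⟩ := (hf.swap (k := 0) (Or.inr hf1)).exists_isSpectral q s
  have hP := IsSpectral.affine _ _ (IsSpectral.affine _ R hR)
  have hQ := IsSpectral.affine _ _ (IsSpectral.swap f R 0 hR hf1)
  have haff : affineL (affineL (f ∘ Equiv.swap (Fin.castSucc 0) (Fin.succ 0)))
      = affineL (affineL f) ∘ Equiv.swap (Fin.last m).castSucc (Fin.last (m + 1)) := by
    have e2 : ∀ g : Fin (m + 1 + 1) → ℤ × ℤ, affineL g 0 = g (Fin.succ 0) := fun g =>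
      affineL_castSucc g 0
    have e3 : Equiv.swap (Fin.castSucc 0) (Fin.succ 0) (0 : Fin (m + 1 + 1)) = Fin.succ 0 :=
      Equiv.swap_apply_left _ _
    funext a
    refine Fin.lastCases ?_ (fun a => Fin.lastCases ?_ (fun a => ?_) a) a
    · rw [affineL_last, Function.comp_apply, Equiv.swap_apply_right, affineL_castSucc,
        Fin.succ_last, affineL_last, e2, Function.comp_apply, Equiv.swap_apply_right]
      rfl
    · rw [affineL_castSucc, Function.comp_apply, Equiv.swap_apply_left, Fin.succ_last,
        affineL_last, affineL_last, e2, Function.comp_apply, e3]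
    · rw [affineL_castSucc, Function.comp_apply, Equiv.swap_apply_of_ne_of_ne, affineL_castSucc,
        ← Fin.castSucc_succ, affineL_castSucc, affineL_castSucc, Function.comp_apply,
        Equiv.swap_apply_of_ne_of_ne]
      all_goals simp [Fin.ext_iff]
      all_goals omega
  rw [haff] at hP
  refine ⟨_, _, hP, hQ, ?_⟩
  simp only [← Module.End.mul_apply, ← unop_mul]
  congr 2
  have := h.isDoubleHecke (n := m + 1) (μ := μ) |>.T_raise_raise
  rw [rStep, rStep, Fin.val_zero, Fin.val_last, mul_add, add_mul, add_mul, mul_assoc (rT _ _ _ _),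
    rRaise, this]
  simp only [mul_smul_comm, smul_mul_assoc, mul_one, one_mul, Fin.castSucc_zero]

/-- The polynomial does not depend on the path: any two arrows into a vertex start at vertices that
have a common predecessor. -/
theorem IsSpectral.unique (h : Generic q s) {e : Fin (n + 1) → ℤ × ℤ} {P Q : VPoly K n μ}
    (hP : IsSpectral q s e P) (hQ : IsSpectral q s e Q) : P = Q := by
  have inv : ∀ {e : Fin (n + 1) → ℤ × ℤ} {P : VPoly K n μ}, IsSpectral q s e P →
      (∃ T : RST n μ, T.IsRoot ∧ e = label 0 T ∧ P = tens 1 T) ∨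
      (∃ (k : Fin n) (P' : VPoly K n μ),
        IsSpectral q s (e ∘ Equiv.swap k.castSucc k.succ) P' ∧
        SpecGT (e k.castSucc) (e k.succ) ∧
        P = (rStep μ n s (stepCoeff q s (e k.succ) (e k.castSucc)) k).unop P') ∨
      (∃ (e' : Fin (n + 1) → ℤ × ℤ) (P' : VPoly K n μ), IsSpectral q s e' P' ∧ e = affineL e' ∧
        P = (rRaise μ n s).unop P') := by
    intro e P hP
    cases hP with
    | root T hT => exact Or.inl ⟨T, hT, rfl, rfl⟩
    | swap _ P k hP h => exact Or.inr (Or.inl ⟨k, P, hP, h, rfl⟩)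
    | affine e P hP => exact Or.inr (Or.inr ⟨e, P, hP, rfl, rfl⟩)
  induction hh : height e using WellFoundedLT.induction generalizing e P Q with
  | ind _ ih =>
    subst hh
    replace ih : ∀ {f : Fin (n + 1) → ℤ × ℤ} {P Q : VPoly K n μ}, height f < height e →
        IsSpectral q s f P → IsSpectral q s f Q → P = Q := fun hf h1 h2 => ih _ hf h1 h2 rfl
    have he := hP.isLabel
    -- two exchanges
    have hSS : ∀ (i j : Fin n) (P Q : VPoly K n μ), i < j →
        IsSpectral q s (e ∘ Equiv.swap i.castSucc i.succ) P → SpecGT (e i.castSucc) (e i.succ) →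
        IsSpectral q s (e ∘ Equiv.swap j.castSucc j.succ) Q → SpecGT (e j.castSucc) (e j.succ) →
        (rStep μ n s (stepCoeff q s (e i.succ) (e i.castSucc)) i).unop P
          = (rStep μ n s (stepCoeff q s (e j.succ) (e j.castSucc)) j).unop Q := by
      intro i j P Q hij hP hi hQ hj
      obtain ⟨P', Q', hP', hQ', heq⟩ : ∃ P Q : VPoly K n μ,
          IsSpectral q s (e ∘ Equiv.swap i.castSucc i.succ) P ∧
          IsSpectral q s (e ∘ Equiv.swap j.castSucc j.succ) Q ∧
          (rStep μ n s (stepCoeff q s (e i.succ) (e i.castSucc)) i).unop P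
            = (rStep μ n s (stepCoeff q s (e j.succ) (e j.castSucc)) j).unop Q := by
        rcases (Nat.succ_le_of_lt hij).eq_or_lt with h' | h'
        · exact diamond_adjacent h he h' hi hj
        · exact diamond_far h he h' hi hj
      rw [ih (height_swap hi) hP hP', ih (height_swap hj) hQ hQ', heq]
    -- an exchange and an affine arrow
    have hSA : ∀ (i : Fin n) (f : Fin (n + 1) → ℤ × ℤ) (P Q : VPoly K n μ),
        IsSpectral q s (e ∘ Equiv.swap i.castSucc i.succ) P → SpecGT (e i.castSucc) (e i.succ) →
        IsSpectral q s f Q → e = affineL f →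
        (rStep μ n s (stepCoeff q s (e i.succ) (e i.castSucc)) i).unop P
          = (rRaise μ n s).unop Q := by
      rintro i f P₁ Q₁ hS hi hA rfl
      obtain ⟨P', Q', hP', hQ', heq⟩ : ∃ P Q : VPoly K n μ,
          IsSpectral q s (affineL f ∘ Equiv.swap i.castSucc i.succ) P ∧ IsSpectral q s f Q ∧
          (rStep μ n s (stepCoeff q s (affineL f i.succ) (affineL f i.castSucc)) i).unop P
            = (rRaise μ n s).unop Q := by
        by_cases hn : (i : ℕ) + 1 = n
        · exact diamond_affine_last h hA.isLabel hn hi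
        · exact diamond_affine h hA.isLabel (j := ⟨i + 1, by omega⟩) rfl hi
      rw [ih (height_swap hi) hS hP', ih (height_lt_affineL hA.isLabel) hA hQ', heq]
    have hR : ∀ (T : RST n μ), T.IsRoot → e = label 0 T → ∀ f : Fin (n + 1) → ℤ × ℤ,
        IsLabel μ f → e ≠ affineL f := by
      rintro T - rfl f hf e
      have h1 := congrArg Prod.fst (congrFun e (Fin.last n))
      have h2 := hf.nonneg 0
      simp only [affineL_last, label, Prod.fst_add, Pi.zero_apply, Nat.cast_zero] at h1
      omega
    rcases inv hP with ⟨T, hT, heT, rfl⟩ | ⟨i, P, hP', hi, rfl⟩ | ⟨f, P, hP', hf, rfl⟩ <;>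
      rcases inv hQ with ⟨U, hU, heU, rfl⟩ | ⟨j, Q, hQ', hj, rfl⟩ | ⟨g, Q, hQ', hg, rfl⟩
    · rw [(label_injective (heT.symm.trans heU)).2]
    · exact absurd hj (heT ▸ IsRoot.not_specGT hT j)
    · exact absurd hg (hR T hT heT g hQ'.isLabel)
    · exact absurd hi (heU ▸ IsRoot.not_specGT hU i)
    · rcases lt_trichotomy i j with hij | rfl | hij
      · exact hSS i j P Q hij hP' hi hQ' hj
      · rw [ih (height_swap hi) hP' hQ']
      · exact (hSS j i Q P hij hQ' hj hP' hi).symm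
    · exact hSA i g P Q hP' hi hQ' hg
    · exact absurd hf (hR U hU heU f hP'.isLabel)
    · exact (hSA j f Q P hQ' hj hP' hf).symm
    · subst hf
      obtain rfl := affineL_injective hg
      rw [ih (height_lt_affineL hP'.isLabel) hP' hQ']

end Graph

/-! ### Eigenvalues of the Cherednik operators -/

section Spectrum

variable {K : Type*} [Field K] {n : ℕ} {μ : YoungDiagram} {q s : K}

open Filling

/-- The greatest entry lies in the corner of the diagram. -/
theorem RST.ct_last (A : RST n μ) : A.ct (Fin.last n) = 0 := by
  obtain ⟨i, hr, hc⟩ := A.exists_entry (μ.up_left_mem (Nat.zero_le _) (Nat.zero_le _)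
    (A.row_col_mem (Fin.last n)))
  have hi : i = Fin.last n := by
    by_contra hne
    exact absurd (A.lt_of_le (by omega) (by omega) hne) (Fin.le_last i).not_gt
  subst hi
  simp [ct, hr, hc]

/-- The content of the entry `k` of a filling. -/
def Filling.content (F : Filling n μ) (k : Fin (n + 1)) : ℤ :=
  ((F k : ℕ × ℕ).2 : ℤ) - (F k : ℕ × ℕ).1

theorem diagCoeff_mul (h : Generic q s) {m : ℤ} (hm : m ≠ 0) :
    (s ^ m - 1) * diagCoeff s m = 1 - s := by
  have h1 : 1 - s ^ m ≠ 0 := sub_ne_zero.mpr (h.s_zpow_ne m hm).symm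
  unfold diagCoeff
  field_simp
  ring

/-- On constants the Cherednik operators act as Jucys–Murphy elements: tableaux are eigenvectors,
and the eigenvalues are given by the contents. -/
theorem rXi_tensF (h : Generic q s) (k : Fin (n + 1)) (F : Filling n μ) :
    (rXi μ n q s k).unop (tensF 1 F) = s ^ content F k • tensF 1 F := by
  induction k using Fin.reverseInduction generalizing F with
  | last =>
    by_cases hF : ∃ A : RST n μ, A.cell = F
    · obtain ⟨A, rfl⟩ := hF
      have : content A.cell (Fin.last n) = 0 := A.ct_last
      rw [tensF_cell, Fin.val_last, (isCherednikFamily q s).last, ← cherednikLast_eq, unop_op,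
        cherednikLast_const h (tens_one_mem A), this, zpow_zero, one_smul]
    · rw [tensF_of_not _ hF, map_zero, smul_zero]
  | cast k ih =>
    by_cases hF : ∃ A : RST n μ, A.cell = F
    swap
    · rw [tensF_of_not _ hF, map_zero, smul_zero]
    obtain ⟨A, rfl⟩ := hF
    have h1 : s ≠ 1 := by simpa using h.s_zpow_ne 1 one_ne_zero
    have hm : diff A.cell k ≠ 0 := by
      rw [diff_cell, sub_ne_zero]
      exact (A.ct_ne (by simp [Fin.lt_def]) (by simp)).symm
    have hT : ∀ F : Filling n μ, boldT s k (tensF 1 F) = tabT s k (tensF 1 F) := fun F => by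
      by_cases hF : ∃ A : RST n μ, A.cell = F
      · obtain ⟨A, rfl⟩ := hF
        rw [tensF_cell, boldT_const _ _ (tens_one_mem A)]
      · rw [tensF_of_not _ hF, map_zero, map_zero]
    have c1 : content A.cell k.succ = content A.cell k.castSucc + diff A.cell k := by
      simp only [content, diff]; ring
    have c2 : content (swap A.cell k) k.succ = content A.cell k.castSucc := by
      simp [content, swap]
    have d1 := diagCoeff_mul h hm
    have d2 := diagCoeff_add_neg h.s_ne (h.s_zpow_ne _ hm)
    have d3 := offCoeff_mul_neg h.s_ne (h.s_zpow_ne _ hm)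
    rw [Fin.val_castSucc, (isCherednikFamily q s).step k k.2, ← Fin.val_succ, rT_val, unop_smul,
      unop_mul, unop_mul, unop_op, LinearMap.smul_apply, Module.End.mul_apply,
      Module.End.mul_apply]
    simp only [hT, tabT_tensF h.s_ne h1, map_add, map_smul, ih, diff_swap,
      swap_swap, c1, c2, zpow_add₀ h.s_ne]
    set m := diff A.cell k
    set c := s ^ content A.cell k.castSucc
    set z := s ^ m
    have hs := h.s_ne
    have e1 : s⁻¹ * (c * z * (diagCoeff s m * diagCoeff s m)
        + c * (offCoeff s m * offCoeff s (-m))) = c := by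
      rw [d3]
      field_simp
      linear_combination c * diagCoeff s m * d1
    have e2 : s⁻¹ * (offCoeff s m * c * (z * diagCoeff s m + diagCoeff s (-m))) = 0 := by
      rw [show z * diagCoeff s m + diagCoeff s (-m) = 0 by linear_combination d1 + d2]
      ring
    calc _ = (s⁻¹ * (c * z * (diagCoeff s m * diagCoeff s m)
        + c * (offCoeff s m * offCoeff s (-m)))) • tensF 1 A.cell
        + (s⁻¹ * (offCoeff s m * c * (z * diagCoeff s m + diagCoeff s (-m))))
          • tensF 1 (swap A.cell k) := by module
      _ = _ := by rw [e1, e2, zero_smul, add_zero]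

/-- The polynomial at a vertex is a common eigenvector of the Cherednik operators, and the
eigenvalues form the spectral vector. -/
theorem IsSpectral.eigen (h : Generic q s) {e : Fin (n + 1) → ℤ × ℤ} {P : VPoly K n μ}
    (hP : IsSpectral q s e P) (k : Fin (n + 1)) :
    (rXi μ n q s k).unop P = weight q s (e k) • P := by
  have hL := h.isDoubleHecke (n := n) (μ := μ)
  have hY := isCherednikFamily (n := n) (μ := μ) q s
  have hC := hL.cherednik_conj hY
  induction hP generalizing k with
  | root T hT =>
    have := rXi_tensF (q := q) h k T.cell
    rw [tensF_cell] at this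
    rw [this]
    simp [weight, label, sExp, rank_zero, content, ct, row, col]
  | swap e P i hP hgt ih =>
    set y := weight q s (e i.castSucc) with hy
    set x := weight q s (e i.succ) with hx
    set g := stepCoeff q s (e i.succ) (e i.castSucc) with hg
    have hgxy : g * (x - y) = (1 - s) * x := h.stepCoeff_mul hgt.ne.symm
    have ih1 : (rXi μ n q s i).unop P = x • P := by
      simpa using ih i.castSucc
    have ih2 : (rXi μ n q s (i + 1 : ℕ)).unop P = y • P := by
      simpa using ih i.succ
    have ev : ∀ Y : ROp K n μ, Y.unop ((rStep μ n s g i).unop P)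
        = (rT μ n s i * Y).unop P + g • Y.unop P := fun Y => by
      rw [rStep, unop_add, LinearMap.add_apply, map_add, unop_smul, unop_one,
        LinearMap.smul_apply, map_smul, unop_mul]
      rfl
    have ev1 : (rStep μ n s g i).unop P = (rT μ n s i).unop P + g • P := ev 1
    by_cases h1 : k = i.castSucc
    · subst h1
      have hT : rT μ n s i * rXi μ n q s i
          = (s - 1) • rXi μ n q s i + rXi μ n q s (i + 1) * rT μ n s i := by
        rw [hY.step i i.2, mul_smul_comm, ← mul_assoc, ← mul_assoc, hL.quad i i.2]
        simp only [add_mul, smul_add, smul_mul_assoc, one_mul, smul_smul]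
        rw [inv_mul_cancel₀ h.s_ne, one_smul, mul_comm]
      rw [ev, Fin.val_castSucc, hT, ih1, unop_add, LinearMap.add_apply, unop_smul,
        LinearMap.smul_apply, unop_mul, Module.End.mul_apply, ih1, ih2, map_smul, ev1, smul_add,
        smul_smul, smul_smul, smul_smul, ← hy]
      have : (s - 1) * x + g * x = y * g := by linear_combination hgxy
      rw [← this]
      module
    by_cases h2 : k = i.succ
    · subst h2
      have hT := hL.T_conj hC i.2
      rw [ev, Fin.val_succ, hT, ih2, unop_mul, Module.End.mul_apply, ih1, map_smul, unop_add,
        LinearMap.add_apply, unop_smul, unop_one, LinearMap.smul_apply, Module.End.one_apply, ev1,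
        ← hx]
      have : x * (1 - s) + g * y = x * g := by linear_combination -hgxy
      rw [smul_add x _ (g • P), smul_smul x g, ← this]
      module
    · have hc := hL.commute_conj hC (i := k) (by omega) i i.2
        (fun e => h1 (Fin.ext e.symm)) (fun e => h2 (Fin.ext (by rw [← e, Fin.val_succ])))
      have ihk := ih k
      rw [Function.comp_apply, Equiv.swap_apply_of_ne_of_ne h1 h2] at ihk
      rw [ev, hc.eq, unop_mul, Module.End.mul_apply, ihk, map_smul, ev1]
      module
  | affine e P hP ih =>
    refine Fin.lastCases ?_ (fun k => ?_) k
    · have := hL.raise_cherednik_last hY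
      rw [← Module.End.mul_apply, ← unop_mul, Fin.val_last, rRaise, this, unop_smul,
        LinearMap.smul_apply, unop_mul, Module.End.mul_apply]
      have ih0 := ih 0
      rw [Fin.val_zero] at ih0
      rw [ih0, map_smul, smul_smul, affineL_last, h.weight_add, mul_comm q]
      simp [weight]
    · have := hL.raise_cherednik hY k.2
      have ihk := ih k.succ
      rw [Fin.val_succ] at ihk
      rw [← Module.End.mul_apply, ← unop_mul, Fin.val_castSucc, rRaise, this, unop_mul,
        Module.End.mul_apply, ihk, map_smul, affineL_castSucc]

end Spectrum

/-! ### The value of the square -/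

section Norm

variable {K : Type*} [Field K] {n : ℕ} {μ : YoungDiagram} {q s : K}

open Classical in
/-- The factor of `△` for the entries `ζ[i]`, `ζ[j] q^k` with exponents `a`, `b`. -/
noncomputable def rhoFactor (q s : K) (a b : ℤ × ℤ) : K :=
  if SpecGT a b then rho s (weight q s b) (weight q s a) else 1

/-- The product of the factors of `△` for the entries with exponents `a`, `b` over all `k ≥ 1`. -/
noncomputable def rhoProd (q s : K) (a b : ℤ × ℤ) : K :=
  ∏ k ∈ Finset.range (a.1 - b.1).toNat, rhoFactor q s a (b + ((k : ℤ) + 1, 0))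

/-- `△` in terms of exponents: the factors with `k ≥ 1` belong to all pairs, those with `k = 0` only
to the pairs in increasing position. -/
noncomputable def triangleL (q s : K) (e : Fin (n + 1) → ℤ × ℤ) : K :=
  (∏ i, ∏ j, rhoProd q s (e i) (e j)) * pairProd (rhoFactor q s) e

/-- `□` in terms of exponents. -/
noncomputable def boxL (q s : K) (e : Fin (n + 1) → ℤ × ℤ) : K :=
  ∏ i, qPoch (q * s ^ (e i).2) q (e i).1.toNat

theorem rhoProd_eq {a b : ℤ × ℤ} {M : ℕ} (hM : a.1 - b.1 ≤ M) :
    rhoProd q s a b = ∏ k ∈ Finset.range M, rhoFactor q s a (b + ((k : ℤ) + 1, 0)) := by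
  refine Finset.prod_subset (fun k hk => ?_) fun k _ hk => ?_
  · rw [Finset.mem_range] at *
    omega
  · rw [Finset.mem_range] at hk
    rw [rhoFactor, if_neg]
    simp only [SpecGT, Prod.fst_add, Prod.snd_add]
    omega

theorem Generic.rhoFactor_add (h : Generic q s) (a b : ℤ × ℤ) :
    rhoFactor q s (a + (1, 0)) (b + (1, 0)) = rhoFactor q s a b := by
  have h1 : SpecGT (a + (1, 0)) (b + (1, 0)) ↔ SpecGT a b := by
    simp only [SpecGT, Prod.fst_add, Prod.snd_add]
    omega
  have hw : weight q s (1, 0) ≠ 0 := h.weight_ne_zero _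
  have h2 : ∀ x y c : K, c ≠ 0 → rho s (x * c) (y * c) = rho s x y := fun x y c hc => by
    unfold rho
    rw [show (x * c - s⁻¹ * (y * c)) * (x * c - s * (y * c))
      = (x - s⁻¹ * y) * (x - s * y) * c ^ 2 by ring,
      show (x * c - y * c) ^ 2 = (x - y) ^ 2 * c ^ 2 by ring,
      mul_div_mul_right _ _ (pow_ne_zero 2 hc)]
  by_cases hab : SpecGT a b
  · rw [rhoFactor, rhoFactor, if_pos hab, if_pos (h1.mpr hab), h.weight_add, h.weight_add,
      h2 _ _ _ hw]
  · rw [rhoFactor, rhoFactor, if_neg hab, if_neg fun h' => hab (h1.mp h')]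

/-- Shifting the greater entry turns the factor with `k = 0` into the one with `k = 1`. -/
theorem Generic.rhoProd_add_left (h : Generic q s) (a b : ℤ × ℤ) :
    rhoProd q s (a + (1, 0)) b = rhoFactor q s a b * rhoProd q s a b := by
  have hM : a.1 - b.1 ≤ (a.1 - b.1).toNat := by omega
  rw [rhoProd_eq (M := (a.1 - b.1).toNat + 1) (by simp only [Prod.fst_add]; omega),
    rhoProd_eq hM, Finset.prod_range_succ', mul_comm]
  congr 1
  · rw [← h.rhoFactor_add a b]
    simp
  · refine Finset.prod_congr rfl fun k _ => ?_
    rw [← h.rhoFactor_add a]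
    congr 1
    ext
    · simp; ring
    · simp

/-- Shifting the smaller entry drops the factor with `k = 1` and restores the one with `k = 0`. -/
theorem rhoProd_add_right (a b : ℤ × ℤ) :
    rhoProd q s b (a + (1, 0)) * rhoFactor q s b (a + (1, 0)) = rhoProd q s b a := by
  have hM : b.1 - a.1 ≤ ((b.1 - a.1).toNat + 1 : ℕ) := by omega
  rw [rhoProd_eq (M := (b.1 - a.1).toNat) (by simp only [Prod.fst_add]; omega),
    rhoProd_eq hM, Finset.prod_range_succ']
  congr 1
  · refine Finset.prod_congr rfl fun k _ => ?_
    congr 1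
    ext
    · simp; ring
    · simp

theorem triangleL_swap {e : Fin (n + 1) → ℤ × ℤ} {k : Fin n}
    (hk : SpecGT (e k.castSucc) (e k.succ)) :
    triangleL q s e = triangleL q s (e ∘ Equiv.swap k.castSucc k.succ)
      * rho s (weight q s (e k.succ)) (weight q s (e k.castSucc)) := by
  have h1 := pairProd_swap (rhoFactor q s) e k
  rw [rhoFactor, if_pos hk, rhoFactor, if_neg hk.asymm, mul_one] at h1
  have h2 : ∏ i, ∏ j, rhoProd q s ((e ∘ Equiv.swap k.castSucc k.succ) i)
      ((e ∘ Equiv.swap k.castSucc k.succ) j) = ∏ i, ∏ j, rhoProd q s (e i) (e j) := by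
    rw [← Equiv.prod_comp (Equiv.swap k.castSucc k.succ)
      (fun i => ∏ j, rhoProd q s (e i) (e j))]
    refine Finset.prod_congr rfl fun i _ => ?_
    exact Equiv.prod_comp (Equiv.swap k.castSucc k.succ) fun j => rhoProd q s _ (e j)
  rw [triangleL, triangleL, h2, mul_assoc, h1]

theorem boxL_swap (e : Fin (n + 1) → ℤ × ℤ) (k : Fin n) :
    boxL q s (e ∘ Equiv.swap k.castSucc k.succ) = boxL q s e :=
  Equiv.prod_comp (Equiv.swap k.castSucc k.succ)
    fun i => qPoch (q * s ^ (e i).2) q (e i).1.toNat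

theorem pairProd_eq {α : Type*} (g : α → α → K) (e : Fin n → α) :
    pairProd g e = ∏ i, ∏ j, if i < j then g (e i) (e j) else 1 := by
  rw [pairProd, Finset.prod_filter, Finset.univ_product_univ.symm, Finset.prod_product]

theorem triangleL_affineL (h : Generic q s) (e : Fin (n + 1) → ℤ × ℤ) :
    triangleL q s (affineL e) = triangleL q s e := by
  have hd : ∀ a : ℤ × ℤ, rhoProd q s a a = 1 := fun a => by simp [rhoProd]
  have e1 : ∏ i, ∏ j, rhoProd q s (affineL e i) (affineL e j)
      = (∏ i : Fin n, ∏ j : Fin n, rhoProd q s (e i.succ) (e j.succ))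
        * (∏ i : Fin n, rhoProd q s (e i.succ) (e 0 + (1, 0)))
        * ∏ j : Fin n, rhoProd q s (e 0 + (1, 0)) (e j.succ) := by
    rw [Fin.prod_univ_castSucc]
    simp only [Fin.prod_univ_castSucc (n := n), affineL_castSucc, affineL_last, hd, mul_one,
      Finset.prod_mul_distrib]
  have e2 : ∏ i, ∏ j, rhoProd q s (e i) (e j)
      = (∏ i : Fin n, ∏ j : Fin n, rhoProd q s (e i.succ) (e j.succ))
        * (∏ i : Fin n, rhoProd q s (e i.succ) (e 0))
        * ∏ j : Fin n, rhoProd q s (e 0) (e j.succ) := by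
    rw [Fin.prod_univ_succ]
    simp only [Fin.prod_univ_succ (n := n), hd, one_mul, Finset.prod_mul_distrib]
    ring
  have e3 : pairProd (rhoFactor q s) (affineL e)
      = pairProd (rhoFactor q s) (fun i : Fin n => e i.succ)
        * ∏ i : Fin n, rhoFactor q s (e i.succ) (e 0 + (1, 0)) := by
    rw [pairProd_eq, pairProd_eq, Fin.prod_univ_castSucc]
    simp only [Fin.prod_univ_castSucc (n := n), affineL_castSucc, affineL_last,
      Fin.castSucc_lt_castSucc_iff, Fin.castSucc_lt_last, if_true, if_false,
      (Fin.le_last _).not_gt, Finset.prod_const_one, mul_one, Finset.prod_mul_distrib]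
  have e4 : pairProd (rhoFactor q s) e
      = pairProd (rhoFactor q s) (fun i : Fin n => e i.succ)
        * ∏ i : Fin n, rhoFactor q s (e 0) (e i.succ) := by
    rw [pairProd_eq, pairProd_eq, Fin.prod_univ_succ]
    simp only [Fin.prod_univ_succ (n := n), Fin.succ_lt_succ_iff, Fin.succ_pos, if_true,
      lt_self_iff_false, if_false, Fin.not_lt_zero, one_mul]
    ring
  simp only [triangleL, e1, e2, e3, e4, h.rhoProd_add_left, Finset.prod_mul_distrib,
    ← rhoProd_add_right (q := q) (s := s) (e 0)]
  ring

theorem boxL_affineL {e : Fin (n + 1) → ℤ × ℤ} (he : IsLabel μ e) :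
    boxL q s (affineL e) = boxL q s e * (1 - q * weight q s (e 0)) := by
  obtain ⟨a, ha⟩ : ∃ a : ℕ, (e 0).1 = a := ⟨_, (Int.toNat_of_nonneg (he.nonneg 0)).symm⟩
  have h1 : ((a : ℤ) + 1).toNat = a + 1 := by omega
  rw [boxL, boxL, Fin.prod_univ_castSucc, Fin.prod_univ_succ]
  simp only [affineL_castSucc, affineL_last, Prod.fst_add, Prod.snd_add, add_zero, ha, h1,
    Int.toNat_natCast, weight, zpow_natCast]
  rw [qPoch, Finset.prod_range_succ, qPoch]
  ring

theorem triangle_eq (h : Generic q s) (v : Fin (n + 1) → ℕ) (T : RST n μ) :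
    triangle q s v T = triangleL q s (label v T) := by
  classical
  have hw : ∀ (j : Fin (n + 1)) (k : ℕ), zeta q s v T j * q ^ k
      = weight q s (label v T j + ((k : ℤ), 0)) := fun j k => by
    rw [zeta_eq, h.weight_add]
    simp [weight]
  have key : ∀ i j : Fin (n + 1),
      (∏ k ∈ (Finset.range (v i + 1)).filter (fun k => chi i j ≤ k ∧
        SpecGT ((v i : ℤ), sExp v T i) ((v j : ℤ) + (k : ℤ), sExp v T j)),
        rho s (zeta q s v T j * q ^ k) (zeta q s v T i))
      = rhoProd q s (label v T i) (label v T j)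
        * if i < j then rhoFactor q s (label v T i) (label v T j) else 1 := fun i j => by
    have hl : ∀ k : ℕ, label v T j + ((k : ℤ), 0) = ((v j : ℤ) + (k : ℤ), sExp v T j) := fun k => by
      simp [label]
    rw [Finset.prod_filter, Finset.prod_range_succ',
      rhoProd_eq (M := v i) (by simp [label])]
    congr 1
    · refine Finset.prod_congr rfl fun k _ => ?_
      have hc : chi i j ≤ k + 1 := by unfold chi; split_ifs <;> omega
      rw [hw, ← hl, zeta_eq, rhoFactor, Nat.cast_add_one]
      by_cases hg : SpecGT (label v T i) (label v T j + ((k : ℤ) + 1, 0))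
      · rw [if_pos hg, if_pos ⟨hc, hg⟩]
      · rw [if_neg hg, if_neg fun h' => hg h'.2]
    · rw [hw, ← hl, zeta_eq, rhoFactor, Nat.cast_zero, show ((0 : ℤ), (0 : ℤ)) = 0 from rfl,
        add_zero]
      by_cases hij : i < j
      · have hc : chi i j ≤ 0 := by rw [chi, if_neg hij.not_gt]
        by_cases hg : SpecGT (label v T i) (label v T j)
        · rw [if_pos hij, if_pos hg, if_pos ⟨hc, hg⟩]
        · rw [if_pos hij, if_neg hg, if_neg fun h' => hg h'.2]
      · rw [if_neg hij, if_neg]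
        rintro ⟨hc, hg⟩
        have hji : ¬ j < i := fun h' => by rw [chi, if_pos h'] at hc; omega
        rw [le_antisymm (not_lt.mp hij) (not_lt.mp hji)] at hg
        exact hg.asymm hg
  rw [triangle, triangleL, pairProd_eq, Finset.prod_comm]
  simp only [← Finset.prod_mul_distrib]
  refine Finset.prod_congr rfl fun i _ => Finset.prod_congr rfl fun j _ => ?_
  rw [← key i j]

theorem box_eq (v : Fin (n + 1) → ℕ) (T : RST n μ) : box q s v T = boxL q s (label v T) := by
  simp [box, boxL, label]

theorem nuFactor_eq (h : Generic q s) (a b : ℤ) :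
    nuFactor s a b = rhoFactor q s (0, a) (0, b) := by
  have h1 : SpecGT (0, a) (0, b) ↔ a - b ≤ -2 := by
    simp only [SpecGT, lt_self_iff_false, false_or, true_and]
    omega
  by_cases hab : a - b ≤ -2
  · rw [nuFactor, rhoFactor, if_pos hab, if_pos (h1.mpr hab)]
    have hs := h.s_ne
    have hne : s ^ b - s ^ a ≠ 0 := by
      intro e
      have := h.s_zpow_ne (b - a) (by omega)
      rw [zpow_sub₀ hs, sub_eq_zero.mp e, div_self (zpow_ne_zero _ hs)] at this
      exact this rfl
    have ha : s ^ a ≠ 0 := zpow_ne_zero _ hs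
    have hne' : s ^ a - s ^ b ≠ 0 := by rw [← neg_sub]; exact neg_ne_zero.mpr hne
    simp only [weight, rho, zpow_zero, one_mul, zpow_sub₀ hs, zpow_add₀ hs, zpow_one]
    have e : 1 - s ^ b / s ^ a = (s ^ a - s ^ b) / s ^ a := by field_simp
    rw [e]
    have e' : (s ^ a - s ^ b) ^ 2 = (s ^ b - s ^ a) ^ 2 := by ring
    rw [div_pow, e']
    field_simp
    ring
  · rw [nuFactor, rhoFactor, if_neg hab, if_neg fun h' => hab (h1.mp h')]

theorem norm_root (h : Generic q s) (T : RST n μ) :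
    nu s T = boxL q s (label 0 T) * triangleL q s (label 0 T) := by
  have h1 : boxL q s (label 0 T) = 1 := by simp [boxL, label, qPoch]
  have h2 : ∏ i, ∏ j, rhoProd q s (label 0 T i) (label 0 T j) = 1 :=
    Finset.prod_eq_one fun i _ => Finset.prod_eq_one fun j _ => by simp [rhoProd, label]
  rw [h1, one_mul, triangleL, h2, one_mul, nu_eq]
  simp only [pairProd, nuFactor_eq h, label, sExp, rank_zero,
    Pi.zero_apply, Nat.cast_zero]

/-- The form on raised polynomials: the Dunkl operator of the last variable undoes the raising up to
the factor `1 - q ζ[1]`. -/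
theorem pairing_rRaise (h : Generic q s) {e : Fin (n + 1) → ℤ × ℤ} {P' P : VPoly K n μ}
    (hP : IsSpectral q s e P) :
    pairing q s ((rRaise μ n s⁻¹).unop P') ((rRaise μ n s).unop P)
      = (1 - q * weight q s (e 0)) * pairing q s P' P := by
  set A := ascProd (rT' μ n s) n with hA
  have e1 : ∀ (s : K) (P : VPoly K n μ), (rRaise μ n s).unop P
      = mulX (Fin.last n) ((ascProd (rT' μ n s) n).unop P) := fun s P => by
    rw [rRaise, IsDoubleHecke.raise, rX_last]
    rfl
  have hD : dunkl q s (Fin.last n) ((rRaise μ n s).unop P)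
      = (1 - q * weight q s (e 0)) • A.unop P := by
    apply mulX_injective (Fin.last n)
    have hx := (isDunklFamily (n := n) (μ := μ) h).last_X
    rw [show rD μ n q s n = op (dunkl q s (Fin.last n)) from rD_val q s (Fin.last n), rX_last,
      ← (isCherednikFamily q s).last] at hx
    have hx' := LinearMap.congr_fun (congrArg unop hx) ((rRaise μ n s).unop P)
    have hev := (IsSpectral.affine e P hP).eigen h (Fin.last n)
    rw [Fin.val_last, affineL_last, h.weight_add] at hev
    rw [unop_sub, LinearMap.sub_apply, hev, unop_mul, Module.End.mul_apply] at hx'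
    simp only [unop_op, unop_one, Module.End.one_apply] at hx'
    rw [hx', map_smul, hA, ← e1]
    simp only [weight, zpow_one, zpow_zero, mul_one]
    module
  rw [e1 s⁻¹, pairing_mulX h, hD, map_smul, smul_eq_mul,
    IsUnitary.ascProd (fun i hi => isUnitary_T' h hi) P' P]

theorem weight_inv (a : ℤ × ℤ) : weight q⁻¹ s⁻¹ a = (weight q s a)⁻¹ := by
  rw [weight, weight, mul_inv, inv_zpow, inv_zpow]

theorem rho_eq (h : Generic q s) {a b : ℤ × ℤ} (hab : a ≠ b) :
    1 - stepCoeff q s a b * stepCoeff q⁻¹ s⁻¹ a b = rho s (weight q s a) (weight q s b) := by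
  have h1 := h.weight_ne_zero a
  have h2 := h.weight_ne_zero b
  have h3 : weight q s a - weight q s b ≠ 0 := sub_ne_zero.mpr (h.weight_injective.ne hab)
  have h4 : weight q s b - weight q s a ≠ 0 := sub_ne_zero.mpr (h.weight_injective.ne hab.symm)
  have hs := h.s_ne
  have e1 := h.stepCoeff_mul hab
  have e2 := h.inv.stepCoeff_mul hab
  rw [← eq_div_iff h3] at e1
  have e3 : stepCoeff q⁻¹ s⁻¹ a b = (1 - s⁻¹) * weight q s b / (weight q s b - weight q s a) := by
    rw [weight_inv, weight_inv] at e2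
    rw [eq_div_iff h4]
    field_simp at e2
    field_simp
    linear_combination e2
  rw [e1, e3, rho]
  field_simp
  ring

/-- The form on the polynomials at the end of an exchange: the cross terms vanish by
orthogonality. -/
theorem pairing_rStep (h : Generic q s) {e : Fin (n + 1) → ℤ × ℤ} {k : Fin n} {P' P : VPoly K n μ}
    (hgt : SpecGT (e k.castSucc) (e k.succ))
    (hP' : IsSpectral q⁻¹ s⁻¹ (e ∘ Equiv.swap k.castSucc k.succ) P')
    (hP : IsSpectral q s (e ∘ Equiv.swap k.castSucc k.succ) P) :
    pairing q s ((rStep μ n s⁻¹ (stepCoeff q⁻¹ s⁻¹ (e k.succ) (e k.castSucc)) k).unop P')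
        ((rStep μ n s (stepCoeff q s (e k.succ) (e k.castSucc)) k).unop P)
      = pairing q s P' P * rho s (weight q s (e k.succ)) (weight q s (e k.castSucc)) := by
  have hQ' := hP'.swap _ _ k hgt
  have hQ := hP.swap _ _ k hgt
  rw [← rho_eq h hgt.ne.symm]
  set g := stepCoeff q s (e k.succ) (e k.castSucc)
  set g' := stepCoeff q⁻¹ s⁻¹ (e k.succ) (e k.castSucc)
  have orth : ∀ {f f' : Fin (n + 1) → ℤ × ℤ} {R' R : VPoly K n μ}, IsSpectral q⁻¹ s⁻¹ f' R' →
      IsSpectral q s f R → f' k.castSucc ≠ f k.castSucc → pairing q s R' R = 0 := by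
    intro f f' R' R hR' hR hne
    refine pairing_eq_zero h (k := k.castSucc) (by simp) (hR'.eigen h.inv _) (hR.eigen h _) ?_
    rw [weight_inv]
    exact fun e => h.weight_injective.ne hne ((inv_mul_eq_one₀ (h.weight_ne_zero _)).mp e)
  have o1 := orth hP' hQ (by simpa using hgt.ne.symm)
  have o2 := orth hQ' hP (by simpa using hgt.ne)
  have u := isUnitary_T (n := n) (μ := μ) h k.2 P' P
  have ev : ∀ (s c : K) (R : VPoly K n μ), (rStep μ n s c k).unop R = (rT μ n s k).unop R + c • R :=
    fun s c R => by rw [rStep]; rfl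
  rw [ev] at o1 o2 ⊢
  simp only [ev, map_add, map_smul, LinearMap.add_apply, LinearMap.smul_apply, smul_eq_mul] at *
  linear_combination u + g' * o1 + g * o2

/-- The norm formula on labels. -/
theorem IsSpectral.norm (h : Generic q s) {e : Fin (n + 1) → ℤ × ℤ} {P' P : VPoly K n μ}
    (hP' : IsSpectral q⁻¹ s⁻¹ e P') (hP : IsSpectral q s e P) :
    pairing q s P' P = boxL q s e * triangleL q s e := by
  induction hP generalizing P' with
  | root T hT =>
    rw [hP'.unique h.inv (.root T hT), ← norm_root h, (isCanonicalForm h).tableau, if_pos rfl]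
  | swap e P k hP hgt ih =>
    obtain ⟨R', hR'⟩ := hP.isLabel.exists_isSpectral q⁻¹ s⁻¹
    rw [hP'.unique h.inv (hR'.swap _ _ k hgt), pairing_rStep h hgt hR' hP, ih hR', boxL_swap,
      triangleL_swap hgt, mul_assoc]
  | affine e P hP ih =>
    obtain ⟨R', hR'⟩ := hP.isLabel.exists_isSpectral q⁻¹ s⁻¹
    rw [hP'.unique h.inv (.affine e R' hR'), pairing_rRaise h hP, ih hR', boxL_affineL hP.isLabel,
      triangleL_affineL h]
    ring

theorem generic_of_algebraicIndependent [Algebra ℚ K] (hqs : AlgebraicIndependent ℚ ![q, s]) :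
    Generic q s := by
  have hq : q ≠ 0 := by simpa using hqs.ne_zero 0
  have hs : s ≠ 0 := by simpa using hqs.ne_zero 1
  have key : ∀ a b c d : ℕ, q ^ a * s ^ b = q ^ c * s ^ d → a = c ∧ b = d := by
    intro a b c d e
    have h1 : (X 0 ^ a * X 1 ^ b : MvPolynomial (Fin 2) ℚ) = X 0 ^ c * X 1 ^ d :=
      hqs (by simpa using e)
    simp only [X_pow_eq_monomial, monomial_mul, mul_one] at h1
    have h2 := monomial_left_injective (one_ne_zero (α := ℚ)) h1
    exact ⟨by simpa using DFunLike.congr_fun h2 0, by simpa using DFunLike.congr_fun h2 1⟩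
  refine ⟨hq, hs, fun a b e => ?_⟩
  have h1 : ∀ (x : K) (m : ℤ), x ≠ 0 → x ^ m = x ^ m.toNat / x ^ (-m).toNat := fun x m hx => by
    rw [← zpow_natCast, ← zpow_natCast, ← zpow_sub₀ hx]
    congr 1
    omega
  rw [h1 q a hq, h1 s b hs, div_mul_div_comm, div_eq_one_iff_eq
    (mul_ne_zero (pow_ne_zero _ hq) (pow_ne_zero _ hs))] at e
  have := key _ _ _ _ e
  omega

end Norm

end VVMac

open VVMac
theorem mainTheorem2 {K : Type*} [Field K] [Algebra ℚ K] (q s : K)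
    (hqs : AlgebraicIndependent ℚ ![q, s])
    (n : ℕ) (μ : YoungDiagram) (hμ : μ.card = n + 1) :
    IsCanonicalForm (n := n) (μ := μ) q s (pairing q s) ∧
    ∀ (v : Fin (n + 1) → ℕ) (T : RST n μ),
      (∃! P : VPoly K n μ, IsMacdonald q s T v P) ∧
      (∃! Pstar : VPoly K n μ, IsMacdonald q⁻¹ s⁻¹ T v Pstar) ∧
      ∀ Pstar P : VPoly K n μ, IsMacdonald q⁻¹ s⁻¹ T v Pstar → IsMacdonald q s T v P →
        pairing q s Pstar P = box q s v T * triangle q s v T := by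
  have h := generic_of_algebraicIndependent hqs
  have key : ∀ {q s : K}, Generic q s → ∀ (v : Fin (n + 1) → ℕ) (T : RST n μ),
      ∃! P : VPoly K n μ, IsMacdonald q s T v P := by
    intro q s h v T
    obtain ⟨P, hP⟩ := IsLabel.exists_isSpectral q s ⟨v, T, rfl⟩
    exact ⟨P, isSpectral_iff.mp hP, fun Q hQ => hQ.isSpectral.unique h hP⟩
  refine ⟨isCanonicalForm h, fun v T => ⟨key h v T, key h.inv v T, fun P' P hP' hP => ?_⟩⟩
  rw [box_eq, triangle_eq h, hP'.isSpectral.norm h hP.isSpectral]
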